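/- **Definitions.** Fix $n\ge 1$. A simplex in $\mathbb R^n$ is *rational* if its vertices lie in $\mathbb Q^n$; a *rational polyhedron* in $\mathbb R^n$ is a finite (possibly empty) union of rational simplexes, and $\mathscr P^{(n)}$ is the set of all of these. For $x\in\mathbb Q^n$ let $\operatorname{den}(x)\ge 1$ be the least common denominator of the coordinates of $x$, and $\tilde x=\operatorname{den}(x)(x,1)\in\mathbb Z^{n+1}$. A rational simplex $\operatorname{conv}(v_0,\dots,v_m)$ is *regular* if $\tilde v_0,\dots,\tilde v_m$ are part of a basis of the free abelian group $\mathbb Z^{n+1}$. A *triangulation* of $P$ is a finite simplicial complex with support $P$; it is *regular* if all its simplexes are. The *$i$-dimensional part* $P^{(i)}$ of a polyhedron $P$ is the union of all maximal $i$-simplexes (those not properly contained in another simplex of the triangulation) of a triangulation of $P$. For $P\in\mathscr P^{(n)}$ and $d=0,1,\dots$, the *$d$-dimensional rational measure* of $P$ is $$\lambda_d(P)=\sum_T \frac{1}{d!\,\prod_{v}\operatorname{den}(v)},$$ where $T$ ranges over the maximal $d$-simplexes of a regular triangulation of $P$, and $v$ over the vertices of $T$. Two rational polyhedra $P\subseteq\mathbb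 R^n$ and $P'\subseteq\mathbb R^{n'}$ are *$\mathbb Z$-homeomorphic* if there is a homeomorphism $\eta$ of $P$ onto $P'$ such that $\eta$ and $\eta^{-1}$ are piecewise (affine) linear, with finitely many pieces, all with integer coefficients. A *rational affine subspace* of $\mathbb R^n$ is the intersection of a finite (possibly empty) set of hyperplanes $\{x\mid a\cdot x+t=0\}$ with $0\neq a\in\mathbb Q^n$, $t\in\mathbb Q$. **Theorem.** Let $n\ge 1$. Every $P\in\mathscr P^{(n)}$ has a regular triangulation; for $P\in\mathscr P^{(n)}$, $\lambda_d(P)\ge 0$ does not depend on the regular triangulation of $P$ used to compute it, and $P^{(i)}$ does not depend on the triangulation of $P$. Moreover, for all $d=0,1,\dots$ and all $P,Q\in\mathscr P^{(n)}$: 1. **(Invariance)** If $P=\gamma(Q)$ for some $\gamma\in\mathcal G_n=GL(n,\mathbb Z)\ltimes\mathbb Z^n$ (the group of maps $x\mapsto Ax+t$ with $A$ an integer matrix of determinant $\pm1$ and $t\in\mathbb Z^n$), then $\lambda_d(P)=\lambda_d(Q)$. More generally, if $P$ is $\mathbb Z$-homeomorphic to $P'\in\mathscr P^{(n')}$, $n'\ge1$,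 then $\lambda_d(P)=\lambda_d(P')$. 2. **(Valuation)** $\lambda_d(\emptyset)=0$; $P^{(d)}$ is a rational polyhedron and $\lambda_d(P)=\lambda_d(P^{(d)})$; and if $P,Q$ have dimension at most $d$, then $P\cup Q$ and $P\cap Q$ are rational polyhedra and $\lambda_d(P)+\lambda_d(Q)=\lambda_d(P\cup Q)+\lambda_d(P\cap Q)$. 3. **(Conservativity)** The set $(P,0)=\{(x,0)\in\mathbb R^{n+1}\mid x\in P\}$ is a rational polyhedron in $\mathbb R^{n+1}$ and $\lambda_d(P)=\lambda_d(P,0)$. 4. **(Pyramid)** For $k=1,\dots,n$, if $\operatorname{conv}(v_0,\dots,v_k)\subseteq\mathbb R^n$ is a regular $k$-simplex with $v_0\in\mathbb Z^n$, then $\lambda_k(\operatorname{conv}(v_0,\dots,v_k))=\lambda_{k-1}(\operatorname{conv}(v_1,\dots,v_k))/k$. 5. **(Normalization)** For $j=1,\dots,n$, if $B=\{w_1,\dots,w_j\}\subseteq\mathbb Z^n$ (with $w_1,\dots,w_j$ distinct) is part of a basis of the free abelian group $\mathbb Z^n$, then the closed parallelepiped $P_B=\{\sum_{i=1}^j\gamma_iw_i\mid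 0\le\gamma_i\le1\}$ is a rational polyhedron and $\lambda_j(P_B)=1$. 6. **(Proportionality)** For $m=0,\dots,n$ and every (nonempty) $m$-dimensional rational affine subspace $A$ of $\mathbb R^n$ there is a constant $\kappa_A>0$, depending only on $A$, such that $\lambda_m(Q)=\kappa_A\cdot\mathcal H^m(Q)$ for every rational $m$-simplex $Q\subseteq A$, where $\mathcal H^m$ is $m$-dimensional Hausdorff measure. -/

import Mathlib

open Set MeasureTheory Geometry
open scoped MeasureTheory

noncomputable section

namespace RationalMeasure

/-- Euclidean `n`-space. -/
abbrev E (n : ℕ) : Type := EuclideanSpace ℝ (Fin n)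

/-- The integer vector `z`, regarded as a point of `ℝⁿ`. -/
def intPoint {n : ℕ} (z : Fin n → ℤ) : E n := WithLp.toLp 2 (fun i => (z i : ℝ))

/-- A point of `ℝⁿ` all of whose coordinates are rational. -/
def IsRationalPoint {n : ℕ} (x : E n) : Prop := ∀ i, ∃ q : ℚ, x i = (q : ℝ)

/-- The least common denominator of the coordinates of a rational point `x`: the least positive
integer `q` such that `q x` is an integer vector. -/
def den {n : ℕ} (x : E n) : ℕ :=
  sInf {q : ℕ | 0 < q ∧ ∀ i, ∃ z : ℤ, (q : ℝ) * x i = (z : ℝ)}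

/-- The homogeneous correspondent `den(x) (x₁, …, xₙ, 1) ∈ ℤⁿ⁺¹` of a rational point `x`.
(The floors are exact, as `den(x) x` is an integer vector.) -/
def homog {n : ℕ} (x : E n) : Fin (n + 1) → ℤ :=
  Fin.snoc (α := fun _ => ℤ) (fun i => ⌊(den x : ℝ) * x i⌋) (den x : ℤ)

/-- The vectors `v i` are (distinct) members of some basis of the free abelian group `ℤᴺ`. -/
def IsPartOfBasis {ι : Type} {N : ℕ} (v : ι → (Fin N → ℤ)) : Prop :=
  ∃ (b : Module.Basis (Fin N) ℤ (Fin N → ℤ)) (f : ι ↪ Fin N), ∀ i, v i = b (f i)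

/-- The points `v i` are the vertices of a rational simplex. -/
def IsRationalSimplex {ι : Type} {n : ℕ} (v : ι → E n) : Prop :=
  AffineIndependent ℝ v ∧ ∀ i, IsRationalPoint (v i)

/-- The points `v i` are the vertices of a regular simplex: a rational simplex such that the
homogeneous correspondents of the vertices are part of a basis of `ℤⁿ⁺¹`. -/
def IsRegularSimplex {ι : Type} {n : ℕ} (v : ι → E n) : Prop :=
  IsRationalSimplex v ∧ IsPartOfBasis (fun i => homog (v i))

/-- A rational polyhedron: a finite (possibly empty) union of rational simplexes, each given by its
nonempty set of vertices. -/
def IsRationalPolyhedron {n : ℕ} (P : Set (E n)) : Prop :=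
  ∃ S : Set (Finset (E n)), S.Finite ∧
    (∀ s ∈ S, s.Nonempty ∧ IsRationalSimplex (fun v : s => (v : E n))) ∧
    P = ⋃ s ∈ S, convexHull ℝ (s : Set (E n))

/-- `K` is a triangulation of `P`: a finite simplicial complex with support `P`. -/
def IsTriangulation {n : ℕ} (K : SimplicialComplex ℝ (E n)) (P : Set (E n)) : Prop :=
  K.faces.Finite ∧ K.space = P

/-- `K` is a regular triangulation of `P`: all of its simplexes are regular. -/
def IsRegularTriangulation {n : ℕ} (K : SimplicialComplex ℝ (E n)) (P : Set (E n)) : Prop :=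
  IsTriangulation K P ∧ ∀ s ∈ K.faces, IsRegularSimplex (fun v : s => (v : E n))

/-- The (vertex sets of the) maximal `i`-simplexes of `K`: those `i`-simplexes of `K` that are not
properly contained in another simplex of `K`. -/
def maxSimplexes {n : ℕ} (K : SimplicialComplex ℝ (E n)) (i : ℕ) : Set (Finset (E n)) :=
  {s | s ∈ K.facets ∧ s.card = i + 1}

/-- The union of the maximal `i`-simplexes of `K`. -/
def maxSimplexUnion {n : ℕ} (K : SimplicialComplex ℝ (E n)) (i : ℕ) : Set (E n) :=
  ⋃ s ∈ maxSimplexes K i, convexHull ℝ (s : Set (E n))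

open Classical in
/-- The `i`-dimensional part `Q⁽ⁱ⁾` of a polyhedron `Q`: the union of the maximal `i`-simplexes of
a triangulation of `Q` (an arbitrary one is chosen). -/
def dimPart {n : ℕ} (i : ℕ) (Q : Set (E n)) : Set (E n) :=
  if h : ∃ K : SimplicialComplex ℝ (E n), IsTriangulation K Q then
    maxSimplexUnion h.choose i
  else ∅

/-- The polyhedron `P` has dimension at most `d`: all simplexes contained in `P` have at most
`d + 1` vertices. -/
def DimLE {n : ℕ} (P : Set (E n)) (d : ℕ) : Prop :=
  ∀ s : Finset (E n), AffineIndependent ℝ (fun v : s => (v : E n)) →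
    convexHull ℝ (s : Set (E n)) ⊆ P → s.card ≤ d + 1

/-- The sum of `1 / (d! den(T))` over all maximal `d`-simplexes `T` of the (finite) complex `K`,
where `den(T)` is the product of the denominators of the vertices of `T`. -/
def lambdaOf {n : ℕ} (d : ℕ) (K : SimplicialComplex ℝ (E n)) : ℝ :=
  ∑ᶠ s ∈ maxSimplexes K d, 1 / ((d.factorial : ℝ) * ((∏ v ∈ s, den v : ℕ) : ℝ))

open Classical in
/-- The `d`-dimensional rational measure `λ_d(P)` of a rational polyhedron `P`, computed from a
regular triangulation of `P` (an arbitrary one is chosen). -/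
def lam {n : ℕ} (d : ℕ) (P : Set (E n)) : ℝ :=
  if h : ∃ K : SimplicialComplex ℝ (E n), IsRegularTriangulation K P then
    lambdaOf d h.choose
  else 0

/-- The group `𝒢ₙ = GL(n,ℤ) ⋉ ℤⁿ`, as the set of all maps `x ↦ A x + t` of `ℝⁿ`. -/
def affineGroup (n : ℕ) : Set (E n → E n) :=
  {γ | ∃ (A : Matrix (Fin n) (Fin n) ℤ) (t : Fin n → ℤ), (A.det = 1 ∨ A.det = -1) ∧
    ∀ x i, γ x i = ∑ j, (A i j : ℝ) * x j + (t i : ℝ)}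

/-- On `P`, the map `f` is continuous and piecewise (affine) linear, each coordinate having finitely
many linear pieces, all of them with integer coefficients. -/
def IsIntegerPL {n m : ℕ} (P : Set (E n)) (f : E n → E m) : Prop :=
  ContinuousOn f P ∧ ∀ i, ∃ F : Set ((Fin n → ℤ) × ℤ), F.Finite ∧
    ∀ x ∈ P, ∃ l ∈ F, f x i = ∑ j, (l.1 j : ℝ) * x j + (l.2 : ℝ)

/-- `P` and `Q` are `ℤ`-homeomorphic: there is a homeomorphism of `P` onto `Q` such that it and its
inverse are piecewise linear with integer coefficients. -/
def IsZHomeomorphic {n m : ℕ} (P : Set (E n)) (Q : Set (E m)) : Prop :=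
  ∃ (f : E n → E m) (g : E m → E n), MapsTo f P Q ∧ MapsTo g Q P ∧ InvOn g f P Q ∧
    IsIntegerPL P f ∧ IsIntegerPL Q g

/-- The embedding `x ↦ (x, 0)` of `ℝⁿ` into `ℝⁿ⁺¹`. -/
def embed {n : ℕ} (x : E n) : E (n + 1) :=
  WithLp.toLp 2 (Fin.snoc (α := fun _ => ℝ) (fun i => x i) 0)

/-- The closed parallelepiped `{∑ γᵢ wᵢ | 0 ≤ γᵢ ≤ 1}` spanned by integer vectors `wᵢ`. -/
def parallelepipedOf {n j : ℕ} (w : Fin j → (Fin n → ℤ)) : Set (E n) :=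
  {x | ∃ γ : Fin j → ℝ, (∀ i, 0 ≤ γ i ∧ γ i ≤ 1) ∧ x = ∑ i, γ i • intPoint (w i)}

/-- A rational affine subspace: the intersection of a finite set of rational hyperplanes
`{x | a · x + t = 0}`, with `a` a nonzero rational vector and `t` a rational number. -/
def IsRationalAffineSubspace {n : ℕ} (A : AffineSubspace ℝ (E n)) : Prop :=
  ∃ F : Set ((Fin n → ℚ) × ℚ), F.Finite ∧ (∀ h ∈ F, h.1 ≠ 0) ∧
    (A : Set (E n)) = {x | ∀ h ∈ F, ∑ j, (h.1 j : ℝ) * x j + (h.2 : ℝ) = 0}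

end RationalMeasure

end

open RationalMeasure

/-!
The rational measure of a polyhedron is an asymptotic count of lattice points. Let `N(m)` be the
number of integer vectors `(y, q)` with `1 ≤ q ≤ m` and `y / q ∈ P` (`conePoints`). The open cone over
a regular simplex `conv(v₀, …, v_d)` contains exactly the positive integer combinations of the
homogeneous correspondents of the vertices, as these are part of a basis of `ℤⁿ⁺¹`
(`ncard_conePoints_relInt`). Its contribution to `N(m)` is thus the number of positive solutions of
`∑ cᵢ den(vᵢ) ≤ m`, which is asymptotic to `m^(d+1) / ((d+1)! ∏ den(vᵢ))` (`tendsto_ncard_posSol`).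
Hence, if `P` has dimension at most `d`, then `N(m) / m^(d+1)` tends to `λ_d(P) / (d+1)` for every
regular triangulation of `P` (`tendsto_ncard_conePoints_space`); in general, the same holds for the
number of lattice points over the `d`-dimensional part `P⁽ᵈ⁾`.

The set `P⁽ᵈ⁾` does not depend on the triangulation, because it is the closure of the set of points at
which `P` is locally `d`-dimensional (`IsTriangulation.maxSimplexUnion_eq`). This description is also
invariant under `ℤ`-homeomorphisms, which moreover permute the lattice points of given height. So
`λ_d` is well defined (`IsRegularTriangulation.lam_eq`) and invariant (`IsZHomeomorphic.lam_eq`), and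
conservativity is a special case of invariance. The valuation property is the additivity of counting
(`lam_union_add_inter`), and normalization is a direct count of the lattice points in the dilates of
a parallelepiped (`lam_parallelepipedOf`). The pyramid formula is immediate, since a regular simplex
is triangulated by its own faces (`lam_convexHull`).

Regular triangulations exist by stellar subdivision of simplicial fans in the half space of `ℝⁿ⁺¹`.
A rational polyhedron is a finite union of cells cut out by integral linear inequalities
(`IsRationalSimplex.exists_eq_cell`). Starting from the cone over a large simplex, one subdivides
edges until no cone is crossed by the hyperplanes of these cells
(`exists_refines_forall_hasSigns`), and then subdivides at lattice points with fractional coordinates,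
which lowers the multiplicities, until all cones are unimodular (`exists_refines_isUnimodular`). The
faces lying over the cells form a regular triangulation (`exists_isRegularTriangulation_of_cells`),
which also shows that intersections of rational polyhedra are rational polyhedra.

For proportionality, the homogeneous correspondents of two regular `m`-simplexes in an
`m`-dimensional affine subspace are related by an integer matrix of determinant `±1`
(`IsRegularSimplex.exists_unimodular`). In an isometric chart, the volume of a simplex is a constant
multiple of the determinant of the vectors `(xᵢ, 1)`, so that the product of the Hausdorff measure and
of the denominators of the vertices is the same for both (`hausdorff_convexHull_mul_prod_den`). Both
measures are additive over the maximal simplexes of a regular triangulation.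
-/

namespace RationalMeasure

/-! ### Homogeneous coordinates -/

/-- The point `(x, 1)` of `ℝⁿ⁺¹`. -/
def lift {n : ℕ} (x : E n) : Fin (n + 1) → ℝ :=
  Fin.snoc (α := fun _ => ℝ) (fun i => x i) 1

/-- An integer vector, regarded as a real vector. -/
def castVec {N : ℕ} (v : Fin N → ℤ) : Fin N → ℝ := fun i => (v i : ℝ)

/-- The point of `ℝⁿ` with homogeneous coordinates `v ∈ ℤⁿ⁺¹`. It is meaningful only if the last
coordinate of `v` is not `0`. -/
noncomputable def pt {n : ℕ} (v : Fin (n + 1) → ℤ) : E n :=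
  WithLp.toLp 2 (fun i => (v i.castSucc : ℝ) / (v (Fin.last n) : ℝ))

@[simp] theorem lift_last {n : ℕ} (x : E n) : lift x (Fin.last n) = 1 := by simp [lift]

@[simp] theorem lift_castSucc {n : ℕ} (x : E n) (i : Fin n) : lift x i.castSucc = x i := by
  simp [lift]

@[simp] theorem castVec_apply {N : ℕ} (v : Fin N → ℤ) (i : Fin N) : castVec v i = (v i : ℝ) := rfl

theorem castVec_add {N : ℕ} (u v : Fin N → ℤ) : castVec (u + v) = castVec u + castVec v := by
  ext i; simp

theorem castVec_smul {N : ℕ} (k : ℤ) (v : Fin N → ℤ) :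
    castVec (k • v) = (k : ℝ) • castVec v := by
  ext i; simp

theorem castVec_sum {N : ℕ} {ι : Type*} (s : Finset ι) (f : ι → Fin N → ℤ) :
    castVec (∑ i ∈ s, f i) = ∑ i ∈ s, castVec (f i) := by
  ext i; simp

theorem castVec_injective {N : ℕ} : Function.Injective (castVec (N := N)) := by
  intro u v h; ext i
  have := congrFun h i
  simpa using this

theorem lift_injective {n : ℕ} : Function.Injective (lift (n := n)) := by
  intro x y h; ext i
  simpa using congrFun h i.castSucc

theorem lift_affineCombination {n : ℕ} {ι : Type*} (s : Finset ι) (w : ι → ℝ) (x : ι → E n)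
    (hw : ∑ i ∈ s, w i = 1) : lift (∑ i ∈ s, w i • x i) = ∑ i ∈ s, w i • lift (x i) := by
  ext j
  refine Fin.lastCases ?_ (fun j => ?_) j
  · simp [hw]
  · simp [Finset.sum_apply]

theorem sum_smul_lift_eq_zero {n : ℕ} {ι : Type*} (s : Finset ι) (w : ι → ℝ) (x : ι → E n) :
    ∑ i ∈ s, w i • lift (x i) = 0 ↔ ∑ i ∈ s, w i = 0 ∧ ∑ i ∈ s, w i • x i = 0 := by
  constructor
  · intro h
    refine ⟨by simpa using congrFun h (Fin.last n), ?_⟩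
    ext j
    simpa [Finset.sum_apply] using congrFun h j.castSucc
  · rintro ⟨h1, h2⟩
    ext j
    refine Fin.lastCases ?_ (fun j => ?_) j
    · simpa using h1
    · have := congrArg (fun y : E n => y j) h2
      simpa [Finset.sum_apply] using this

theorem castVec_eq_smul_lift_pt {n : ℕ} {v : Fin (n + 1) → ℤ} (hv : v (Fin.last n) ≠ 0) :
    castVec v = (v (Fin.last n) : ℝ) • lift (pt v) := by
  have : (v (Fin.last n) : ℝ) ≠ 0 := by exact_mod_cast hv
  ext j
  refine Fin.lastCases ?_ (fun j => ?_) j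
  · simp
  · simp [pt]; field_simp

theorem eq_pt_iff {n : ℕ} {v : Fin (n + 1) → ℤ} (hv : v (Fin.last n) ≠ 0) (x : E n) :
    x = pt v ↔ castVec v = (v (Fin.last n) : ℝ) • lift x := by
  have h0 : (v (Fin.last n) : ℝ) ≠ 0 := by exact_mod_cast hv
  rw [castVec_eq_smul_lift_pt hv]
  constructor
  · rintro rfl; rfl
  · intro h
    exact (lift_injective (smul_right_injective _ h0 h)).symm

theorem isRationalPoint_pt {n : ℕ} (v : Fin (n + 1) → ℤ) : IsRationalPoint (pt v) := fun i =>
  ⟨(v i.castSucc : ℚ) / v (Fin.last n), by simp [pt]⟩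

theorem den_mem {n : ℕ} {x : E n} (hx : IsRationalPoint x) :
    0 < den x ∧ ∀ i, ∃ z : ℤ, (den x : ℝ) * x i = (z : ℝ) := by
  have : {q : ℕ | 0 < q ∧ ∀ i, ∃ z : ℤ, (q : ℝ) * x i = (z : ℝ)}.Nonempty := by
    choose q hq using hx
    refine ⟨∏ i, (q i).den, Finset.prod_pos fun i _ => (q i).den_pos, fun i => ?_⟩
    refine ⟨(q i).num * ∏ j ∈ Finset.univ.erase i, (q j).den, ?_⟩
    rw [← Finset.mul_prod_erase _ _ (Finset.mem_univ i), hq i]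
    have h1 : ((q i : ℚ) : ℝ) * ((q i).den : ℝ) = ((q i).num : ℝ) := by
      exact_mod_cast Rat.mul_den_eq_num (q i)
    push_cast
    rw [← h1]; ring
  exact Nat.sInf_mem this

theorem den_pos {n : ℕ} {x : E n} (hx : IsRationalPoint x) : 0 < den x := (den_mem hx).1

theorem homog_last {n : ℕ} (x : E n) : homog x (Fin.last n) = den x := by simp [homog]

theorem castVec_homog {n : ℕ} {x : E n} (hx : IsRationalPoint x) :
    castVec (homog x) = (den x : ℝ) • lift x := by
  ext j
  refine Fin.lastCases ?_ (fun j => ?_) j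
  · simp [homog_last]
  · obtain ⟨z, hz⟩ := (den_mem hx).2 j
    simp [homog, hz]

theorem pt_homog {n : ℕ} {x : E n} (hx : IsRationalPoint x) : pt (homog x) = x := by
  have h := den_pos hx
  symm
  rw [eq_pt_iff, castVec_homog hx, homog_last]
  · simp
  · rw [homog_last]; exact_mod_cast h.ne'

theorem affineIndependent_iff_lift {n : ℕ} {ι : Type*} (x : ι → E n) :
    AffineIndependent ℝ x ↔ LinearIndependent ℝ (fun i => lift (x i)) := by
  rw [affineIndependent_iff, linearIndependent_iff']
  constructor
  · intro h s w hw i hi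
    obtain ⟨h1, h2⟩ := (sum_smul_lift_eq_zero s w x).1 hw
    exact h s w h1 h2 i hi
  · intro h s w h1 h2 i hi
    exact h s w ((sum_smul_lift_eq_zero s w x).2 ⟨h1, h2⟩) i hi

theorem affineIndependent_iff_homog {n : ℕ} {ι : Type*} {x : ι → E n}
    (hx : ∀ i, IsRationalPoint (x i)) :
    AffineIndependent ℝ x ↔ LinearIndependent ℝ (fun i => castVec (homog (x i))) := by
  rw [affineIndependent_iff_lift]
  have h0 : ∀ i, (den (x i) : ℝ) ≠ 0 := fun i => by exact_mod_cast (den_pos (hx i)).ne'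
  simp only [castVec_homog (hx _)]
  exact (LinearIndependent.units_smul_iff _ (fun i => Units.mk0 _ (h0 i))).symm

/-! ### Integer functionals -/

/-- The linear functional on `ℝᴺ` with integer coefficients `a`. -/
noncomputable def functional {N : ℕ} (a : Fin N → ℤ) : (Fin N → ℝ) →ₗ[ℝ] ℝ :=
  ∑ i, (a i : ℝ) • LinearMap.proj i

theorem functional_apply {N : ℕ} (a : Fin N → ℤ) (x : Fin N → ℝ) :
    functional a x = ∑ i, (a i : ℝ) * x i := by simp [functional]

theorem functional_castVec {N : ℕ} (a v : Fin N → ℤ) :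
    functional a (castVec v) = ((∑ i, a i * v i : ℤ) : ℝ) := by simp [functional_apply]

theorem functional_lift {n : ℕ} (a : Fin (n + 1) → ℤ) (x : E n) :
    functional a (lift x) = ∑ i : Fin n, (a i.castSucc : ℝ) * x i + (a (Fin.last n) : ℝ) := by
  simp [functional_apply, Fin.sum_univ_castSucc]

/-- The coefficients of the `i`-th coordinate functional of a basis of `ℤᴺ`. -/
noncomputable def coordVec {N : ℕ} {ι : Type*} (b : Module.Basis ι ℤ (Fin N → ℤ)) (i : ι) : Fin N → ℤ :=
  fun j => b.coord i (Pi.single j 1)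

theorem functional_coordVec {N : ℕ} {ι : Type*} (b : Module.Basis ι ℤ (Fin N → ℤ)) (i : ι)
    (v : Fin N → ℤ) : functional (coordVec b i) (castVec v) = (b.coord i v : ℝ) := by
  rw [functional_castVec]
  congr 1
  have hv : v = ∑ j, v j • (Pi.single j 1 : Fin N → ℤ) := by
    ext k; simp [Finset.sum_apply, Pi.single_apply]
  conv_rhs => rw [hv]
  simp only [map_sum, map_smul, smul_eq_mul, coordVec, mul_comm]

theorem functional_coordVec_sum {N : ℕ} {ι κ : Type*} (b : Module.Basis ι ℤ (Fin N → ℤ))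
    (f : κ ↪ ι) (s : Finset κ) (r : κ → ℝ) (k : κ) (hk : k ∈ s) :
    functional (coordVec b (f k)) (∑ j ∈ s, r j • castVec (b (f j))) = r k := by
  classical
  rw [map_sum, Finset.sum_eq_single_of_mem k hk]
  · simp [functional_coordVec]
  · intro j _ hj
    have : f j ≠ f k := fun h => hj (f.injective h)
    simp [functional_coordVec, this]

/-! ### Stellar subdivision of simplicial fans -/

/-- The linear combination `∑ w(v) v` of integer vectors. -/
noncomputable def realize {n : ℕ} : ((Fin (n + 1) → ℤ) →₀ ℝ) →ₗ[ℝ] (Fin (n + 1) → ℝ) :=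
  Finsupp.linearCombination ℝ castVec

/-- `M` is the set of maximal cones, each given by its `n + 1` integer generators, of a
full-dimensional simplicial fan in the open upper half space of `ℝⁿ⁺¹`. The intersection condition
is expressed by the uniqueness of conical coordinates. -/
structure IsFan {n : ℕ} (M : Finset (Finset (Fin (n + 1) → ℤ))) : Prop where
  card : ∀ t ∈ M, t.card = n + 1
  pos : ∀ t ∈ M, ∀ v ∈ t, 0 < v (Fin.last n)
  inj : ∀ t ∈ M, ∀ t' ∈ M, ∀ w w' : (Fin (n + 1) → ℤ) →₀ ℝ, 0 ≤ w → 0 ≤ w' →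
    w.support ⊆ t → w'.support ⊆ t' → realize w = realize w' → w = w'

/-- The union of the cones of `M`. -/
def coneSupport {n : ℕ} (M : Finset (Finset (Fin (n + 1) → ℤ))) : Set (Fin (n + 1) → ℝ) :=
  {x | ∃ t ∈ M, ∃ w : (Fin (n + 1) → ℤ) →₀ ℝ, 0 ≤ w ∧ w.support ⊆ t ∧ realize w = x}

/-- The maximal cones of the stellar subdivision at the vector `p`, whose carrier is the cone
generated by `σ`. -/
def star {n : ℕ} (M : Finset (Finset (Fin (n + 1) → ℤ))) (σ : Finset (Fin (n + 1) → ℤ))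
    (p : Fin (n + 1) → ℤ) : Finset (Finset (Fin (n + 1) → ℤ)) :=
  M.filter (fun t => ¬ σ ⊆ t) ∪
    (M.filter (fun t => σ ⊆ t)).biUnion (fun t => σ.image (fun v => insert p (t.erase v)))

theorem mem_star {n : ℕ} {M : Finset (Finset (Fin (n + 1) → ℤ))} {σ : Finset (Fin (n + 1) → ℤ)}
    {p : Fin (n + 1) → ℤ} {t' : Finset (Fin (n + 1) → ℤ)} :
    t' ∈ star M σ p ↔ (t' ∈ M ∧ ¬ σ ⊆ t') ∨
      ∃ t ∈ M, σ ⊆ t ∧ ∃ v ∈ σ, t' = insert p (t.erase v) := by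
  simp only [star, Finset.mem_union, Finset.mem_filter, Finset.mem_biUnion, Finset.mem_image]
  constructor
  · rintro (h | ⟨t, ⟨h1, h2⟩, v, hv, rfl⟩)
    · exact Or.inl h
    · exact Or.inr ⟨t, h1, h2, v, hv, rfl⟩
  · rintro (h | ⟨t, h1, h2, v, hv, rfl⟩)
    · exact Or.inl h
    · exact Or.inr ⟨t, ⟨h1, h2⟩, v, hv, rfl⟩

theorem realize_single {n : ℕ} (v : Fin (n + 1) → ℤ) (r : ℝ) :
    realize (Finsupp.single v r) = r • castVec v := by simp [realize]

theorem realize_eq_sum {n : ℕ} (w : (Fin (n + 1) → ℤ) →₀ ℝ) (t : Finset (Fin (n + 1) → ℤ))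
    (h : w.support ⊆ t) : realize w = ∑ v ∈ t, w v • castVec v := by
  rw [realize, Finsupp.linearCombination_apply]
  exact Finsupp.sum_of_support_subset _ h _ (by simp)

theorem apply_eq_zero_of_support_subset {n : ℕ} {w : (Fin (n + 1) → ℤ) →₀ ℝ}
    {t : Finset (Fin (n + 1) → ℤ)} (h : w.support ⊆ t) {v : Fin (n + 1) → ℤ} (hv : v ∉ t) :
    w v = 0 := by
  by_contra h0
  exact hv (h (Finsupp.mem_support_iff.2 h0))

theorem support_subset_of {n : ℕ} {w : (Fin (n + 1) → ℤ) →₀ ℝ}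
    {t : Finset (Fin (n + 1) → ℤ)} (h : ∀ v, v ∉ t → w v = 0) : w.support ⊆ t := by
  intro v hv
  by_contra h0
  exact Finsupp.mem_support_iff.1 hv (h v h0)

section Star

variable {n : ℕ} {M : Finset (Finset (Fin (n + 1) → ℤ))} {c : (Fin (n + 1) → ℤ) →₀ ℝ}
  {p : Fin (n + 1) → ℤ}

/-- The data of a stellar subdivision: `p` is a positive combination, with coefficients `c`, of
generators of one cone of `M`, and it is not itself one of the generators. -/
structure IsStarCenter (M : Finset (Finset (Fin (n + 1) → ℤ))) (c : (Fin (n + 1) → ℤ) →₀ ℝ)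
    (p : Fin (n + 1) → ℤ) : Prop where
  fan : IsFan M
  nonneg : 0 ≤ c
  ne_zero : c ≠ 0
  ne_single : c ≠ Finsupp.single p 1
  carrier : ∃ t ∈ M, c.support ⊆ t
  eq : realize c = castVec p

namespace IsStarCenter

theorem pos_of_mem (h : IsStarCenter M c p) {v : Fin (n + 1) → ℤ} (hv : v ∈ c.support) :
    0 < c v := lt_of_le_of_ne (h.nonneg v) (Finsupp.mem_support_iff.1 hv).symm

theorem notMem (h : IsStarCenter M c p) {t : Finset (Fin (n + 1) → ℤ)} (ht : t ∈ M) : p ∉ t := by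
  intro hp
  obtain ⟨t₀, ht₀, hc⟩ := h.carrier
  refine h.ne_single (h.fan.inj t₀ ht₀ t ht _ _ h.nonneg ?_ hc ?_ ?_)
  · exact Finsupp.single_nonneg.2 zero_le_one
  · exact (Finsupp.support_single_subset).trans (by simpa using hp)
  · rw [h.eq, realize_single, one_smul]

theorem notMem_support (h : IsStarCenter M c p) : p ∉ c.support := by
  obtain ⟨t₀, ht₀, hc⟩ := h.carrier
  exact fun hp => h.notMem ht₀ (hc hp)

/-- Conical coordinates with respect to the subdivided fan, turned into coordinates with respect
to the original one. -/
noncomputable def collapse (c : (Fin (n + 1) → ℤ) →₀ ℝ) (p : Fin (n + 1) → ℤ)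
    (w : (Fin (n + 1) → ℤ) →₀ ℝ) : (Fin (n + 1) → ℤ) →₀ ℝ :=
  w.erase p + w p • c

theorem realize_collapse (h : IsStarCenter M c p) (w : (Fin (n + 1) → ℤ) →₀ ℝ) :
    realize (collapse c p w) = realize w := by
  conv_rhs => rw [← Finsupp.erase_add_single p w]
  rw [collapse, map_add, map_add, map_smul, h.eq, realize_single]

theorem collapse_nonneg (h : IsStarCenter M c p) {w : (Fin (n + 1) → ℤ) →₀ ℝ} (hw : 0 ≤ w) :
    0 ≤ collapse c p w := by
  intro v
  have h1 := hw v
  have h2 := mul_nonneg (hw p) (h.nonneg v)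
  simp only [collapse, Finsupp.coe_add, Finsupp.coe_smul, Pi.add_apply, Pi.smul_apply,
    smul_eq_mul, Finsupp.coe_zero, Pi.zero_apply, Finsupp.erase_apply] at *
  split_ifs <;> linarith

theorem collapse_apply_of_ne {w : (Fin (n + 1) → ℤ) →₀ ℝ} {v : Fin (n + 1) → ℤ} (hv : v ≠ p) :
    collapse c p w v = w v + w p * c v := by
  simp [collapse, hv]

theorem collapse_support (h : IsStarCenter M c p) {w : (Fin (n + 1) → ℤ) →₀ ℝ}
    {t' : Finset (Fin (n + 1) → ℤ)} (ht' : t' ∈ star M c.support p) (hw : w.support ⊆ t') :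
    ∃ t ∈ M, (collapse c p w).support ⊆ t := by
  rcases mem_star.1 ht' with ⟨ht, -⟩ | ⟨t, ht, hσ, v, hv, rfl⟩
  · refine ⟨t', ht, support_subset_of fun u hu => ?_⟩
    have hp : w p = 0 := apply_eq_zero_of_support_subset hw (h.notMem ht)
    have hu' : w u = 0 := apply_eq_zero_of_support_subset hw hu
    simp [collapse, hp, hu']
  · refine ⟨t, ht, support_subset_of fun u hu => ?_⟩
    have hcu : c u = 0 := apply_eq_zero_of_support_subset hσ hu
    rcases eq_or_ne u p with rfl | hup
    · simp [collapse, hcu]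
    · rw [collapse_apply_of_ne hup, hcu, apply_eq_zero_of_support_subset hw (v := u)]
      · simp
      · simp [hup, hu]

/-- Some generator of the carrier has coordinate `0`. -/
theorem exists_apply_eq_zero (h : IsStarCenter M c p) {w : (Fin (n + 1) → ℤ) →₀ ℝ}
    {t' : Finset (Fin (n + 1) → ℤ)} (ht' : t' ∈ star M c.support p) (hw : w.support ⊆ t') :
    ∃ v ∈ c.support, w v = 0 := by
  rcases mem_star.1 ht' with ⟨ht, hσ⟩ | ⟨t, ht, hσ, v, hv, rfl⟩
  · obtain ⟨v, hv, hvt⟩ := Finset.not_subset.1 hσ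
    exact ⟨v, hv, apply_eq_zero_of_support_subset hw hvt⟩
  · refine ⟨v, hv, apply_eq_zero_of_support_subset hw ?_⟩
    have : v ≠ p := fun hvp => h.notMem_support (hvp ▸ hv)
    simp [this]

theorem apply_center_le (h : IsStarCenter M c p) {w₁ w₂ : (Fin (n + 1) → ℤ) →₀ ℝ}
    {t : Finset (Fin (n + 1) → ℤ)} (ht : t ∈ star M c.support p)
    (hw₁ : w₁.support ⊆ t) (h₂ : 0 ≤ w₂) (he : collapse c p w₁ = collapse c p w₂) :
    w₂ p ≤ w₁ p := by
  obtain ⟨v, hv, hv0⟩ := h.exists_apply_eq_zero ht hw₁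
  have hvp : v ≠ p := fun hvp => h.notMem_support (hvp ▸ hv)
  have := DFunLike.congr_fun he v
  rw [collapse_apply_of_ne hvp, collapse_apply_of_ne hvp, hv0, zero_add] at this
  have h2 := h₂ v
  have hc := h.pos_of_mem hv
  simp only [Finsupp.coe_zero, Pi.zero_apply] at h2
  exact le_of_mul_le_mul_right (by linarith) hc

theorem collapse_inj (h : IsStarCenter M c p) {w₁ w₂ : (Fin (n + 1) → ℤ) →₀ ℝ}
    {t₁ t₂ : Finset (Fin (n + 1) → ℤ)} (ht₁ : t₁ ∈ star M c.support p)
    (ht₂ : t₂ ∈ star M c.support p) (hw₁ : w₁.support ⊆ t₁) (hw₂ : w₂.support ⊆ t₂)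
    (h₁ : 0 ≤ w₁) (h₂ : 0 ≤ w₂) (he : collapse c p w₁ = collapse c p w₂) : w₁ = w₂ := by
  have hp : w₁ p = w₂ p := le_antisymm (h.apply_center_le ht₂ hw₂ h₁ he.symm)
    (h.apply_center_le ht₁ hw₁ h₂ he)
  ext v
  rcases eq_or_ne v p with rfl | hv
  · exact hp
  · have := DFunLike.congr_fun he v
    rw [collapse_apply_of_ne hv, collapse_apply_of_ne hv, hp] at this
    linarith

theorem last_pos (h : IsStarCenter M c p) : 0 < p (Fin.last n) := by
  obtain ⟨t₀, ht₀, hc⟩ := h.carrier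
  have h1 := congrFun h.eq (Fin.last n)
  rw [realize_eq_sum c _ subset_rfl, Finset.sum_apply] at h1
  have : (0 : ℝ) < p (Fin.last n) := by
    rw [castVec_apply] at h1
    rw [← h1]
    refine Finset.sum_pos (fun v hv => ?_) (Finsupp.support_nonempty_iff.2 h.ne_zero)
    have := h.fan.pos t₀ ht₀ v (hc hv)
    have h3 := h.pos_of_mem hv
    simp only [Pi.smul_apply, castVec_apply, smul_eq_mul]
    have : (0 : ℝ) < v (Fin.last n) := by exact_mod_cast this
    positivity
  exact_mod_cast this

theorem isFan_star (h : IsStarCenter M c p) : IsFan (star M c.support p) where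
  card t' ht' := by
    rcases mem_star.1 ht' with ⟨ht, -⟩ | ⟨t, ht, hσ, v, hv, rfl⟩
    · exact h.fan.card _ ht
    · rw [Finset.card_insert_of_notMem, Finset.card_erase_of_mem (hσ hv), h.fan.card t ht]
      · rfl
      · exact fun hp => h.notMem ht (Finset.mem_of_mem_erase hp)
  pos t' ht' v hv := by
    rcases mem_star.1 ht' with ⟨ht, -⟩ | ⟨t, ht, hσ, u, hu, rfl⟩
    · exact h.fan.pos _ ht v hv
    · rcases Finset.mem_insert.1 hv with rfl | hv
      · exact h.last_pos
      · exact h.fan.pos _ ht v (Finset.mem_of_mem_erase hv)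
  inj t₁ ht₁ t₂ ht₂ w₁ w₂ h₁ h₂ hw₁ hw₂ he := by
    obtain ⟨s₁, hs₁, hc₁⟩ := h.collapse_support ht₁ hw₁
    obtain ⟨s₂, hs₂, hc₂⟩ := h.collapse_support ht₂ hw₂
    refine h.collapse_inj ht₁ ht₂ hw₁ hw₂ h₁ h₂ ?_
    refine h.fan.inj s₁ hs₁ s₂ hs₂ _ _ (h.collapse_nonneg h₁) (h.collapse_nonneg h₂) hc₁ hc₂ ?_
    rw [h.realize_collapse, h.realize_collapse, he]

theorem coneSupport_subset_star (h : IsStarCenter M c p) :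
    coneSupport M ⊆ coneSupport (star M c.support p) := by
  rintro x ⟨t, ht, w, hw, hwt, rfl⟩
  by_cases hσ : c.support ⊆ t
  · -- subtract from `w` the largest multiple of `c` that leaves it nonnegative
    obtain ⟨v, hv, hmin⟩ := Finset.exists_min_image c.support (fun v => w v / c v)
      (Finsupp.support_nonempty_iff.2 h.ne_zero)
    set m := w v / c v with hm
    have hm0 : 0 ≤ m := div_nonneg (hw v) (h.nonneg v)
    refine ⟨insert p (t.erase v), mem_star.2 (Or.inr ⟨t, ht, hσ, v, hv, rfl⟩),
      w - m • c + Finsupp.single p m, ?_, ?_, ?_⟩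
    · intro u
      have h0 : 0 ≤ w u - m * c u := by
        by_cases hu : u ∈ c.support
        · have h1 := hmin u hu
          rw [le_div_iff₀ (h.pos_of_mem hu)] at h1
          linarith
        · rw [Finsupp.notMem_support_iff.1 hu, mul_zero, sub_zero]
          exact hw u
      have h1 : 0 ≤ Finsupp.single p m u := (Finsupp.single_nonneg.2 hm0) u
      simpa using add_nonneg h0 h1
    · refine support_subset_of fun u hu => ?_
      simp only [Finset.mem_insert, Finset.mem_erase, not_or, not_and_or, not_not] at hu
      obtain ⟨hup, hu⟩ := hu
      have h1 : Finsupp.single p m u = 0 := Finsupp.single_eq_of_ne hup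
      have h2 : w u - m * c u = 0 := by
        rcases hu with rfl | hu
        · rw [hm, div_mul_cancel₀ _ (h.pos_of_mem hv).ne', sub_self]
        · rw [apply_eq_zero_of_support_subset hwt hu, apply_eq_zero_of_support_subset hσ hu]
          ring
      simp [h1, h2]
    · rw [map_add, map_sub, map_smul, h.eq, realize_single]
      simp
  · exact ⟨t, mem_star.2 (Or.inl ⟨ht, hσ⟩), w, hw, hwt, rfl⟩

/-- The generators of the subdivided fan are nonnegative with respect to a functional if those of
some cone of the original fan are. -/
theorem exists_mem_forall_nonneg (h : IsStarCenter M c p) {t' : Finset (Fin (n + 1) → ℤ)}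
    (ht' : t' ∈ star M c.support p) : ∃ t ∈ M, ∀ f : (Fin (n + 1) → ℝ) →ₗ[ℝ] ℝ,
      (∀ v ∈ t, 0 ≤ f (castVec v)) → ∀ v ∈ t', 0 ≤ f (castVec v) := by
  rcases mem_star.1 ht' with ⟨ht, -⟩ | ⟨t, ht, hσ, u, hu, rfl⟩
  · exact ⟨t', ht, fun f hf => hf⟩
  · refine ⟨t, ht, fun f hf v hv => ?_⟩
    rcases Finset.mem_insert.1 hv with rfl | hv
    · rw [← h.eq, realize_eq_sum c _ subset_rfl, map_sum]
      refine Finset.sum_nonneg fun a ha => ?_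
      rw [map_smul]
      exact mul_nonneg (h.nonneg a) (hf a (hσ ha))
    · exact hf v (Finset.mem_of_mem_erase hv)

end IsStarCenter

end Star

/-! ### Subdividing along a hyperplane -/

section Separation

variable {n : ℕ}

/-- No cone of `M` is crossed by the hyperplane `f = 0`. -/
def HasSigns (M : Finset (Finset (Fin (n + 1) → ℤ))) (f : (Fin (n + 1) → ℝ) →ₗ[ℝ] ℝ) : Prop :=
  ∀ t ∈ M, (∀ v ∈ t, 0 ≤ f (castVec v)) ∨ (∀ v ∈ t, f (castVec v) ≤ 0)

/-- `M'` is a fan that covers the cones of `M` and is not crossed by any hyperplane that does not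
cross `M`. -/
structure Refines (M' M : Finset (Finset (Fin (n + 1) → ℤ))) : Prop where
  fan : IsFan M'
  coneSupport_subset : coneSupport M ⊆ coneSupport M'
  hasSigns : ∀ f, HasSigns M f → HasSigns M' f

theorem Refines.refl {M : Finset (Finset (Fin (n + 1) → ℤ))} (h : IsFan M) : Refines M M :=
  ⟨h, subset_rfl, fun _ h => h⟩

theorem Refines.trans {M M' M'' : Finset (Finset (Fin (n + 1) → ℤ))} (h : Refines M'' M')
    (h' : Refines M' M) : Refines M'' M :=
  ⟨h.fan, h'.coneSupport_subset.trans h.coneSupport_subset,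
    fun f hf => h.hasSigns f (h'.hasSigns f hf)⟩

theorem IsStarCenter.refines {M : Finset (Finset (Fin (n + 1) → ℤ))}
    {c : (Fin (n + 1) → ℤ) →₀ ℝ} {p : Fin (n + 1) → ℤ} (h : IsStarCenter M c p) :
    Refines (star M c.support p) M := by
  refine ⟨h.isFan_star, h.coneSupport_subset_star, fun f hf t' ht' => ?_⟩
  obtain ⟨t, ht, hs⟩ := h.exists_mem_forall_nonneg ht'
  rcases hf t ht with h1 | h1
  · exact Or.inl (hs f h1)
  · refine Or.inr fun v hv => ?_
    have := hs (-f) (fun v hv => by simpa using h1 v hv) v hv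
    simpa using this

/-- The edges of `M` that are crossed by the hyperplane with coefficients `a`. -/
def crossing (M : Finset (Finset (Fin (n + 1) → ℤ))) (a : Fin (n + 1) → ℤ) :
    Finset ((Fin (n + 1) → ℤ) × (Fin (n + 1) → ℤ)) :=
  (M.biUnion (fun t => t ×ˢ t)).filter (fun q => a ⬝ᵥ q.1 < 0 ∧ 0 < a ⬝ᵥ q.2)

theorem mem_crossing {M : Finset (Finset (Fin (n + 1) → ℤ))} {a : Fin (n + 1) → ℤ}
    {q : (Fin (n + 1) → ℤ) × (Fin (n + 1) → ℤ)} : q ∈ crossing M a ↔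
      (∃ t ∈ M, q.1 ∈ t ∧ q.2 ∈ t) ∧ a ⬝ᵥ q.1 < 0 ∧ 0 < a ⬝ᵥ q.2 := by
  simp [crossing]

theorem functional_castVec' (a v : Fin (n + 1) → ℤ) :
    functional a (castVec v) = ((a ⬝ᵥ v : ℤ) : ℝ) := functional_castVec a v

/-- Subdividing a crossed edge at its intersection with the hyperplane removes this edge and creates
no crossed edges. -/
theorem exists_refines_crossing_ssubset {M : Finset (Finset (Fin (n + 1) → ℤ))} (hM : IsFan M)
    {a : Fin (n + 1) → ℤ} (hne : (crossing M a).Nonempty) :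
    ∃ M', Refines M' M ∧ crossing M' a ⊂ crossing M a := by
  obtain ⟨⟨u, v⟩, huv⟩ := hne
  obtain ⟨⟨t, ht, hut, hvt⟩, hu, hv⟩ := mem_crossing.1 huv
  simp only at hut hvt hu hv
  have huv_ne : u ≠ v := by rintro rfl; exact lt_asymm hu hv
  set p : Fin (n + 1) → ℤ := (a ⬝ᵥ v) • u + (-(a ⬝ᵥ u)) • v with hp
  set c : (Fin (n + 1) → ℤ) →₀ ℝ :=
    Finsupp.single u ((a ⬝ᵥ v : ℤ) : ℝ) + Finsupp.single v ((-(a ⬝ᵥ u) : ℤ) : ℝ) with hc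
  have hv' : (0 : ℝ) < ((a ⬝ᵥ v : ℤ) : ℝ) := by exact_mod_cast hv
  have hu' : (0 : ℝ) < ((-(a ⬝ᵥ u) : ℤ) : ℝ) := by
    have : 0 < -(a ⬝ᵥ u) := by linarith
    exact_mod_cast this
  have hcu : c u = ((a ⬝ᵥ v : ℤ) : ℝ) := by simp [hc, huv_ne]
  have hcv : c v = ((-(a ⬝ᵥ u) : ℤ) : ℝ) := by simp [hc, huv_ne.symm]
  have husupp : u ∈ c.support := by rw [Finsupp.mem_support_iff, hcu]; exact hv'.ne'
  have hvsupp : v ∈ c.support := by rw [Finsupp.mem_support_iff, hcv]; exact hu'.ne'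
  have hap : a ⬝ᵥ p = 0 := by
    rw [hp, dotProduct_add, dotProduct_smul, dotProduct_smul, smul_eq_mul, smul_eq_mul]; ring
  have hcen : IsStarCenter M c p := by
    refine ⟨hM, ?_, ?_, ?_, ⟨t, ht, ?_⟩, ?_⟩
    · exact add_nonneg (Finsupp.single_nonneg.2 hv'.le) (Finsupp.single_nonneg.2 hu'.le)
    · intro h; rw [h] at hcu; simp at hcu; exact hv'.ne hcu
    · -- a multiple of a single generator has one-element support
      intro h
      rw [h] at husupp hvsupp
      have h1 := Finset.mem_singleton.1 (Finsupp.support_single_subset husupp)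
      have h2 := Finset.mem_singleton.1 (Finsupp.support_single_subset hvsupp)
      exact huv_ne (h1.trans h2.symm)
    · refine support_subset_of fun w hw => ?_
      have h1 : w ≠ u := by rintro rfl; exact hw hut
      have h2 : w ≠ v := by rintro rfl; exact hw hvt
      simp [hc, h1, h2]
    · rw [hc, map_add, realize_single, realize_single, hp, castVec_add, castVec_smul, castVec_smul]
  refine ⟨_, hcen.refines, Finset.ssubset_iff_subset_ne.2 ⟨fun q hq => ?_, fun he => ?_⟩⟩
  · obtain ⟨⟨t', ht', h1, h2⟩, h3, h4⟩ := mem_crossing.1 hq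
    refine mem_crossing.2 ⟨?_, h3, h4⟩
    rcases mem_star.1 ht' with ⟨ht', -⟩ | ⟨s, hs, hσ, w, hw, rfl⟩
    · exact ⟨t', ht', h1, h2⟩
    · refine ⟨s, hs, ?_, ?_⟩
      · rcases Finset.mem_insert.1 h1 with h | h
        · rw [h, hap] at h3; exact absurd h3 (lt_irrefl _)
        · exact Finset.mem_of_mem_erase h
      · rcases Finset.mem_insert.1 h2 with h | h
        · rw [h, hap] at h4; exact absurd h4 (lt_irrefl _)
        · exact Finset.mem_of_mem_erase h
  · rw [← he] at huv
    obtain ⟨⟨t', ht', h1, h2⟩, -⟩ := mem_crossing.1 huv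
    simp only at h1 h2
    have hup : u ≠ p := by rintro h; exact hcen.notMem_support (h ▸ husupp)
    have hvp : v ≠ p := by rintro h; exact hcen.notMem_support (h ▸ hvsupp)
    have hsub : c.support ⊆ {u, v} := support_subset_of fun w hw => by
      simp only [Finset.mem_insert, Finset.mem_singleton, not_or] at hw
      simp [hc, hw.1, hw.2]
    rcases mem_star.1 ht' with ⟨-, hσ⟩ | ⟨s, hs, hσ, w, hw, rfl⟩
    · refine hσ (hsub.trans ?_)
      simp [Finset.insert_subset_iff, h1, h2]
    · have := hsub hw
      simp only [Finset.mem_insert, Finset.mem_singleton] at this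
      rcases this with rfl | rfl
      · simp [hup] at h1
      · simp [hvp] at h2

theorem hasSigns_of_crossing_eq_empty {M : Finset (Finset (Fin (n + 1) → ℤ))}
    {a : Fin (n + 1) → ℤ} (h : crossing M a = ∅) : HasSigns M (functional a) := by
  intro t ht
  by_contra! hcon
  obtain ⟨⟨u, hu, hu'⟩, v, hv, hv'⟩ := hcon
  rw [functional_castVec'] at hu' hv'
  have : (u, v) ∈ crossing M a :=
    mem_crossing.2 ⟨⟨t, ht, hu, hv⟩, by exact_mod_cast hu', by exact_mod_cast hv'⟩
  simp [h] at this

theorem exists_refines_hasSigns {M : Finset (Finset (Fin (n + 1) → ℤ))} (hM : IsFan M)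
    (a : Fin (n + 1) → ℤ) : ∃ M', Refines M' M ∧ HasSigns M' (functional a) := by
  induction hk : (crossing M a).card using Nat.strong_induction_on generalizing M with
  | _ k ih =>
    rcases (crossing M a).eq_empty_or_nonempty with h | h
    · exact ⟨M, Refines.refl hM, hasSigns_of_crossing_eq_empty h⟩
    · obtain ⟨M', hM', hlt⟩ := exists_refines_crossing_ssubset hM h
      obtain ⟨M'', h1, h2⟩ := ih _ (hk ▸ Finset.card_lt_card hlt) hM'.fan rfl
      exact ⟨M'', h1.trans hM', h2⟩

theorem exists_refines_forall_hasSigns {M : Finset (Finset (Fin (n + 1) → ℤ))} (hM : IsFan M)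
    (H : Finset (Fin (n + 1) → ℤ)) :
    ∃ M', Refines M' M ∧ ∀ a ∈ H, HasSigns M' (functional a) := by
  induction H using Finset.induction_on with
  | empty => exact ⟨M, Refines.refl hM, by simp⟩
  | insert a H _ ih =>
    obtain ⟨M', h1, h2⟩ := ih
    obtain ⟨M'', h3, h4⟩ := exists_refines_hasSigns h1.fan a
    refine ⟨M'', h3.trans h1, fun b hb => ?_⟩
    rcases Finset.mem_insert.1 hb with rfl | hb
    · exact h4
    · exact h3.hasSigns _ (h2 b hb)

end Separation

/-! ### Multiplicities of cones, and unimodular refinements -/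

section Unimodular

variable {n : ℕ}

theorem IsFan.eq_zero_of_realize_eq_zero {M : Finset (Finset (Fin (n + 1) → ℤ))} (hM : IsFan M)
    {t : Finset (Fin (n + 1) → ℤ)} (ht : t ∈ M) {w : (Fin (n + 1) → ℤ) →₀ ℝ}
    (hw : w.support ⊆ t) (h0 : realize w = 0) : w = 0 := by
  set s : (Fin (n + 1) → ℤ) →₀ ℝ := w.mapRange (fun x => |x|) (by simp) with hs
  have hsupp : s.support ⊆ t := Finsupp.support_mapRange.trans hw
  have h := hM.inj t ht t ht (w + s) s (fun v => ?_) (fun v => ?_)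
    (Finsupp.support_add.trans (Finset.union_subset hw hsupp)) hsupp (by rw [map_add, h0, zero_add])
  · simpa using h
  · have := neg_abs_le (w v)
    simp only [Finsupp.coe_zero, Pi.zero_apply, hs, Finsupp.coe_add, Pi.add_apply,
      Finsupp.mapRange_apply]
    linarith
  · simp [hs]

theorem IsFan.linearIndependent {M : Finset (Finset (Fin (n + 1) → ℤ))} (hM : IsFan M)
    {t : Finset (Fin (n + 1) → ℤ)} (ht : t ∈ M) :
    LinearIndependent ℝ (fun v : t => castVec (v : Fin (n + 1) → ℤ)) := by
  have : LinearIndepOn ℝ castVec (t : Set (Fin (n + 1) → ℤ)) := by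
    rw [linearIndepOn_iff]
    intro w hw h0
    exact hM.eq_zero_of_realize_eq_zero ht (by simpa [Finsupp.mem_supported] using hw) h0
  exact this

/-- The Gram determinant of a finite family of integer vectors. -/
def gramDet {N : ℕ} {ι : Type*} [Fintype ι] [DecidableEq ι] (f : ι → Fin N → ℤ) : ℤ :=
  (Matrix.of f * (Matrix.of f).transpose).det

theorem gramDet_comp_equiv {N : ℕ} {ι κ : Type*} [Fintype ι] [DecidableEq ι] [Fintype κ]
    [DecidableEq κ] (f : ι → Fin N → ℤ) (e : κ ≃ ι) : gramDet (f ∘ e) = gramDet f := by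
  rw [gramDet, gramDet, ← Matrix.det_submatrix_equiv_self e]
  rfl

theorem gramDet_cast {N : ℕ} {ι : Type*} [Fintype ι] [DecidableEq ι] (f : ι → Fin N → ℤ) :
    (gramDet f : ℝ) = (Matrix.of (fun i => castVec (f i)) *
      (Matrix.of (fun i => castVec (f i))).transpose).det := by
  rw [gramDet]
  have := RingHom.map_det (Int.castRingHom ℝ) (Matrix.of f * (Matrix.of f).transpose)
  rw [eq_intCast] at this
  rw [this]
  congr 1
  ext i j
  simp [Matrix.mul_apply]

theorem gramDet_ne_zero {N : ℕ} {ι : Type*} [Fintype ι] [DecidableEq ι] {f : ι → Fin N → ℤ}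
    (hf : LinearIndependent ℝ (fun i => castVec (f i))) : gramDet f ≠ 0 := by
  intro h0
  have h1 : (gramDet f : ℝ) = 0 := by exact_mod_cast h0
  rw [gramDet_cast] at h1
  obtain ⟨v, hv, hv0⟩ := Matrix.exists_vecMul_eq_zero_iff.2 h1
  have h2 := (Matrix.vecMul_self_mul_conjTranspose_eq_zero
    (Matrix.of (fun i => castVec (f i))) v).1 (by
      rw [Matrix.conjTranspose_eq_transpose_of_trivial]; exact hv0)
  refine hv (funext fun i => ?_)
  refine Fintype.linearIndependent_iff.1 hf v ?_ i
  rw [← h2]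
  ext j
  simp [Matrix.vecMul, dotProduct, Finset.sum_apply]

theorem gramDet_update {N : ℕ} {ι : Type*} [Fintype ι] [DecidableEq ι] (f : ι → Fin N → ℤ)
    (i : ι) (p : Fin N → ℤ) (r : ι → ℝ) (hp : castVec p = ∑ j, r j • castVec (f j)) :
    (gramDet (Function.update f i p) : ℝ) = r i ^ 2 * gramDet f := by
  set A : Matrix ι (Fin N) ℝ := Matrix.of (fun i => castVec (f i)) with hA
  set C : Matrix ι ι ℝ := ((1 : Matrix ι ι ℝ).updateCol i r).transpose with hC
  have hdet : C.det = r i := by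
    rw [hC, Matrix.det_transpose, ← Matrix.cramer_apply, Matrix.cramer_one]; rfl
  have hCA : Matrix.of (fun j => castVec (Function.update f i p j)) = C * A := by
    ext j k
    rcases eq_or_ne j i with rfl | hj
    · have := congrFun hp k
      simp only [Matrix.of_apply, Function.update_self, this, Matrix.mul_apply, hC,
        Matrix.transpose_apply, Matrix.updateCol_self, hA]
      simp [Finset.sum_apply]
    · simp [Matrix.mul_apply, hC, hA, hj, Matrix.updateCol_ne, Matrix.one_apply]
  rw [gramDet_cast, gramDet_cast, hCA, Matrix.transpose_mul, Matrix.mul_assoc,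
    ← Matrix.mul_assoc A, Matrix.det_mul, Matrix.det_mul, Matrix.det_transpose C, hdet]
  ring

/-- The multiplicity of a cone: the absolute value of the Gram determinant of its generators, hence
the square of the index of the lattice that they generate. -/
def mult (t : Finset (Fin (n + 1) → ℤ)) : ℕ :=
  (gramDet (fun v : t => (v : Fin (n + 1) → ℤ))).natAbs

theorem mult_insert_erase_lt {t : Finset (Fin (n + 1) → ℤ)}
    (ht : LinearIndependent ℝ (fun v : t => castVec (v : Fin (n + 1) → ℤ)))
    {c : (Fin (n + 1) → ℤ) →₀ ℝ} (hc : c.support ⊆ t) {p : Fin (n + 1) → ℤ} (hpt : p ∉ t)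
    (hp : realize c = castVec p) {v : Fin (n + 1) → ℤ} (hv : v ∈ t) (h0 : 0 < c v)
    (h1 : c v < 1) : mult (insert p (t.erase v)) < mult t := by
  -- replacing `v` by `p` identifies the two index sets
  let g : t → {x // x ∈ insert p (t.erase v)} := fun u => if h : (u : Fin (n + 1) → ℤ) = v
    then ⟨p, by simp⟩ else ⟨u, by simp [h]⟩
  have hg : Function.Bijective g := by
    rw [Fintype.bijective_iff_injective_and_card]
    constructor
    · intro a b hab
      have hap : (a : Fin (n + 1) → ℤ) ≠ p := fun h => hpt (h ▸ a.2)
      have hbp : (b : Fin (n + 1) → ℤ) ≠ p := fun h => hpt (h ▸ b.2)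
      by_cases ha : (a : Fin (n + 1) → ℤ) = v <;> by_cases hb : (b : Fin (n + 1) → ℤ) = v <;>
        simp only [g, ha, hb, dif_pos, dif_neg, not_false_eq_true, Subtype.mk.injEq] at hab
      · exact Subtype.ext (ha.trans hb.symm)
      · exact absurd hab.symm hbp
      · exact absurd hab hap
      · exact Subtype.ext hab
    · rw [Fintype.card_coe, Fintype.card_coe, Finset.card_insert_of_notMem,
        Finset.card_erase_of_mem hv]
      · have : 0 < t.card := Finset.card_pos.2 ⟨v, hv⟩
        omega
      · exact fun h => hpt (Finset.mem_of_mem_erase h)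
  have hcomp : (fun u : {x // x ∈ insert p (t.erase v)} => (u : Fin (n + 1) → ℤ)) ∘
      (Equiv.ofBijective g hg) =
      Function.update (fun u : t => (u : Fin (n + 1) → ℤ)) ⟨v, hv⟩ p := by
    ext1 u
    by_cases hu : (u : Fin (n + 1) → ℤ) = v
    · obtain rfl : u = ⟨v, hv⟩ := Subtype.ext hu
      simp [g]
    · have : u ≠ ⟨v, hv⟩ := fun h => hu (congrArg Subtype.val h)
      simp [g, hu, this]
  have hsum : castVec p = ∑ u : t, c u • castVec (u : Fin (n + 1) → ℤ) := by
    rw [← hp, realize_eq_sum c t hc, ← Finset.sum_coe_sort t]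
  have hG := gramDet_update (fun u : t => (u : Fin (n + 1) → ℤ)) ⟨v, hv⟩ p (fun u => c u) hsum
  rw [← hcomp, gramDet_comp_equiv] at hG
  have hne := gramDet_ne_zero ht
  rw [mult, mult, ← Nat.cast_lt (α := ℝ), Nat.cast_natAbs, Nat.cast_natAbs, Int.cast_abs,
    Int.cast_abs, hG, abs_mul, abs_of_nonneg (sq_nonneg _)]
  have hpos : (0 : ℝ) < |(gramDet (fun u : t => (u : Fin (n + 1) → ℤ)) : ℝ)| := by
    rw [abs_pos]; exact_mod_cast hne
  have : c v ^ 2 < 1 := by nlinarith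
  simpa using mul_lt_mul_of_pos_right this hpos

/-- The vectors of `t` form a basis of `ℤⁿ⁺¹`. -/
def IsUnimodular (t : Finset (Fin (n + 1) → ℤ)) : Prop :=
  ∃ b : Module.Basis t ℤ (Fin (n + 1) → ℤ), ∀ v : t, b v = v

/-- A termination measure for the stellar subdivisions that lower multiplicities: a cone may be
replaced by up to `n + 1` cones of smaller multiplicity. -/
def complexity (M : Finset (Finset (Fin (n + 1) → ℤ))) : ℕ := ∑ t ∈ M, (n + 2) ^ mult t

theorem sum_biUnion_le {ι κ : Type*} [DecidableEq κ] (s : Finset ι) (f : ι → Finset κ)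
    (g : κ → ℕ) : ∑ k ∈ s.biUnion f, g k ≤ ∑ i ∈ s, ∑ k ∈ f i, g k := by
  classical
  induction s using Finset.induction_on with
  | empty => simp
  | insert i s hi ih =>
    rw [Finset.biUnion_insert, Finset.sum_insert hi]
    have := Finset.sum_union_inter (s₁ := f i) (s₂ := s.biUnion f) (f := g)
    omega

theorem IsStarCenter.complexity_star_lt {M : Finset (Finset (Fin (n + 1) → ℤ))}
    {c : (Fin (n + 1) → ℤ) →₀ ℝ} {p : Fin (n + 1) → ℤ} (h : IsStarCenter M c p)
    (h1 : ∀ v, c v < 1) : complexity (star M c.support p) < complexity M := by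
  have key : ∀ t ∈ M.filter (fun t => c.support ⊆ t),
      ∑ t' ∈ c.support.image (fun v => insert p (t.erase v)), (n + 2) ^ mult t' <
        (n + 2) ^ mult t := by
    intro t ht
    obtain ⟨ht, hσ⟩ := Finset.mem_filter.1 ht
    have hlt : ∀ v ∈ c.support, mult (insert p (t.erase v)) < mult t := fun v hv =>
      mult_insert_erase_lt (h.fan.linearIndependent ht) hσ (h.notMem ht) h.eq (hσ hv)
        (h.pos_of_mem hv) (h1 v)
    calc ∑ t' ∈ c.support.image (fun v => insert p (t.erase v)), (n + 2) ^ mult t'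
        ≤ ∑ v ∈ c.support, (n + 2) ^ mult (insert p (t.erase v)) :=
          Finset.sum_image_le_of_nonneg (fun _ _ => Nat.zero_le _)
      _ ≤ ∑ v ∈ c.support, (n + 2) ^ (mult t - 1) := by
          refine Finset.sum_le_sum fun v hv => Nat.pow_le_pow_right (by omega) ?_
          have := hlt v hv
          omega
      _ ≤ (n + 1) * (n + 2) ^ (mult t - 1) := by
          rw [Finset.sum_const, smul_eq_mul]
          exact Nat.mul_le_mul_right _ ((Finset.card_le_card hσ).trans (h.fan.card t ht).le)
      _ < (n + 2) * (n + 2) ^ (mult t - 1) := by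
          refine Nat.mul_lt_mul_of_pos_right (by omega) (by positivity)
      _ = (n + 2) ^ mult t := by
          obtain ⟨v, hv⟩ := Finsupp.support_nonempty_iff.2 h.ne_zero
          have := hlt v hv
          rw [← pow_succ', Nat.sub_add_cancel (by omega)]
  have hstrict : ∑ t ∈ M.filter (fun t => c.support ⊆ t),
      ∑ t' ∈ c.support.image (fun v => insert p (t.erase v)), (n + 2) ^ mult t' <
      ∑ t ∈ M.filter (fun t => c.support ⊆ t), (n + 2) ^ mult t := by
    obtain ⟨t₀, ht₀, hc⟩ := h.carrier
    exact Finset.sum_lt_sum_of_nonempty ⟨t₀, Finset.mem_filter.2 ⟨ht₀, hc⟩⟩ key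
  have hu := Finset.sum_union_inter (s₁ := M.filter (fun t => ¬ c.support ⊆ t))
    (s₂ := (M.filter (fun t => c.support ⊆ t)).biUnion
      (fun t => c.support.image (fun v => insert p (t.erase v))))
    (f := fun t' => (n + 2) ^ mult t')
  have hb := sum_biUnion_le (M.filter (fun t => c.support ⊆ t))
    (fun t => c.support.image (fun v => insert p (t.erase v))) (fun t' => (n + 2) ^ mult t')
  have hf := Finset.sum_filter_add_sum_filter_not M (fun t => c.support ⊆ t)
    (fun t' => (n + 2) ^ mult t')
  simp only [complexity, star]
  omega

/-- A cone that is not unimodular contains a lattice point with fractional coordinates; subdividing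
there lowers the complexity. -/
theorem exists_refines_complexity_lt {M : Finset (Finset (Fin (n + 1) → ℤ))} (hM : IsFan M)
    {t : Finset (Fin (n + 1) → ℤ)} (ht : t ∈ M) (hu : ¬ IsUnimodular t) :
    ∃ M', Refines M' M ∧ complexity M' < complexity M := by
  classical
  have hli := hM.linearIndependent ht
  have hcard : Fintype.card t = Module.finrank ℝ (Fin (n + 1) → ℝ) := by
    rw [Fintype.card_coe, hM.card t ht, Module.finrank_fin_fun]
  have : Nonempty t := by
    rw [← Fintype.card_pos_iff, Fintype.card_coe, hM.card t ht]; omega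
  set B := basisOfLinearIndependentOfCardEqFinrank hli hcard with hB
  have hBapply : ∀ v : t, B v = castVec (v : Fin (n + 1) → ℤ) := fun v => by
    rw [hB, coe_basisOfLinearIndependentOfCardEqFinrank]
  have hliZ : LinearIndependent ℤ (fun v : t => (v : Fin (n + 1) → ℤ)) := by
    rw [Fintype.linearIndependent_iff]
    intro g hg v
    have := Fintype.linearIndependent_iff.1 hli (fun v => (g v : ℝ)) (by
      have h2 := congrArg castVec hg
      rw [castVec_sum] at h2
      simp only [castVec_smul] at h2
      rw [h2]; ext; simp) v
    exact_mod_cast this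
  obtain ⟨z, hz⟩ : ∃ z : Fin (n + 1) → ℤ, ∃ v : t, ∀ k : ℤ, B.repr (castVec z) v ≠ k := by
    by_contra! hcon
    refine hu ⟨Module.Basis.mk hliZ ?_, fun v => by rw [Module.Basis.mk_apply]⟩
    rintro z -
    choose k hk using hcon z
    have hz : z = ∑ v : t, k v • (v : Fin (n + 1) → ℤ) := by
      apply castVec_injective
      rw [castVec_sum]
      conv_lhs => rw [← B.sum_repr (castVec z)]
      exact Finset.sum_congr rfl fun v _ => by rw [hk, hBapply, castVec_smul]
    rw [hz]
    exact Submodule.sum_mem _ fun v _ => Submodule.smul_mem _ _ (Submodule.subset_span ⟨v, rfl⟩)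
  obtain ⟨v₀, hv₀⟩ := hz
  set a : t → ℝ := fun v => B.repr (castVec z) v with ha
  set c : (Fin (n + 1) → ℤ) →₀ ℝ := Finsupp.onFinset t
    (fun v => if h : v ∈ t then Int.fract (a ⟨v, h⟩) else 0)
    (fun v hv => by by_contra h; simp [h] at hv) with hc
  set p : Fin (n + 1) → ℤ := z - ∑ v : t, ⌊a v⌋ • (v : Fin (n + 1) → ℤ) with hp
  have hcv : ∀ v : t, c v = Int.fract (a v) := fun v => by simp [hc]
  have hct : c.support ⊆ t := Finsupp.support_onFinset_subset
  have hc1 : ∀ v, c v < 1 := fun v => by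
    simp only [hc, Finsupp.onFinset_apply]
    split_ifs
    · exact Int.fract_lt_one _
    · exact zero_lt_one
  have hcen : IsStarCenter M c p := by
    refine ⟨hM, fun v => ?_, fun h => ?_, fun h => ?_, ⟨t, ht, hct⟩, ?_⟩
    · simp only [hc, Finsupp.onFinset_apply, Finsupp.coe_zero, Pi.zero_apply]
      split_ifs
      · exact Int.fract_nonneg _
      · exact le_rfl
    · have h1 := hcv v₀
      rw [h] at h1
      obtain ⟨k, hk⟩ := Int.fract_eq_zero_iff.1 h1.symm
      exact hv₀ k hk.symm
    · have := hc1 p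
      rw [h] at this
      simp at this
    · rw [realize_eq_sum c t hct, ← Finset.sum_coe_sort t, hp, sub_eq_add_neg, castVec_add,
        ← neg_one_smul ℤ (∑ v : t, ⌊a v⌋ • (v : Fin (n + 1) → ℤ)), castVec_smul, castVec_sum]
      conv_rhs => rw [← B.sum_repr (castVec z)]
      rw [Finset.smul_sum, ← Finset.sum_add_distrib]
      refine Finset.sum_congr rfl fun v _ => ?_
      rw [hcv, hBapply, castVec_smul, smul_smul, ← add_smul]
      congr 1
      simp only [Int.fract, ha]
      push_cast
      ring
  exact ⟨_, hcen.refines, hcen.complexity_star_lt hc1⟩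

theorem exists_refines_isUnimodular {M : Finset (Finset (Fin (n + 1) → ℤ))} (hM : IsFan M) :
    ∃ M', Refines M' M ∧ ∀ t ∈ M', IsUnimodular t := by
  induction hk : complexity M using Nat.strong_induction_on generalizing M with
  | _ k ih =>
    by_cases h : ∀ t ∈ M, IsUnimodular t
    · exact ⟨M, Refines.refl hM, h⟩
    · push Not at h
      obtain ⟨t, ht, hu⟩ := h
      obtain ⟨M', hM', hlt⟩ := exists_refines_complexity_lt hM ht hu
      obtain ⟨M'', h1, h2⟩ := ih _ (hk ▸ hlt) hM'.fan rfl
      exact ⟨M'', h1.trans hM', h2⟩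

end Unimodular

/-! ### From fans to regular triangulations -/

section Triangulation

variable {n : ℕ}

theorem lift_smul_add_smul (x y : E n) {a b : ℝ} (hab : a + b = 1) :
    lift (a • x + b • y) = a • lift x + b • lift y := by
  ext j
  refine Fin.lastCases ?_ (fun j => ?_) j
  · simp [hab]
  · simp

theorem lift_eq_sum_iff {ι : Type*} (s : Finset ι) (w : ι → ℝ) (x : ι → E n) (y : E n) :
    lift y = ∑ i ∈ s, w i • lift (x i) ↔ ∑ i ∈ s, w i = 1 ∧ y = ∑ i ∈ s, w i • x i := by
  constructor
  · intro h
    have h1 : ∑ i ∈ s, w i = 1 := by simpa using (congrFun h (Fin.last n)).symm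
    exact ⟨h1, lift_injective (by rw [h, lift_affineCombination s w x h1])⟩
  · rintro ⟨h1, rfl⟩
    exact lift_affineCombination s w x h1

/-- A simplex consists of the points whose homogeneous coordinates lie in the cone generated by
homogeneous coordinates of its vertices. -/
theorem mem_convexHull_image_pt {t : Finset (Fin (n + 1) → ℤ)}
    (ht : ∀ v ∈ t, 0 < v (Fin.last n)) {x : E n} :
    x ∈ convexHull ℝ ((t.image pt : Finset (E n)) : Set (E n)) ↔
      ∃ w : (Fin (n + 1) → ℤ) →₀ ℝ, 0 ≤ w ∧ w.support ⊆ t ∧ realize w = lift x := by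
  constructor
  · intro hx
    refine convexHull_min (t := {x | ∃ w : (Fin (n + 1) → ℤ) →₀ ℝ, 0 ≤ w ∧ w.support ⊆ t ∧
      realize w = lift x}) ?_ ?_ hx
    · intro y hy
      obtain ⟨v, hv, rfl⟩ := Finset.mem_image.1 (Finset.mem_coe.1 hy)
      have h0 : (0 : ℝ) < v (Fin.last n) := by exact_mod_cast ht v hv
      refine ⟨Finsupp.single v (v (Fin.last n) : ℝ)⁻¹,
        Finsupp.single_nonneg.2 (inv_nonneg.2 h0.le),
        Finsupp.support_single_subset.trans (by simpa using hv), ?_⟩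
      rw [realize_single, castVec_eq_smul_lift_pt (ht v hv).ne', smul_smul,
        inv_mul_cancel₀ h0.ne', one_smul]
    · rintro y ⟨w, hw, hwt, hwy⟩ z ⟨w', hw', hwt', hwz⟩ a b ha hb hab
      refine ⟨a • w + b • w', add_nonneg (smul_nonneg ha hw) (smul_nonneg hb hw'),
        Finsupp.support_add.trans (Finset.union_subset (Finsupp.support_smul.trans hwt)
          (Finsupp.support_smul.trans hwt')), ?_⟩
      rw [map_add, map_smul, map_smul, hwy, hwz, lift_smul_add_smul y z hab]
  · rintro ⟨w, hw, hwt, h⟩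
    rw [realize_eq_sum w t hwt] at h
    have h2 : lift x = ∑ v ∈ t, (w v * v (Fin.last n)) • lift (pt v) := by
      rw [← h]
      refine Finset.sum_congr rfl fun v hv => ?_
      rw [castVec_eq_smul_lift_pt (ht v hv).ne', smul_smul]
    obtain ⟨h3, rfl⟩ := (lift_eq_sum_iff t _ _ x).1 h2
    refine (convex_convexHull ℝ _).sum_mem (fun v hv => ?_) h3 (fun v hv => ?_)
    · have : (0 : ℝ) < v (Fin.last n) := by exact_mod_cast ht v hv
      exact mul_nonneg (hw v) this.le
    · exact subset_convexHull ℝ _ (Finset.mem_coe.2 (Finset.mem_image_of_mem _ hv))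

/-- The polyhedral cell of the points that satisfy the integral inequalities with coefficient
vectors in `C`. -/
def cell (C : Finset (Fin (n + 1) → ℤ)) : Set (E n) := {x | ∀ a ∈ C, 0 ≤ functional a (lift x)}

theorem convex_cell (C : Finset (Fin (n + 1) → ℤ)) : Convex ℝ (cell C) := by
  intro x hx y hy a b ha hb hab c hc
  rw [lift_smul_add_smul x y hab, map_add, map_smul, map_smul]
  exact add_nonneg (mul_nonneg ha (hx c hc)) (mul_nonneg hb (hy c hc))

theorem cell_union (C D : Finset (Fin (n + 1) → ℤ)) : cell (C ∪ D) = cell C ∩ cell D := by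
  ext x
  simp only [cell, Finset.mem_union, mem_ofPred_eq, mem_inter_iff]
  exact ⟨fun h => ⟨fun a ha => h a (Or.inl ha), fun a ha => h a (Or.inr ha)⟩,
    fun h a ha => ha.elim (h.1 a) (h.2 a)⟩

theorem pt_mem_cell {C : Finset (Fin (n + 1) → ℤ)} {v : Fin (n + 1) → ℤ}
    (hv : 0 < v (Fin.last n)) (h : ∀ a ∈ C, 0 ≤ functional a (castVec v)) : pt v ∈ cell C := by
  intro a ha
  have h1 := h a ha
  rw [castVec_eq_smul_lift_pt hv.ne', map_smul, smul_eq_mul] at h1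
  have : (0 : ℝ) < v (Fin.last n) := by exact_mod_cast hv
  exact nonneg_of_mul_nonneg_right h1 this

/-- The generators of the cone over a large simplex. -/
def bigVec (n r : ℕ) (j k : Fin (n + 1)) : ℤ :=
  if k = Fin.last n then 1 else -r + if j = k then 2 * n * r + 1 else 0

theorem bigVec_last (r : ℕ) (j : Fin (n + 1)) : bigVec n r j (Fin.last n) = 1 := by simp [bigVec]

theorem bigVec_castSucc (r : ℕ) (j : Fin (n + 1)) (i : Fin n) :
    bigVec n r j i.castSucc = -r + if j = i.castSucc then 2 * n * r + 1 else 0 := by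
  simp [bigVec, (Fin.castSucc_lt_last i).ne]

theorem bigVec_injective (r : ℕ) : Function.Injective (bigVec n r) := by
  have h0 : (2 * n * r + 1 : ℤ) ≠ 0 := by positivity
  have key : ∀ (i : Fin n) (k : Fin (n + 1)), bigVec n r i.castSucc = bigVec n r k →
      i.castSucc = k := by
    intro i k h
    have := congrFun h i.castSucc
    rw [bigVec_castSucc, bigVec_castSucc, if_pos rfl] at this
    by_contra hne
    rw [if_neg (Ne.symm hne)] at this
    omega
  intro j k h
  induction j using Fin.lastCases with
  | cast i => exact key i k h
  | last =>
    induction k using Fin.lastCases with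
    | cast i => exact (key i _ h.symm).symm
    | last => rfl

theorem sum_smul_bigVec_last (r : ℕ) (c : Fin (n + 1) → ℝ) :
    (∑ j, c j • castVec (bigVec n r j)) (Fin.last n) = ∑ j, c j := by
  simp [Finset.sum_apply, bigVec_last]

theorem sum_smul_bigVec_castSucc (r : ℕ) (c : Fin (n + 1) → ℝ) (i : Fin n) :
    (∑ j, c j • castVec (bigVec n r j)) i.castSucc =
      -r * ∑ j, c j + c i.castSucc * (2 * n * r + 1) := by
  simp only [Finset.sum_apply, Pi.smul_apply, castVec_apply, bigVec_castSucc, smul_eq_mul]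
  push_cast
  simp only [mul_add, Finset.sum_add_distrib, mul_ite, mul_zero, Finset.sum_ite_eq',
    Finset.mem_univ, if_true, ← Finset.sum_mul]
  ring

/-- A bounded set lies in the simplex with the vertices `(-r, …, -r)` and
`(-r, …, -r) + (2nr + 1) eⱼ`, for large `r`; the cone over it is a fan with one maximal cone. -/
theorem exists_isFan_of_bounded {P : Set (E n)} (hP : Bornology.IsBounded P) :
    ∃ M : Finset (Finset (Fin (n + 1) → ℤ)), IsFan M ∧ ∀ x ∈ P, lift x ∈ coneSupport M := by
  obtain ⟨R, hR⟩ := hP.exists_norm_le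
  obtain ⟨r, hr⟩ := exists_nat_ge R
  set t : Finset (Fin (n + 1) → ℤ) := Finset.univ.image (bigVec n r) with ht
  have hsum : ∀ w : (Fin (n + 1) → ℤ) →₀ ℝ, w.support ⊆ t →
      realize w = ∑ j, w (bigVec n r j) • castVec (bigVec n r j) := fun w hw => by
    rw [realize_eq_sum w t hw, ht, Finset.sum_image fun _ _ _ _ h => bigVec_injective r h]
  have h0 : (0 : ℝ) < 2 * n * r + 1 := by positivity
  refine ⟨{t}, ⟨?_, ?_, ?_⟩, ?_⟩
  · intro s hs
    rw [Finset.mem_singleton.1 hs, ht, Finset.card_image_of_injective _ (bigVec_injective r)]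
    simp
  · intro s hs v hv
    rw [Finset.mem_singleton.1 hs, ht] at hv
    obtain ⟨j, -, rfl⟩ := Finset.mem_image.1 hv
    rw [bigVec_last]; exact one_pos
  · intro s hs s' hs' w w' _ _ hw hw' h
    rw [Finset.mem_singleton.1 hs] at hw
    rw [Finset.mem_singleton.1 hs'] at hw'
    rw [hsum w hw, hsum w' hw'] at h
    have hl := congrFun h (Fin.last n)
    rw [sum_smul_bigVec_last, sum_smul_bigVec_last] at hl
    have hc : ∀ i : Fin n, w (bigVec n r i.castSucc) = w' (bigVec n r i.castSucc) := by
      intro i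
      have := congrFun h i.castSucc
      rw [sum_smul_bigVec_castSucc, sum_smul_bigVec_castSucc, hl] at this
      exact mul_right_cancel₀ h0.ne' (add_left_cancel this)
    have hlast : w (bigVec n r (Fin.last n)) = w' (bigVec n r (Fin.last n)) := by
      rw [Fin.sum_univ_castSucc, Fin.sum_univ_castSucc, Finset.sum_congr rfl fun i _ => hc i] at hl
      exact add_left_cancel hl
    ext v
    by_cases hv : v ∈ t
    · obtain ⟨j, -, rfl⟩ := Finset.mem_image.1 hv
      exact Fin.lastCases (motive := fun j => w (bigVec n r j) = w' (bigVec n r j)) hlast hc j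
    · rw [apply_eq_zero_of_support_subset hw hv, apply_eq_zero_of_support_subset hw' hv]
  · intro x hx
    have hxi : ∀ i, |x i| ≤ r := fun i => ((EuclideanSpace.norm_eq x ▸ by
      have := PiLp.norm_apply_le x i
      rwa [EuclideanSpace.norm_eq x] at this : |x i| ≤ ‖x‖)).trans ((hR x hx).trans hr)
    set c : Fin (n + 1) → ℝ := Fin.snoc (α := fun _ => ℝ) (fun i => (x i + r) / (2 * n * r + 1))
      (1 - ∑ i, (x i + r) / (2 * n * r + 1)) with hc
    have hc1 : ∑ j, c j = 1 := by simp [Fin.sum_univ_castSucc, hc]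
    have hc0 : ∀ j, 0 ≤ c j := by
      intro j
      refine Fin.lastCases ?_ (fun i => ?_) j
      · simp only [hc, Fin.snoc_last, sub_nonneg, ← Finset.sum_div]
        rw [div_le_one h0]
        calc ∑ i, (x i + r) ≤ ∑ _i : Fin n, (2 * r : ℝ) :=
              Finset.sum_le_sum fun i _ => by have := (abs_le.1 (hxi i)).2; linarith
          _ ≤ 2 * n * r + 1 := by simp; nlinarith
      · simp only [hc, Fin.snoc_castSucc]
        have := (abs_le.1 (hxi i)).1
        exact div_nonneg (by linarith) h0.le
    refine ⟨t, Finset.mem_singleton_self _, Finsupp.onFinset t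
      (fun v => ∑ j, if bigVec n r j = v then c j else 0) ?_, ?_, Finsupp.support_onFinset_subset,
      ?_⟩
    · intro v hv
      obtain ⟨j, -, hj⟩ := Finset.exists_ne_zero_of_sum_ne_zero hv
      rw [ht]
      refine Finset.mem_image.2 ⟨j, Finset.mem_univ _, ?_⟩
      by_contra h
      simp [h] at hj
    · intro v
      simp only [Finsupp.onFinset_apply, Finsupp.coe_zero, Pi.zero_apply]
      refine Finset.sum_nonneg fun j _ => ?_
      split_ifs
      · exact hc0 j
      · exact le_rfl
    · rw [hsum _ Finsupp.support_onFinset_subset]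
      have hv : ∀ k, (∑ j, if bigVec n r j = bigVec n r k then c j else 0) = c k := by
        intro k
        simp [(bigVec_injective r).eq_iff]
      simp only [Finsupp.onFinset_apply, hv]
      ext k
      refine Fin.lastCases ?_ (fun i => ?_) k
      · rw [sum_smul_bigVec_last, hc1, lift_last]
      · rw [sum_smul_bigVec_castSucc, hc1, lift_castSucc]
        simp only [hc, Fin.snoc_castSucc]
        field_simp
        ring

theorem den_pt_of_basis {ι : Type*} (b : Module.Basis ι ℤ (Fin (n + 1) → ℤ)) (i : ι)
    (hv : 0 < b i (Fin.last n)) : (den (pt (b i) : E n) : ℤ) = b i (Fin.last n) := by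
  have h0 : (b i (Fin.last n) : ℝ) ≠ 0 := by exact_mod_cast hv.ne'
  have hr := isRationalPoint_pt (b i)
  apply le_antisymm
  · have : den (pt (b i) : E n) ≤ (b i (Fin.last n)).toNat := by
      refine Nat.sInf_le ⟨by omega, fun j => ⟨b i j.castSucc, ?_⟩⟩
      have h1 : (((b i (Fin.last n)).toNat : ℕ) : ℝ) = (b i (Fin.last n) : ℝ) := by
        exact_mod_cast congrArg (Int.cast (R := ℝ)) (Int.toNat_of_nonneg hv.le)
      rw [h1, pt]
      field_simp
    omega
  · -- `b i` is primitive, so that `den • b i = (b i)ₙ₊₁ • homog` makes `(b i)ₙ₊₁` divide `den`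
    have h1 : (den (pt (b i) : E n) : ℤ) • b i = b i (Fin.last n) • homog (pt (b i)) := by
      apply castVec_injective
      rw [castVec_smul, castVec_smul, castVec_homog hr, castVec_eq_smul_lift_pt hv.ne', smul_smul,
        smul_smul, mul_comm]
      simp
    have h2 := congrArg (b.coord i) h1
    rw [map_smul, map_smul, b.coord_apply, b.repr_self, Finsupp.single_eq_same, smul_eq_mul,
      mul_one, smul_eq_mul] at h2
    exact Int.le_of_dvd (by exact_mod_cast den_pos hr) ⟨_, h2⟩

theorem homog_pt_of_basis {ι : Type*} (b : Module.Basis ι ℤ (Fin (n + 1) → ℤ)) (i : ι)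
    (hv : 0 < b i (Fin.last n)) : homog (pt (b i) : E n) = b i := by
  apply castVec_injective
  rw [castVec_homog (isRationalPoint_pt _), castVec_eq_smul_lift_pt hv.ne',
    ← den_pt_of_basis b i hv]
  simp

theorem IsFan.isRegularSimplex {M : Finset (Finset (Fin (n + 1) → ℤ))} (hM : IsFan M)
    (hu : ∀ t ∈ M, IsUnimodular t) {t u : Finset (Fin (n + 1) → ℤ)} (ht : t ∈ M) (hut : u ⊆ t) :
    IsRegularSimplex (fun v : (u.image pt : Finset (E n)) => (v : E n)) := by
  obtain ⟨b, hb⟩ := hu t ht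
  let e : t ≃ Fin (n + 1) := Finset.equivFinOfCardEq (hM.card t ht)
  have hrat : ∀ v : (u.image pt : Finset (E n)), IsRationalPoint (v : E n) := by
    intro v
    obtain ⟨w, -, hw⟩ := Finset.mem_image.1 v.2
    exact hw ▸ isRationalPoint_pt w
  have hmem : ∀ v : (u.image pt : Finset (E n)), homog (v : E n) ∈ t := by
    intro v
    obtain ⟨w, hw, hwv⟩ := Finset.mem_image.1 v.2
    have e1 := homog_pt_of_basis b ⟨w, hut hw⟩ (by rw [hb]; exact hM.pos t ht w (hut hw))
    rw [hb] at e1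
    simp only at e1
    rw [← hwv, e1]
    exact hut hw
  have hinj : Function.Injective (fun v : (u.image pt : Finset (E n)) =>
      (⟨homog (v : E n), hmem v⟩ : t)) := by
    intro v v' h
    apply Subtype.ext
    have h1 : homog (v : E n) = homog (v' : E n) := congrArg Subtype.val h
    rw [← pt_homog (hrat v), ← pt_homog (hrat v'), h1]
  refine ⟨⟨?_, hrat⟩, b.reindex e, ⟨fun v => e ⟨homog (v : E n), hmem v⟩,
    fun v v' h => hinj (e.injective h)⟩, fun v => ?_⟩
  · rw [affineIndependent_iff_homog hrat]
    have h := (hM.linearIndependent ht).comp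
      (fun v : (u.image pt : Finset (E n)) => (⟨homog (v : E n), hmem v⟩ : t)) hinj
    simpa only [Function.comp_def] using h
  · change homog (v : E n) = (b.reindex e) (e ⟨homog (v : E n), hmem v⟩)
    simp [hb]

/-- The complex of all simplexes spanned by generators of a unimodular fan that lie in one of the
cells of `𝒞`. -/
theorem exists_isRegularTriangulation_of_fan {M : Finset (Finset (Fin (n + 1) → ℤ))} (hM : IsFan M)
    (hu : ∀ t ∈ M, IsUnimodular t) (𝒞 : Set (Finset (Fin (n + 1) → ℤ)))
    (hs : ∀ C ∈ 𝒞, ∀ a ∈ C, HasSigns M (functional a))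
    (hcov : ∀ C ∈ 𝒞, ∀ x ∈ cell C, lift x ∈ coneSupport M) :
    ∃ K : SimplicialComplex ℝ (E n), IsRegularTriangulation K (⋃ C ∈ 𝒞, cell C) := by
  let F : Set (Finset (E n)) := {s | ∃ t ∈ M, ∃ u ⊆ t, u.Nonempty ∧
    (∃ C ∈ 𝒞, ∀ v ∈ u, ∀ a ∈ C, 0 ≤ functional a (castVec v)) ∧ s = u.image pt}
  have hpos : ∀ t ∈ M, ∀ u ⊆ t, ∀ v ∈ u, 0 < v (Fin.last n) :=
    fun t ht u hut v hv => hM.pos t ht v (hut hv)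
  let K : SimplicialComplex ℝ (E n) :=
    { faces := F
      isRelLowerSet_faces := by
        rintro s ⟨t, ht, u, hut, hne, ⟨C, hC, hCu⟩, rfl⟩
        refine ⟨hne.image _, fun s' hs' hne' => ?_⟩
        obtain ⟨u', hu', rfl⟩ := Finset.subset_image_iff.1 hs'
        exact ⟨t, ht, u', (Finset.coe_subset.1 hu').trans hut, Finset.image_nonempty.1 hne',
          ⟨C, hC, fun v hv => hCu v (hu' hv)⟩, rfl⟩
      indep := by
        rintro s ⟨t, ht, u, hut, -, -, rfl⟩
        exact (hM.isRegularSimplex hu ht hut).1.1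
      inter_subset_convexHull := by
        rintro s s' ⟨t, ht, u, hut, -, -, rfl⟩ ⟨t', ht', u', hut', -, -, rfl⟩ x ⟨hx, hx'⟩
        obtain ⟨w, hw, hwu, hwx⟩ := (mem_convexHull_image_pt (hpos t ht u hut)).1 hx
        obtain ⟨w', hw', hwu', hwx'⟩ := (mem_convexHull_image_pt (hpos t' ht' u' hut')).1 hx'
        obtain rfl := hM.inj t ht t' ht' w w' hw hw' (hwu.trans hut) (hwu'.trans hut')
          (hwx.trans hwx'.symm)
        have h1 : x ∈ convexHull ℝ (((u ∩ u').image pt : Finset (E n)) : Set (E n)) :=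
          (mem_convexHull_image_pt (hpos t ht _ (Finset.inter_subset_left.trans hut))).2
            ⟨w, hw, Finset.subset_inter hwu hwu', hwx⟩
        refine convexHull_mono ?_ h1
        rw [← Finset.coe_inter]
        exact Finset.coe_subset.2 (Finset.image_inter_subset _ _ _) }
  refine ⟨K, ⟨?_, ?_⟩, ?_⟩
  · have : F ⊆ (((M.biUnion Finset.powerset).image (fun u => u.image pt) :
        Finset (Finset (E n))) : Set (Finset (E n))) := by
      rintro s ⟨t, ht, u, hut, -, -, rfl⟩
      exact Finset.mem_coe.2 (Finset.mem_image_of_mem _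
        (Finset.mem_biUnion.2 ⟨t, ht, Finset.mem_powerset.2 hut⟩))
    exact (Finset.finite_toSet _).subset this
  · ext x
    rw [SimplicialComplex.mem_space_iff, mem_iUnion₂]
    constructor
    · rintro ⟨s, ⟨t, ht, u, hut, -, ⟨C, hC, hCu⟩, rfl⟩, hx⟩
      refine ⟨C, hC, convexHull_min ?_ (convex_cell C) hx⟩
      intro y hy
      obtain ⟨v, hv, rfl⟩ := Finset.mem_image.1 (Finset.mem_coe.1 hy)
      exact pt_mem_cell (hpos t ht u hut v hv) (hCu v hv)
    · rintro ⟨C, hC, hx⟩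
      obtain ⟨t, ht, w, hw, hwt, hwx⟩ := hcov C hC x hx
      refine ⟨w.support.image pt, ⟨t, ht, w.support, hwt, ?_, ⟨C, hC, ?_⟩, rfl⟩,
        (mem_convexHull_image_pt (hpos t ht _ hwt)).2 ⟨w, hw, subset_rfl, hwx⟩⟩
      · rw [Finsupp.support_nonempty_iff]
        rintro rfl
        have := congrFun hwx (Fin.last n)
        simp at this
      · intro v hv a ha
        rcases hs C hC a ha t ht with h | h
        · exact h v (hwt hv)
        · -- all terms of `∑ w(v) a(v) = a(x, 1) ≥ 0` are nonpositive, hence zero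
          have h0 : ∑ v ∈ w.support, w v * functional a (castVec v) = functional a (lift x) := by
            rw [← hwx, realize_eq_sum w _ subset_rfl, map_sum]
            simp
          have h1 : ∀ v ∈ w.support, w v * functional a (castVec v) ≤ 0 := fun v hv =>
            mul_nonpos_of_nonneg_of_nonpos (hw v) (h v (hwt hv))
          have h2 : ∑ v ∈ w.support, w v * functional a (castVec v) = 0 :=
            le_antisymm (Finset.sum_nonpos h1) (h0 ▸ hx a ha)
          have h3 := (Finset.sum_eq_zero_iff_of_nonpos h1).1 h2 v hv
          exact ((mul_eq_zero.1 h3).resolve_left (Finsupp.mem_support_iff.1 hv)).ge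
  · rintro s ⟨t, ht, u, hut, -, -, rfl⟩
    exact hM.isRegularSimplex hu ht hut

/-- A bounded finite union of cells has a regular triangulation. -/
theorem exists_isRegularTriangulation_of_cells {𝒞 : Set (Finset (Fin (n + 1) → ℤ))}
    (hfin : 𝒞.Finite) (hb : Bornology.IsBounded (⋃ C ∈ 𝒞, cell C)) :
    ∃ K : SimplicialComplex ℝ (E n), IsRegularTriangulation K (⋃ C ∈ 𝒞, cell C) := by
  obtain ⟨M, hM, hcov⟩ := exists_isFan_of_bounded hb
  obtain ⟨M', h1, h2⟩ := exists_refines_forall_hasSigns hM (hfin.toFinset.biUnion id)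
  obtain ⟨M'', h3, h4⟩ := exists_refines_isUnimodular h1.fan
  have h5 := h3.trans h1
  refine exists_isRegularTriangulation_of_fan h5.fan h4 𝒞 (fun C hC a ha => ?_)
    (fun C hC x hx => h5.coneSupport_subset (hcov x (mem_biUnion hC hx)))
  exact h3.hasSigns _ (h2 a (Finset.mem_biUnion.2 ⟨C, hfin.mem_toFinset.2 hC, ha⟩))

end Triangulation

/-! ### Rational polyhedra as finite unions of cells -/

section Polyhedra

variable {n : ℕ}

/-- Positive multiples of the coordinate functionals of a rational basis have integer
coefficients, by Cramer's rule. -/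
theorem exists_dual_functionals {N : ℕ} {g : Fin N → Fin N → ℤ}
    (hg : LinearIndependent ℝ (fun i => castVec (g i))) :
    ∃ (a : Fin N → Fin N → ℤ) (D : ℝ), 0 < D ∧
      ∀ i j, functional (a j) (castVec (g i)) = if i = j then D else 0 := by
  set A : Matrix (Fin N) (Fin N) ℤ := Matrix.of g with hA
  have hdet : A.det ≠ 0 := by
    have h1 : IsUnit (A.map (Int.cast : ℤ → ℝ)) := by
      rw [← Matrix.linearIndependent_rows_iff_isUnit]
      exact hg
    rw [Matrix.isUnit_iff_isUnit_det] at h1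
    intro h0
    have h2 := RingHom.map_det (Int.castRingHom ℝ) A
    rw [h0, map_zero] at h2
    exact h1.ne_zero h2.symm
  refine ⟨fun j k => A.det * A.adjugate k j, (A.det : ℝ) ^ 2, ?_, fun i j => ?_⟩
  · have : (A.det : ℝ) ≠ 0 := by exact_mod_cast hdet
    positivity
  · have h1 := congrFun (congrFun (Matrix.mul_adjugate A) i) j
    rw [Matrix.mul_apply] at h1
    have h2 : ∑ k, A.det * A.adjugate k j * g i k = if i = j then A.det ^ 2 else 0 := by
      calc ∑ k, A.det * A.adjugate k j * g i k = A.det * ∑ k, A i k * A.adjugate k j := by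
            rw [Finset.mul_sum]
            exact Finset.sum_congr rfl fun k _ => by rw [hA, Matrix.of_apply]; ring
        _ = _ := by
            rw [h1]
            simp only [Matrix.smul_apply, Matrix.one_apply, smul_eq_mul]
            split_ifs <;> ring
    rw [functional_castVec, h2]
    split_ifs <;> simp

/-- Linearly independent integer vectors can be completed to a basis of integer vectors. -/
theorem exists_extension_castVec {N : ℕ} {ι : Type*} {f : ι → Fin N → ℤ}
    (hf : LinearIndependent ℝ (fun i => castVec (f i))) :
    ∃ (g : Fin N → Fin N → ℤ) (h : ι → Fin N), LinearIndependent ℝ (fun i => castVec (g i)) ∧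
      ∀ i, g (h i) = f i := by
  obtain ⟨b, hbt, hsb, hspan, hli⟩ := exists_linearIndepOn_id_extension
    (K := ℝ) (s := range fun i => castVec (f i)) (t := range (castVec (N := N)))
    (hf.linearIndepOn_id) (by rintro _ ⟨i, rfl⟩; exact ⟨_, rfl⟩)
  have htop : ⊤ ≤ Submodule.span ℝ b := by
    rw [← Submodule.span_le] at hspan
    refine le_trans ?_ hspan
    rintro x -
    have hx : x = ∑ i, x i • castVec (Pi.single i 1) := by
      ext k
      simp [Finset.sum_apply, Pi.single_apply]
    rw [hx]
    exact Submodule.sum_mem _ fun i _ => Submodule.smul_mem _ _ (Submodule.subset_span ⟨_, rfl⟩)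
  have hli' : LinearIndependent ℝ (fun x : b => (x : Fin N → ℝ)) := hli
  let B : Module.Basis b ℝ (Fin N → ℝ) := Module.Basis.mk hli' (by simpa using htop)
  have : Fintype b := FiniteDimensional.fintypeBasisIndex B
  let e : b ≃ Fin N := Fintype.equivFinOfCardEq (by
    rw [← Module.finrank_eq_card_basis B, Module.finrank_fin_fun])
  choose z hz using fun x : b => hbt x.2
  refine ⟨fun i => z (e.symm i), fun i => e ⟨castVec (f i), hsb ⟨i, rfl⟩⟩, ?_, fun i => ?_⟩
  · simp only [hz]
    exact hli'.comp _ e.symm.injective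
  · apply castVec_injective
    rw [hz]
    simp

/-- Every rational simplex is a cell. -/
theorem IsRationalSimplex.exists_eq_cell {s : Finset (E n)}
    (hs : IsRationalSimplex (fun v : s => (v : E n))) :
    ∃ C : Finset (Fin (n + 1) → ℤ), convexHull ℝ (s : Set (E n)) = cell C := by
  classical
  have hrat : ∀ x ∈ s, IsRationalPoint x := fun x hx => hs.2 ⟨x, hx⟩
  obtain ⟨g, h, hg, hgh⟩ := exists_extension_castVec ((affineIndependent_iff_homog hs.2).1 hs.1)
  obtain ⟨a, D, hD, ha⟩ := exists_dual_functionals hg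
  have hpos : ∀ v ∈ s.image homog, 0 < v (Fin.last n) := by
    intro v hv
    obtain ⟨x, hx, rfl⟩ := Finset.mem_image.1 hv
    rw [homog_last]
    exact_mod_cast den_pos (hrat x hx)
  have himg : (s.image homog).image pt = s := by
    rw [Finset.image_image]
    conv_rhs => rw [← Finset.image_id (s := s)]
    exact Finset.image_congr fun x hx => pt_homog (hrat x hx)
  refine ⟨Finset.univ.image a ∪ (Finset.univ.filter (fun j => j ∉ range h)).image (fun j => -a j),
    subset_antisymm (convexHull_min (fun x hx => ?_) (convex_cell _)) (fun x hx => ?_)⟩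
  · have hx' : x ∈ s := hx
    rw [← pt_homog (hrat x hx')]
    refine pt_mem_cell (hpos _ (Finset.mem_image_of_mem _ hx')) fun c hc => ?_
    have hval : ∀ j, functional (a j) (castVec (homog x)) = if h ⟨x, hx'⟩ = j then D else 0 := by
      intro j
      have := ha (h ⟨x, hx'⟩) j
      rwa [hgh] at this
    rcases Finset.mem_union.1 hc with hc | hc
    · obtain ⟨j, -, rfl⟩ := Finset.mem_image.1 hc
      rw [hval]
      split_ifs
      · exact hD.le
      · exact le_rfl
    · obtain ⟨j, hj, rfl⟩ := Finset.mem_image.1 hc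
      have hj' := (Finset.mem_filter.1 hj).2
      have : functional (-a j) (castVec (homog x)) = -functional (a j) (castVec (homog x)) := by
        simp [functional_apply]
      rw [this, hval, if_neg (fun he => hj' ⟨_, he⟩), neg_zero]
  · have hcard : Fintype.card (Fin (n + 1)) = Module.finrank ℝ (Fin (n + 1) → ℝ) := by simp
    let B := basisOfLinearIndependentOfCardEqFinrank hg hcard
    have hB : ∀ i, B i = castVec (g i) := fun i => by
      rw [coe_basisOfLinearIndependentOfCardEqFinrank]
    have hsum : lift x = ∑ i, B.repr (lift x) i • castVec (g i) := by
      conv_lhs => rw [← B.sum_repr (lift x)]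
      simp only [hB]
    set c := B.repr (lift x) with hc
    have hval : ∀ j, functional (a j) (lift x) = c j * D := by
      intro j
      rw [hsum, map_sum]
      simp only [map_smul, ha, smul_eq_mul, mul_ite, mul_zero, Finset.sum_ite_eq',
        Finset.mem_univ, if_true]
    have hc0 : ∀ j, 0 ≤ c j := by
      intro j
      have := hx (a j) (Finset.mem_union_left _ (Finset.mem_image_of_mem _ (Finset.mem_univ j)))
      rw [hval] at this
      exact nonneg_of_mul_nonneg_left this hD
    have hc1 : ∀ j, j ∉ range h → c j = 0 := by
      intro j hj
      have h1 := hx (-a j) (Finset.mem_union_right _ (Finset.mem_image_of_mem _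
        (Finset.mem_filter.2 ⟨Finset.mem_univ j, hj⟩)))
      have h2 : functional (-a j) (lift x) = -functional (a j) (lift x) := by
        simp [functional_apply]
      rw [h2, hval] at h1
      have h3 := hc0 j
      nlinarith
    rw [← himg]
    refine (mem_convexHull_image_pt hpos).2 ⟨∑ j, Finsupp.single (g j) (c j), ?_, ?_, ?_⟩
    · exact Finset.sum_nonneg fun j _ => Finsupp.single_nonneg.2 (hc0 j)
    · refine support_subset_of fun v hv => ?_
      rw [Finsupp.finsetSum_apply]
      refine Finset.sum_eq_zero fun j _ => ?_
      by_cases hj : j ∈ range h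
      · obtain ⟨i, rfl⟩ := hj
        rw [hgh]
        refine Finsupp.single_eq_of_ne fun he => hv ?_
        rw [he]
        exact Finset.mem_image_of_mem _ i.2
      · rw [hc1 j hj]; simp
    · rw [map_sum, hsum]
      simp only [realize_single]

theorem isBounded_convexHull_finset (s : Finset (E n)) :
    Bornology.IsBounded (convexHull ℝ (s : Set (E n))) :=
  isBounded_convexHull.2 s.finite_toSet.isBounded

theorem isCompact_convexHull_finset (s : Finset (E n)) :
    IsCompact (convexHull ℝ (s : Set (E n))) :=
  s.finite_toSet.isCompact_convexHull ℝ

theorem IsRationalPolyhedron.isCompact {P : Set (E n)} (h : IsRationalPolyhedron P) :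
    IsCompact P := by
  obtain ⟨S, hS, -, rfl⟩ := h
  exact hS.isCompact_biUnion fun s _ => isCompact_convexHull_finset s

theorem IsRationalPolyhedron.exists_cells {P : Set (E n)} (h : IsRationalPolyhedron P) :
    ∃ 𝒞 : Set (Finset (Fin (n + 1) → ℤ)), 𝒞.Finite ∧ P = ⋃ C ∈ 𝒞, cell C := by
  obtain ⟨S, hS, hs, rfl⟩ := h
  have h1 : ∀ s : S, ∃ C, convexHull ℝ (s : Set (E n)) = cell C :=
    fun s => (hs s s.2).2.exists_eq_cell
  choose C hC using h1
  have : Finite S := hS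
  refine ⟨range C, finite_range C, ?_⟩
  rw [biUnion_range, biUnion_eq_iUnion]
  exact iUnion_congr hC

theorem IsRegularTriangulation.isRationalPolyhedron {K : SimplicialComplex ℝ (E n)}
    {P : Set (E n)} (h : IsRegularTriangulation K P) : IsRationalPolyhedron P :=
  ⟨K.faces, h.1.1, fun s hs => ⟨K.nonempty_of_mem_faces hs, (h.2 s hs).1⟩, h.1.2.symm⟩

theorem isRationalPolyhedron_of_cells {P : Set (E n)} (hb : Bornology.IsBounded P)
    {𝒞 : Set (Finset (Fin (n + 1) → ℤ))} (hfin : 𝒞.Finite) (hP : P = ⋃ C ∈ 𝒞, cell C) :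
    IsRationalPolyhedron P := by
  subst hP
  obtain ⟨K, hK⟩ := exists_isRegularTriangulation_of_cells hfin hb
  exact hK.isRationalPolyhedron

theorem IsRationalPolyhedron.exists_isRegularTriangulation {P : Set (E n)}
    (h : IsRationalPolyhedron P) :
    ∃ K : SimplicialComplex ℝ (E n), IsRegularTriangulation K P := by
  obtain ⟨𝒞, hfin, rfl⟩ := h.exists_cells
  exact exists_isRegularTriangulation_of_cells hfin h.isCompact.isBounded

theorem IsRationalPolyhedron.union {P Q : Set (E n)} (hP : IsRationalPolyhedron P)
    (hQ : IsRationalPolyhedron Q) : IsRationalPolyhedron (P ∪ Q) := by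
  obtain ⟨S, hS, hs, rfl⟩ := hP
  obtain ⟨T, hT, ht, rfl⟩ := hQ
  exact ⟨S ∪ T, hS.union hT, fun s h => h.elim (hs s) (ht s), (biUnion_union _ _ _).symm⟩

theorem IsRationalPolyhedron.inter {P Q : Set (E n)} (hP : IsRationalPolyhedron P)
    (hQ : IsRationalPolyhedron Q) : IsRationalPolyhedron (P ∩ Q) := by
  obtain ⟨𝒞, hC, hPC⟩ := hP.exists_cells
  obtain ⟨𝒟, hD, hQD⟩ := hQ.exists_cells
  refine isRationalPolyhedron_of_cells (hP.isCompact.isBounded.subset inter_subset_left)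
    (hC.image2 (fun C D => C ∪ D) hD) ?_
  rw [hPC, hQD]
  ext x
  simp only [mem_inter_iff, mem_iUnion, exists_prop, mem_image2]
  constructor
  · rintro ⟨⟨C, hC, hxC⟩, D, hD, hxD⟩
    exact ⟨_, ⟨C, hC, D, hD, rfl⟩, by rw [cell_union]; exact ⟨hxC, hxD⟩⟩
  · rintro ⟨_, ⟨C, hC, D, hD, rfl⟩, hx⟩
    rw [cell_union] at hx
    exact ⟨⟨C, hC, hx.1⟩, D, hD, hx.2⟩

theorem isRationalPolyhedron_convexHull {s : Finset (E n)} (hne : s.Nonempty)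
    (hs : IsRationalSimplex (fun v : s => (v : E n))) :
    IsRationalPolyhedron (convexHull ℝ (s : Set (E n))) :=
  ⟨{s}, finite_singleton s, by rintro _ rfl; exact ⟨hne, hs⟩, by simp⟩

end Polyhedra

/-! ### Simplexes contained in a set, and local dimension -/

section Dimension

variable {n : ℕ}

/-- The set `S` contains a `d`-simplex. -/
def HasSimplex (d : ℕ) (S : Set (E n)) : Prop :=
  ∃ v : Fin (d + 1) → E n, AffineIndependent ℝ v ∧ convexHull ℝ (range v) ⊆ S

theorem HasSimplex.mono {d : ℕ} {S T : Set (E n)} (h : HasSimplex d S) (hST : S ⊆ T) :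
    HasSimplex d T :=
  let ⟨v, hv, hvS⟩ := h
  ⟨v, hv, hvS.trans hST⟩

theorem HasSimplex.of_finset {d : ℕ} {S : Set (E n)} {s : Finset (E n)}
    (hs : AffineIndependent ℝ (fun v : s => (v : E n))) (hcard : s.card = d + 1)
    (hS : convexHull ℝ (s : Set (E n)) ⊆ S) : HasSimplex d S := by
  let e : Fin (d + 1) ≃ s := (Finset.equivFinOfCardEq hcard).symm
  refine ⟨fun i => (e i : E n), hs.comp_embedding e.toEmbedding, ?_⟩
  have : range (fun i => (e i : E n)) = (s : Set (E n)) := by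
    rw [show (fun i => (e i : E n)) = Subtype.val ∘ e from rfl, range_comp, e.range_eq_univ,
      image_univ]
    exact Subtype.range_coe
  rwa [this]

theorem HasSimplex.of_le {d k : ℕ} {S : Set (E n)} (h : HasSimplex d S) (hk : k ≤ d) :
    HasSimplex k S := by
  obtain ⟨v, hv, hvS⟩ := h
  let e : Fin (k + 1) ↪ Fin (d + 1) := (Fin.castLEEmb (by omega))
  refine ⟨v ∘ e, hv.comp_embedding e, (convexHull_mono ?_).trans hvS⟩
  exact range_comp_subset_range e v

theorem affineIndependent_image {ι : Type*} [Fintype ι] {v : ι → E n}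
    (hv : AffineIndependent ℝ v) :
    AffineIndependent ℝ (fun x : (Finset.univ.image v : Finset (E n)) => (x : E n)) := by
  have hsub : ((Finset.univ.image v : Finset (E n)) : Set (E n)) ⊆ range v := by simp
  exact AffineIndependent.mono (s := ((Finset.univ.image v : Finset (E n)) : Set (E n))) hv.range hsub

theorem dimLE_iff {P : Set (E n)} {d : ℕ} : DimLE P d ↔ ¬ HasSimplex (d + 1) P := by
  constructor
  · rintro h ⟨v, hv, hvP⟩
    have h1 := h (Finset.univ.image v) (affineIndependent_image hv) (by simpa using hvP)
    rw [Finset.card_image_of_injective _ hv.injective, Finset.card_fin] at h1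
    omega
  · intro h s hs hsP
    by_contra hcon
    obtain ⟨k, hk⟩ : ∃ k, s.card = k + 1 := ⟨s.card - 1, by omega⟩
    exact h ((HasSimplex.of_finset hs hk hsP).of_le (by omega))

theorem lift_mem_span_of_mem_convexHull {s : Set (E n)} {x : E n} (hx : x ∈ convexHull ℝ s) :
    lift x ∈ Submodule.span ℝ (lift '' s) := by
  refine convexHull_min (t := {x | lift x ∈ Submodule.span ℝ (lift '' s)})
    (fun y hy => Submodule.subset_span ⟨y, hy, rfl⟩) ?_ hx
  intro y hy z hz a b _ _ hab
  change lift (a • y + b • z) ∈ Submodule.span ℝ (lift '' s)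
  rw [lift_smul_add_smul y z hab]
  exact Submodule.add_mem _ (Submodule.smul_mem _ _ hy) (Submodule.smul_mem _ _ hz)

theorem HasSimplex.lt_card_of_span {d : ℕ} {S : Set (E n)} (h : HasSimplex d S)
    {T : Finset (Fin (n + 1) → ℝ)}
    (hT : ∀ x ∈ S, lift x ∈ Submodule.span ℝ (T : Set (Fin (n + 1) → ℝ))) : d < T.card := by
  obtain ⟨v, hv, hvs⟩ := h
  rw [affineIndependent_iff_lift] at hv
  have hli : LinearIndependent ℝ (fun i =>
      (⟨lift (v i), hT _ (hvs (subset_convexHull ℝ _ ⟨i, rfl⟩))⟩ :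
        Submodule.span ℝ (T : Set (Fin (n + 1) → ℝ)))) :=
    LinearIndependent.of_comp (Submodule.subtype _) hv
  have h1 := hli.fintype_card_le_finrank
  have h2 := finrank_span_finset_le_card (R := ℝ) T
  rw [Fintype.card_fin] at h1
  exact h1.trans h2

theorem HasSimplex.lt_card {d : ℕ} {s : Finset (E n)}
    (h : HasSimplex d (convexHull ℝ (s : Set (E n)))) : d < s.card := by
  classical
  refine (h.lt_card_of_span (T := s.image lift) fun x hx => ?_).trans_le Finset.card_image_le
  rw [Finset.coe_image]
  exact lift_mem_span_of_mem_convexHull hx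

/-- The affine parametrization of the affine span of `v`, mapping the standard corner simplex onto
the simplex with vertices `v`. -/
noncomputable def cornerMap {d : ℕ} (v : Fin (d + 1) → E n) : (Fin d → ℝ) →ᵃ[ℝ] E n :=
  (Fintype.linearCombination ℝ (fun i : Fin d => v i.succ - v 0)).toAffineMap +
    AffineMap.const ℝ _ (v 0)

theorem cornerMap_apply {d : ℕ} (v : Fin (d + 1) → E n) (t : Fin d → ℝ) :
    cornerMap v t = ∑ i, t i • (v i.succ - v 0) + v 0 := by
  simp [cornerMap, Fintype.linearCombination_apply]

theorem cornerMap_mem_convexHull {d : ℕ} (v : Fin (d + 1) → E n) {t : Fin d → ℝ}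
    (h0 : ∀ i, 0 ≤ t i) (h1 : ∑ i, t i ≤ 1) : cornerMap v t ∈ convexHull ℝ (range v) := by
  have h : cornerMap v t = ∑ j, (Fin.cons (1 - ∑ i, t i) t : Fin (d + 1) → ℝ) j • v j := by
    rw [cornerMap_apply, Fin.sum_univ_succ]
    simp only [Fin.cons_zero, Fin.cons_succ, smul_sub, Finset.sum_sub_distrib, sub_smul, one_smul,
      ← Finset.sum_smul]
    abel
  rw [h]
  refine (convex_convexHull ℝ _).sum_mem (fun j _ => ?_) ?_
    (fun j _ => subset_convexHull ℝ _ ⟨j, rfl⟩)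
  · refine Fin.cases ?_ (fun i => ?_) j
    · simpa using h1
    · simpa using h0 i
  · simp [Fin.sum_univ_succ]

/-- If finitely many closed sets cover a set that contains a `d`-simplex, then one of them contains
a smaller `d`-simplex: by Baire's theorem, one of them has interior points relative to the given
simplex. -/
theorem HasSimplex.exists_of_cover {d : ℕ} {S : Set (E n)} (h : HasSimplex d S) {ι : Type*}
    [Finite ι] {C : ι → Set (E n)} (hC : ∀ i, IsClosed (C i)) (hcov : S ⊆ ⋃ i, C i) :
    ∃ i, HasSimplex d (C i ∩ S) := by
  obtain ⟨v, hv, hvS⟩ := h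
  have hcont : Continuous (cornerMap v) := (cornerMap v).continuous_of_finiteDimensional
  set O : Set (Fin d → ℝ) := {t | (∀ i, 0 < t i) ∧ ∑ i, t i < 1} with hO
  have hOopen : IsOpen O := by
    have h1 : IsOpen {t : Fin d → ℝ | ∀ i, 0 < t i} := by
      simp only [ofPred_forall]
      exact isOpen_iInter_of_finite fun i => isOpen_lt continuous_const (continuous_apply i)
    exact h1.inter (isOpen_lt (by fun_prop : Continuous fun t : Fin d → ℝ => ∑ i, t i)
      continuous_const)
  have hOS : ∀ t ∈ O, cornerMap v t ∈ S := fun t ht =>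
    hvS (cornerMap_mem_convexHull v (fun i => (ht.1 i).le) ht.2.le)
  have hOne : O.Nonempty := by
    refine ⟨fun _ => 1 / (d + 1), fun i => by positivity, ?_⟩
    rw [Finset.sum_const, Finset.card_fin, nsmul_eq_mul, mul_one_div, div_lt_one (by positivity)]
    linarith
  let D : Option ι → Set (Fin d → ℝ) := fun i => i.elim Oᶜ (fun i => cornerMap v ⁻¹' C i)
  have hdense : Dense (⋃ i, interior (D i)) := by
    refine dense_iUnion_interior_of_closed (fun i => ?_) ?_
    · cases i with
      | none => exact hOopen.isClosed_compl
      | some i => exact (hC i).preimage hcont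
    · refine eq_univ_of_forall fun t => ?_
      by_cases ht : t ∈ O
      · obtain ⟨i, hi⟩ := mem_iUnion.1 (hcov (hOS t ht))
        exact mem_iUnion.2 ⟨some i, hi⟩
      · exact mem_iUnion.2 ⟨none, ht⟩
  obtain ⟨t, htO, ht⟩ := hdense.inter_open_nonempty O hOopen hOne
  obtain ⟨i, hi⟩ := mem_iUnion.1 ht
  cases i with
  | none => exact absurd htO (interior_subset hi)
  | some i =>
    refine ⟨i, ?_⟩
    have hnhds : (interior (D (some i)) ∩ O) ∈ nhds t :=
      (isOpen_interior.inter hOopen).mem_nhds ⟨hi, htO⟩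
    obtain ⟨ε, hε, hball⟩ := Metric.mem_nhds_iff.1 hnhds
    have hsub : cornerMap v '' Metric.ball t ε ⊆ C i ∩ S := by
      rintro _ ⟨u, hu, rfl⟩
      exact ⟨interior_subset (s := D (some i)) (hball hu).1, hOS u (hball hu).2⟩
    let v' : Fin (d + 1) → E n := fun j => cornerMap v
      (Fin.cases (motive := fun _ => Fin d → ℝ) t (fun k => t + Pi.single k (ε / 2)) j)
    have hv'0 : v' 0 = cornerMap v t := rfl
    have hv's : ∀ k : Fin d, v' k.succ = cornerMap v (t + Pi.single k (ε / 2)) := fun k => rfl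
    refine ⟨v', ?_, (convexHull_min ?_ ((convex_ball t ε).affine_image _)).trans hsub⟩
    · rw [affineIndependent_iff_linearIndependent_vsub ℝ _ (0 : Fin (d + 1))] at hv ⊢
      have hdiff : ∀ k : Fin d, v' k.succ - v' 0 = (ε / 2) • (v k.succ - v 0) := by
        intro k
        rw [hv'0, hv's, cornerMap_apply, cornerMap_apply, add_sub_add_right_eq_sub,
          ← Finset.sum_sub_distrib, Finset.sum_eq_single k]
        · simp [← sub_smul]
        · intro j _ hj
          simp [hj]
        · simp
      have hε2 : ε / 2 ≠ 0 := by positivity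
      have := hv.units_smul (fun _ => Units.mk0 _ hε2)
      convert this using 1
      ext1 ⟨j, hj⟩
      obtain ⟨k, rfl⟩ := Fin.exists_succ_eq.2 hj
      exact hdiff k
    · rintro _ ⟨j, rfl⟩
      refine ⟨_, ?_, rfl⟩
      refine Fin.cases ?_ (fun k => ?_) j
      · exact Metric.mem_ball_self hε
      · rw [Metric.mem_ball, dist_eq_norm]
        simp [Pi.norm_single, abs_of_pos hε]
        linarith

/-- A simplex contains small copies of itself near each of its points. -/
theorem HasSimplex.of_mem_nhds {d : ℕ} {v : Fin (d + 1) → E n} (hv : AffineIndependent ℝ v)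
    {x : E n} (hx : x ∈ convexHull ℝ (range v)) {U : Set (E n)} (hU : IsOpen U) (hxU : x ∈ U) :
    HasSimplex d (convexHull ℝ (range v) ∩ U) := by
  obtain ⟨ε, hε, hball⟩ := Metric.isOpen_iff.1 hU x hxU
  obtain ⟨R, hR⟩ := ((finite_range v).isBounded).subset_closedBall x
  set r : ℝ := min 1 (ε / (2 * (|R| + 1))) with hr
  have hr0 : 0 < r := lt_min one_pos (by positivity)
  have hr1 : r ≤ 1 := min_le_left _ _
  refine ⟨fun i => AffineMap.homothety x r (v i), ?_, subset_inter (convexHull_min ?_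
    (convex_convexHull ℝ _)) ((convexHull_min ?_ (convex_ball x ε)).trans hball)⟩
  · refine hv.map' (AffineMap.homothety x r) fun a b hab => ?_
    simpa [AffineMap.homothety_apply, hr0.ne'] using hab
  · rintro _ ⟨i, rfl⟩
    change AffineMap.homothety x r (v i) ∈ _
    rw [AffineMap.homothety_eq_lineMap]
    have h1 : v i ∈ convexHull ℝ (range v) := subset_convexHull ℝ _ ⟨i, rfl⟩
    exact (convex_convexHull ℝ _).lineMap_mem hx h1 ⟨hr0.le, hr1⟩
  · rintro _ ⟨i, rfl⟩
    have h1 : dist (v i) x ≤ |R| := (Metric.mem_closedBall.1 (hR ⟨i, rfl⟩)).trans (le_abs_self R)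
    rw [Metric.mem_ball, dist_comm, dist_center_homothety, Real.norm_eq_abs, abs_of_pos hr0,
      dist_comm]
    calc r * dist (v i) x ≤ (ε / (2 * (|R| + 1))) * (|R| + 1) :=
          mul_le_mul (min_le_right _ _) (by linarith) dist_nonneg (by positivity)
      _ = ε / 2 := by field_simp
      _ < ε := by linarith

/-- An affine map that is injective on a simplex maps it onto a simplex. -/
theorem AffineIndependent.map_of_injOn {m d : ℕ} {v : Fin (d + 1) → E n}
    (hv : AffineIndependent ℝ v) (f : E n →ᵃ[ℝ] E m) (hf : InjOn f (convexHull ℝ (range v))) :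
    AffineIndependent ℝ (f ∘ v) := by
  rw [affineIndependent_iff_of_fintype]
  intro w hw0 hw
  rw [Finset.weightedVSub_eq_linear_combination _ hw0] at hw
  by_contra hcon
  push Not at hcon
  -- move the barycenter in the direction of an affine dependence of the images
  obtain ⟨ε, hε, hε'⟩ : ∃ ε : ℝ, 0 < ε ∧ ∀ i, ε * |w i| ≤ 1 / (d + 1) := by
    refine ⟨1 / ((d + 1) * (1 + ∑ i, |w i|)), by positivity, fun i => ?_⟩
    have h1 : |w i| ≤ 1 + ∑ i, |w i| := by
      have : |w i| ≤ ∑ i, |w i| := Finset.single_le_sum (f := fun i => |w i|)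
        (fun i _ => abs_nonneg _) (Finset.mem_univ i)
      linarith
    have h2 : 0 < 1 + ∑ i, |w i| := by positivity
    rw [div_mul_eq_mul_div, one_mul, div_le_div_iff₀ (by positivity) (by positivity)]
    nlinarith
  have hd : (0 : ℝ) < d + 1 := by positivity
  set u : Fin (d + 1) → ℝ := fun i => 1 / (d + 1) + ε * w i with hu
  have hu0 : ∀ i, 0 ≤ u i := fun i => by
    have h1 := hε' i
    have h2 : -(ε * |w i|) ≤ ε * w i := by
      have := neg_abs_le (w i)
      nlinarith
    simp only [hu]
    linarith
  have hc1 : ∑ _i : Fin (d + 1), (1 : ℝ) / (d + 1) = 1 := by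
    simp; field_simp
  have hu1 : ∑ i, u i = 1 := by
    simp only [hu, Finset.sum_add_distrib, ← Finset.mul_sum, hw0, hc1]
    simp
  have hx : ∑ i, u i • v i ∈ convexHull ℝ (range v) :=
    (convex_convexHull ℝ _).sum_mem (fun i _ => hu0 i) hu1
      (fun i _ => subset_convexHull ℝ _ ⟨i, rfl⟩)
  have hc : ∑ i, ((1 : ℝ) / (d + 1)) • v i ∈ convexHull ℝ (range v) :=
    (convex_convexHull ℝ _).sum_mem (fun i _ => by positivity) hc1
      (fun i _ => subset_convexHull ℝ _ ⟨i, rfl⟩)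
  have hmap : ∀ a : Fin (d + 1) → ℝ, ∑ i, a i = 1 →
      f (∑ i, a i • v i) = ∑ i, a i • f (v i) := by
    intro a ha
    rw [← Finset.affineCombination_eq_linear_combination _ v a ha, Finset.map_affineCombination _ _ _ ha,
      Finset.affineCombination_eq_linear_combination _ _ a ha]
    rfl
  have heq : f (∑ i, u i • v i) = f (∑ i, ((1 : ℝ) / (d + 1)) • v i) := by
    rw [hmap u hu1, hmap _ hc1]
    simp only [hu, add_smul, Finset.sum_add_distrib, mul_smul, ← Finset.smul_sum]
    simp only [Function.comp_apply] at hw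
    rw [hw, smul_zero, add_zero]
  have h1 := hf hx hc heq
  have h2 : ∑ i, w i • v i = 0 := by
    simp only [hu, add_smul, Finset.sum_add_distrib, mul_smul, ← Finset.smul_sum] at h1
    have := add_eq_left.1 h1
    exact (smul_eq_zero.1 this).resolve_left hε.ne'
  obtain ⟨i, hi⟩ := hcon
  exact hi (affineIndependent_iff.1 hv Finset.univ w hw0 h2 i (Finset.mem_univ i))

/-- The affine map with the given integer coefficients. -/
noncomputable def integerAffineMap {m : ℕ} (l : Fin m → (Fin n → ℤ) × ℤ) : E n →ᵃ[ℝ] E m :=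
  (WithLp.linearEquiv 2 ℝ (Fin m → ℝ)).symm.toLinearMap.toAffineMap.comp
    (AffineMap.pi fun i => (∑ j, ((l i).1 j : ℝ) • (EuclideanSpace.proj (𝕜 := ℝ) j).toLinearMap :
      E n →ₗ[ℝ] ℝ).toAffineMap + AffineMap.const ℝ (E n) ((l i).2 : ℝ))

theorem integerAffineMap_apply {m : ℕ} (l : Fin m → (Fin n → ℤ) × ℤ) (x : E n) (i : Fin m) :
    integerAffineMap l x i = ∑ j, ((l i).1 j : ℝ) * x j + ((l i).2 : ℝ) := by
  simp [integerAffineMap]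

/-- Injective piecewise linear maps do not lower the dimension. -/
theorem HasSimplex.image {m d : ℕ} {P S : Set (E n)} (hS : HasSimplex d S) (hSP : S ⊆ P)
    {f : E n → E m} (hf : IsIntegerPL P f) (hinj : InjOn f P) : HasSimplex d (f '' S) := by
  obtain ⟨v, hv, hvS⟩ := hS
  have hT : HasSimplex d (convexHull ℝ (range v)) := ⟨v, hv, subset_rfl⟩
  have hTc : IsCompact (convexHull ℝ (range v)) := (finite_range v).isCompact_convexHull ℝ
  choose F hF hFl using hf.2
  have : ∀ i, Finite (F i) := fun i => hF i
  let C : (∀ i, F i) → Set (E n) := fun l =>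
    {x | x ∈ convexHull ℝ (range v) ∧ f x = integerAffineMap (fun i => (l i : (Fin n → ℤ) × ℤ)) x}
  have hcontf : ContinuousOn f (convexHull ℝ (range v)) := hf.1.mono (hvS.trans hSP)
  have hCclosed : ∀ l, IsClosed (C l) := fun l => by
    have h1 : ContinuousOn (fun x => (f x, integerAffineMap (fun i => (l i : (Fin n → ℤ) × ℤ)) x))
        (convexHull ℝ (range v)) :=
      hcontf.prodMk (AffineMap.continuous_of_finiteDimensional _).continuousOn
    exact h1.preimage_isClosed_of_isClosed hTc.isClosed isClosed_diagonal
  have hcov : convexHull ℝ (range v) ⊆ ⋃ l, C l := by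
    intro x hx
    choose l hl hlx using fun i => hFl i x (hSP (hvS hx))
    refine mem_iUnion.2 ⟨fun i => ⟨l i, hl i⟩, hx, ?_⟩
    ext i
    rw [hlx, integerAffineMap_apply]
  obtain ⟨l, v', hv', hv'C⟩ := hT.exists_of_cover hCclosed hcov
  set g := integerAffineMap (fun i => (l i : (Fin n → ℤ) × ℤ)) with hg
  have hfg : ∀ x ∈ convexHull ℝ (range v'), f x = g x := fun x hx => (hv'C hx).1.2
  refine ⟨g ∘ v', AffineIndependent.map_of_injOn hv' g fun x hx y hy hxy => ?_, ?_⟩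
  · rw [← hfg x hx, ← hfg y hy] at hxy
    exact hinj (hSP (hvS (hv'C hx).2)) (hSP (hvS (hv'C hy).2)) hxy
  · rw [range_comp, ← AffineMap.image_convexHull]
    rintro _ ⟨x, hx, rfl⟩
    exact ⟨x, hvS (hv'C hx).2, hfg x hx⟩

end Dimension

/-! ### The dimensional parts of a polyhedron -/

section DimPart

variable {n : ℕ}

/-- The points of a simplex all of whose barycentric coordinates are positive. -/
def relInt (s : Finset (E n)) : Set (E n) :=
  {x | ∃ w : E n → ℝ, (∀ v ∈ s, 0 < w v) ∧ ∑ v ∈ s, w v = 1 ∧ ∑ v ∈ s, w v • v = x}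

theorem relInt_subset_convexHull (s : Finset (E n)) : relInt s ⊆ convexHull ℝ (s : Set (E n)) := by
  rintro _ ⟨w, hw, h1, rfl⟩
  exact (convex_convexHull ℝ _).sum_mem (fun v hv => (hw v hv).le) h1
    (fun v hv => subset_convexHull ℝ _ hv)

theorem nonempty_of_mem_relInt {s : Finset (E n)} {x : E n} (hx : x ∈ relInt s) : s.Nonempty := by
  obtain ⟨w, -, h1, -⟩ := hx
  by_contra h
  rw [Finset.not_nonempty_iff_eq_empty] at h
  simp [h] at h1

theorem exists_mem_relInt {s : Finset (E n)} {x : E n} (hx : x ∈ convexHull ℝ (s : Set (E n))) :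
    ∃ t ⊆ s, x ∈ relInt t := by
  classical
  obtain ⟨w, hw, h1, rfl⟩ := Finset.mem_convexHull'.1 hx
  refine ⟨s.filter (fun v => w v ≠ 0), Finset.filter_subset _ _, w, fun v hv => ?_, ?_, ?_⟩
  · obtain ⟨hv, hv0⟩ := Finset.mem_filter.1 hv
    exact lt_of_le_of_ne (hw v hv) hv0.symm
  · rw [← h1]
    exact Finset.sum_filter_ne_zero s
  · refine Finset.sum_filter_of_ne fun v _ hv h0 => hv ?_
    rw [h0, zero_smul]

theorem eq_of_affineIndependent {s : Finset (E n)}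
    (hs : AffineIndependent ℝ (fun v : s => (v : E n))) {w w' : E n → ℝ}
    (h1 : ∑ v ∈ s, w v = ∑ v ∈ s, w' v) (h2 : ∑ v ∈ s, w v • v = ∑ v ∈ s, w' v • v) :
    ∀ v ∈ s, w v = w' v := by
  intro v hv
  have := affineIndependent_iff.1 hs Finset.univ (fun v => w v - w' v) (by
    rw [Finset.sum_coe_sort s (fun v => w v - w' v), Finset.sum_sub_distrib, h1, sub_self]) (by
    rw [Finset.sum_coe_sort s (fun v => (w v - w' v) • v)]
    simp only [sub_smul, Finset.sum_sub_distrib]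
    rw [h2, sub_self]) ⟨v, hv⟩ (Finset.mem_univ _)
  exact sub_eq_zero.1 this

/-- A face that meets the relative interior of another one contains it. -/
theorem subset_of_mem_relInt {K : SimplicialComplex ℝ (E n)} {s t : Finset (E n)}
    (hs : s ∈ K.faces) (ht : t ∈ K.faces) {x : E n} (hx : x ∈ relInt s)
    (hxt : x ∈ convexHull ℝ (t : Set (E n))) : s ⊆ t := by
  classical
  have h := K.inter_subset_convexHull hs ht ⟨relInt_subset_convexHull s hx, hxt⟩
  rw [← Finset.coe_inter] at h
  obtain ⟨w', hw', h1', hx'⟩ := Finset.mem_convexHull'.1 h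
  obtain ⟨w, hw, h1, hxw⟩ := hx
  have hsub : s ∩ t ⊆ s := Finset.inter_subset_left
  have hz : ∀ v ∈ s, v ∉ s ∩ t → (if v ∈ s ∩ t then w' v else 0) = 0 := fun v _ hv => if_neg hv
  have key := eq_of_affineIndependent (K.indep hs) (w := w)
    (w' := fun v => if v ∈ s ∩ t then w' v else 0) (by
      rw [h1, ← Finset.sum_subset hsub hz, ← h1']
      exact Finset.sum_congr rfl fun v hv => (if_pos hv).symm) (by
      rw [hxw, ← hx', ← Finset.sum_subset hsub fun v hv hv' => by rw [hz v hv hv', zero_smul]]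
      exact Finset.sum_congr rfl fun v hv => by simp only [if_pos hv])
  intro v hv
  have h2 := key v hv
  by_contra hvt
  rw [if_neg (fun h => hvt (Finset.mem_inter.1 h).2)] at h2
  exact (hw v hv).ne' h2

theorem convexHull_subset_closure_relInt {s : Finset (E n)} (hs : s.Nonempty) :
    convexHull ℝ (s : Set (E n)) ⊆ closure (relInt s) := by
  intro x hx
  obtain ⟨w, hw, h1, hxw⟩ := Finset.mem_convexHull'.1 hx
  have hcard : (0 : ℝ) < s.card := by exact_mod_cast Finset.card_pos.2 hs
  set c : E n := ∑ v ∈ s, (1 / (s.card : ℝ)) • v with hc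
  -- the segment from `x` to the barycenter `c` approaches `x` through the relative interior
  have hlim : Filter.Tendsto (fun ε : ℝ => x + ε • (c - x)) (nhdsWithin 0 (Ioo 0 1)) (nhds x) := by
    have : Continuous (fun ε : ℝ => x + ε • (c - x)) := by fun_prop
    have h := this.tendsto 0
    rw [zero_smul, add_zero] at h
    exact h.mono_left nhdsWithin_le_nhds
  have : (nhdsWithin (0 : ℝ) (Ioo 0 1)).NeBot := by
    rw [← mem_closure_iff_nhdsWithin_neBot, closure_Ioo zero_ne_one]
    exact ⟨le_rfl, zero_le_one⟩
  refine mem_closure_of_tendsto hlim ?_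
  filter_upwards [self_mem_nhdsWithin] with ε hε
  refine ⟨fun v => (1 - ε) * w v + ε * (1 / s.card), fun v hv => ?_, ?_, ?_⟩
  · have h2 := hw v hv
    have h3 : 0 < ε * (1 / (s.card : ℝ)) := mul_pos hε.1 (by positivity)
    have h4 : 0 ≤ (1 - ε) * w v := mul_nonneg (by linarith [hε.2]) h2
    linarith
  · rw [Finset.sum_add_distrib, ← Finset.mul_sum, h1, Finset.sum_const, nsmul_eq_mul]
    field_simp
    ring
  · simp only [add_smul, mul_smul, Finset.sum_add_distrib, ← Finset.smul_sum]
    rw [hxw, ← hc]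
    module

/-- The points of `P` at which `P` is locally `d`-dimensional. -/
def localDimSet (d : ℕ) (P : Set (E n)) : Set (E n) :=
  {x | (∃ U, IsOpen U ∧ x ∈ U ∧ ¬ HasSimplex (d + 1) (P ∩ U)) ∧
    ∀ V, IsOpen V → x ∈ V → HasSimplex d (P ∩ V)}

theorem HasSimplex.nonempty {d : ℕ} {S : Set (E n)} (h : HasSimplex d S) : S.Nonempty := by
  obtain ⟨v, -, hv⟩ := h
  exact ⟨v 0, hv (subset_convexHull ℝ _ ⟨0, rfl⟩)⟩

theorem localDimSet_subset {d : ℕ} {P : Set (E n)} (hP : IsClosed P) : localDimSet d P ⊆ P := by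
  rintro x ⟨-, hx⟩
  rw [← hP.closure_eq, mem_closure_iff]
  intro V hV hxV
  rw [inter_comm]
  exact (hx V hV hxV).nonempty

theorem HasSimplex.of_mem_nhds_finset {d : ℕ} {s : Finset (E n)}
    (hs : AffineIndependent ℝ (fun v : s => (v : E n))) (hcard : s.card = d + 1)
    {x : E n} (hx : x ∈ convexHull ℝ (s : Set (E n))) {U : Set (E n)} (hU : IsOpen U)
    (hxU : x ∈ U) : HasSimplex d (convexHull ℝ (s : Set (E n)) ∩ U) := by
  let e : Fin (d + 1) ≃ s := (Finset.equivFinOfCardEq hcard).symm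
  have hr : range (fun i => (e i : E n)) = (s : Set (E n)) := by
    rw [show (fun i => (e i : E n)) = Subtype.val ∘ e from rfl, range_comp, e.range_eq_univ,
      image_univ]
    exact Subtype.range_coe
  have h := HasSimplex.of_mem_nhds (hs.comp_embedding e.toEmbedding)
    (x := x) (by rw [show range ((fun v : s => (v : E n)) ∘ e.toEmbedding) = s from hr]; exact hx)
    hU hxU
  rwa [show range ((fun v : s => (v : E n)) ∘ e.toEmbedding) = s from hr] at h

theorem isClosed_maxSimplexUnion {K : SimplicialComplex ℝ (E n)} (hK : K.faces.Finite) (d : ℕ) :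
    IsClosed (maxSimplexUnion K d) :=
  (hK.subset fun _ hs => K.facets_subset hs.1).isClosed_biUnion
    fun s _ => (isCompact_convexHull_finset s).isClosed

theorem relInt_subset_localDimSet {K : SimplicialComplex ℝ (E n)} {P : Set (E n)}
    (hK : IsTriangulation K P) {d : ℕ} {s : Finset (E n)} (hs : s ∈ maxSimplexes K d) :
    relInt s ⊆ localDimSet d P := by
  intro x hx
  have hsf : s ∈ K.faces := K.facets_subset hs.1
  refine ⟨⟨(⋃ t ∈ {t ∈ K.faces | x ∉ convexHull ℝ (t : Set (E n))},
    convexHull ℝ (t : Set (E n)))ᶜ, ?_, ?_, ?_⟩, fun V hV hxV => ?_⟩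
  · exact ((hK.1.subset fun t ht => ht.1).isClosed_biUnion
      fun t _ => (isCompact_convexHull_finset t).isClosed).isOpen_compl
  · simp only [mem_compl_iff, mem_iUnion, not_exists]
    exact fun t ht => ht.2
  · intro h
    have hsub : P ∩ (⋃ t ∈ {t ∈ K.faces | x ∉ convexHull ℝ (t : Set (E n))},
        convexHull ℝ (t : Set (E n)))ᶜ ⊆ convexHull ℝ (s : Set (E n)) := by
      rintro y ⟨hyP, hy⟩
      rw [← hK.2] at hyP
      obtain ⟨t, ht, hyt⟩ := SimplicialComplex.mem_space_iff.1 hyP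
      have hxt : x ∈ convexHull ℝ (t : Set (E n)) := by
        by_contra hxt
        exact hy (mem_biUnion (show t ∈ {t ∈ K.faces | _} from ⟨ht, hxt⟩) hyt)
      obtain rfl := hs.1.2 ht (subset_of_mem_relInt hsf ht hx hxt)
      exact hyt
    have := (h.mono hsub).lt_card
    rw [hs.2] at this
    exact lt_irrefl _ this
  · refine (HasSimplex.of_mem_nhds_finset (K.indep hsf) hs.2 (relInt_subset_convexHull s hx) hV
      hxV).mono (inter_subset_inter_left _ ?_)
    rw [← hK.2]
    exact K.convexHull_subset_space hsf

theorem exists_mem_facets {K : SimplicialComplex ℝ (E n)} (hK : K.faces.Finite) {s : Finset (E n)}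
    (hs : s ∈ K.faces) : ∃ t ∈ K.facets, s ⊆ t := by
  obtain ⟨t, hst, ht⟩ := hK.exists_le_maximal hs
  exact ⟨t, ⟨ht.1, fun u hu htu => le_antisymm htu (ht.2 hu htu)⟩, hst⟩

theorem localDimSet_subset_maxSimplexUnion {K : SimplicialComplex ℝ (E n)} {P : Set (E n)}
    (hK : IsTriangulation K P) (d : ℕ) : localDimSet d P ⊆ maxSimplexUnion K d := by
  rintro x ⟨⟨U, hU, hxU, hdim⟩, hx⟩
  -- near `x` only the faces that contain `x` matter, and one of them has dimension at least `d`
  have hW : IsOpen (⋃ t ∈ {t ∈ K.faces | x ∉ convexHull ℝ (t : Set (E n))},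
      convexHull ℝ (t : Set (E n)))ᶜ := ((hK.1.subset fun t ht => ht.1).isClosed_biUnion
    fun t _ => (isCompact_convexHull_finset t).isClosed).isOpen_compl
  have hxW : x ∈ (⋃ t ∈ {t ∈ K.faces | x ∉ convexHull ℝ (t : Set (E n))},
      convexHull ℝ (t : Set (E n)))ᶜ := by
    simp only [mem_compl_iff, mem_iUnion, not_exists]
    exact fun t ht => ht.2
  have hfin : Finite {t | t ∈ K.faces ∧ x ∈ convexHull ℝ (t : Set (E n))} :=
    hK.1.subset fun t ht => ht.1
  obtain ⟨⟨t, ht, hxt⟩, h⟩ := (hx _ hW hxW).exists_of_cover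
    (C := fun t : {t | t ∈ K.faces ∧ x ∈ convexHull ℝ (t : Set (E n))} =>
      convexHull ℝ ((t : Finset (E n)) : Set (E n)))
    (fun t => (isCompact_convexHull_finset _).isClosed) (by
      rintro y ⟨hyP, hy⟩
      rw [← hK.2] at hyP
      obtain ⟨t, ht, hyt⟩ := SimplicialComplex.mem_space_iff.1 hyP
      refine mem_iUnion.2 ⟨⟨t, ht, ?_⟩, hyt⟩
      by_contra hxt
      exact hy (mem_biUnion (show t ∈ {t ∈ K.faces | _} from ⟨ht, hxt⟩) hyt))
  have hcard := (h.mono inter_subset_left).lt_card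
  obtain ⟨t', ht', htt'⟩ := exists_mem_facets hK.1 ht
  have hxt' : x ∈ convexHull ℝ (t' : Set (E n)) :=
    convexHull_mono (Finset.coe_subset.2 htt') hxt
  have hcard' : t'.card = d + 1 := by
    have h1 := Finset.card_le_card htt'
    by_contra hne
    obtain ⟨k, hk⟩ : ∃ k, t'.card = k + 1 := ⟨t'.card - 1, by simp only at hcard; omega⟩
    refine hdim (((HasSimplex.of_mem_nhds_finset (K.indep ht'.1) hk hxt' hU hxU).mono
      (inter_subset_inter_left _ ?_)).of_le (by simp only at hcard; omega))
    rw [← hK.2]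
    exact K.convexHull_subset_space ht'.1
  exact mem_biUnion (show t' ∈ maxSimplexes K d from ⟨ht', hcard'⟩) hxt'

/-- The union of the maximal `d`-simplexes does not depend on the triangulation: it is the closure
of the set of points of local dimension `d`. -/
theorem IsTriangulation.maxSimplexUnion_eq {K : SimplicialComplex ℝ (E n)} {P : Set (E n)}
    (hK : IsTriangulation K P) (d : ℕ) : maxSimplexUnion K d = closure (localDimSet d P) := by
  refine subset_antisymm (iUnion₂_subset fun s hs => ?_)
    (closure_minimal (localDimSet_subset_maxSimplexUnion hK d) (isClosed_maxSimplexUnion hK.1 d))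
  exact (convexHull_subset_closure_relInt (K.nonempty_of_mem_faces hs.1.1)).trans
    (closure_mono (relInt_subset_localDimSet hK hs))

theorem IsTriangulation.dimPart_eq {K : SimplicialComplex ℝ (E n)} {P : Set (E n)}
    (hK : IsTriangulation K P) (d : ℕ) : dimPart d P = maxSimplexUnion K d := by
  have h : ∃ K : SimplicialComplex ℝ (E n), IsTriangulation K P := ⟨K, hK⟩
  rw [dimPart, dif_pos h, h.choose_spec.maxSimplexUnion_eq d, hK.maxSimplexUnion_eq d]

theorem mapsTo_localDimSet {m d : ℕ} {P : Set (E n)} {Q : Set (E m)} (hP : IsClosed P)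
    {f : E n → E m} {g : E m → E n} (hfPQ : MapsTo f P Q) (hgQP : MapsTo g Q P)
    (hfg : InvOn g f P Q) (hf : IsIntegerPL P f) (hg : IsIntegerPL Q g) :
    MapsTo f (localDimSet d P) (localDimSet d Q) := by
  intro x hx
  have hxP := localDimSet_subset hP hx
  obtain ⟨⟨U, hU, hxU, hdim⟩, hx⟩ := hx
  refine ⟨?_, fun V hV hfV => ?_⟩
  · obtain ⟨W, hW, hxW, hWU⟩ := continuousOn_iff.1 hg.1 (f x) (hfPQ hxP) U hU
      (by rw [hfg.1 hxP]; exact hxU)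
    refine ⟨W, hW, hxW, fun h => hdim ((h.image inter_subset_left hg hfg.2.injOn).mono ?_)⟩
    rintro _ ⟨y, ⟨hyQ, hyW⟩, rfl⟩
    exact ⟨hgQP hyQ, hWU ⟨hyW, hyQ⟩⟩
  · obtain ⟨W, hW, hxW, hWV⟩ := continuousOn_iff.1 hf.1 x hxP V hV hfV
    refine ((hx W hW hxW).image inter_subset_left hf hfg.1.injOn).mono ?_
    rintro _ ⟨y, ⟨hyP, hyW⟩, rfl⟩
    exact ⟨hfPQ hyP, hWV ⟨hyW, hyP⟩⟩

/-- `ℤ`-homeomorphisms preserve the dimensional parts. -/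
theorem mapsTo_closure_localDimSet {m d : ℕ} {P : Set (E n)} {Q : Set (E m)} (hP : IsClosed P)
    {f : E n → E m} {g : E m → E n} (hfPQ : MapsTo f P Q) (hgQP : MapsTo g Q P)
    (hfg : InvOn g f P Q) (hf : IsIntegerPL P f) (hg : IsIntegerPL Q g) :
    MapsTo f (closure (localDimSet d P)) (closure (localDimSet d Q)) :=
  (mapsTo_localDimSet hP hfPQ hgQP hfg hf hg).closure_of_continuousOn
    (hf.1.mono (closure_minimal (localDimSet_subset hP) hP))

end DimPart

/-! ### Counting positive solutions of a linear inequality -/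

section Counting

/-- The positive integer solutions `c` of `∑ cᵢ aᵢ ≤ m`. -/
def posSol {ι : Type*} [Fintype ι] (a : ι → ℕ) (m : ℕ) : Set (ι → ℕ) :=
  {c | (∀ i, 0 < c i) ∧ ∑ i, c i * a i ≤ m}

theorem posSol_finite {ι : Type*} [Fintype ι] {a : ι → ℕ} (ha : ∀ i, 0 < a i) (m : ℕ) :
    (posSol a m).Finite := by
  refine (Set.Finite.pi' fun _ : ι => Set.finite_Iic m).subset fun c hc i => ?_
  calc c i ≤ c i * a i := Nat.le_mul_of_pos_right _ (ha i)
    _ ≤ ∑ i, c i * a i := Finset.single_le_sum (f := fun i => c i * a i)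
        (fun _ _ => Nat.zero_le _) (Finset.mem_univ i)
    _ ≤ m := hc.2

theorem ncard_posSol_succ {k : ℕ} {a : Fin (k + 1) → ℕ} (ha : ∀ i, 0 < a i) (m : ℕ) :
    (posSol a m).ncard =
      ∑ j ∈ Finset.Icc 1 (m / a 0), (posSol (fun i : Fin k => a i.succ) (m - j * a 0)).ncard := by
  have hU : posSol a m = ⋃ j ∈ (Finset.Icc 1 (m / a 0) : Set ℕ),
      (fun c : Fin k → ℕ => (Fin.cons j c : Fin (k + 1) → ℕ)) ''
        posSol (fun i : Fin k => a i.succ) (m - j * a 0) := by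
    ext c
    simp only [mem_iUnion, Finset.coe_Icc, mem_Icc, exists_prop, mem_image]
    constructor
    · rintro ⟨h1, h2⟩
      rw [Fin.sum_univ_succ] at h2
      refine ⟨c 0, ⟨h1 0, ?_⟩, fun i => c i.succ, ⟨fun i => h1 i.succ, ?_⟩, Fin.cons_self_tail c⟩
      · rw [Nat.le_div_iff_mul_le (ha 0)]
        omega
      · change ∑ i : Fin k, c i.succ * a i.succ ≤ m - c 0 * a 0
        omega
    · rintro ⟨j, ⟨hj1, hj2⟩, c', ⟨h1, h2⟩, rfl⟩
      rw [Nat.le_div_iff_mul_le (ha 0)] at hj2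
      refine ⟨Fin.cases hj1 h1, ?_⟩
      · rw [Fin.sum_univ_succ]
        change ∑ i : Fin k, c' i * a i.succ ≤ m - j * a 0 at h2
        simp only [Fin.cons_zero, Fin.cons_succ]
        omega
  rw [hU, Set.Finite.ncard_biUnion (Finset.finite_toSet _), finsum_mem_coe_finset]
  · refine Finset.sum_congr rfl fun j _ => ncard_image_of_injective _ fun c c' h => ?_
    exact (Fin.cons_injective2 h).2
  · exact fun j _ => (posSol_finite (fun i : Fin k => ha i.succ) _).image _
  · intro j _ j' _ hne
    rw [Function.onFun, Set.disjoint_left]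
    rintro _ ⟨c, -, rfl⟩ ⟨c', -, h⟩
    exact hne (Fin.cons_injective2 h).1.symm

theorem pow_succ_sub_pow_succ_le {x y : ℝ} (hy : 0 ≤ y) (hyx : y ≤ x) (k : ℕ) :
    x ^ (k + 1) - y ^ (k + 1) ≤ (k + 1) * (x - y) * x ^ k := by
  induction k with
  | zero => simp
  | succ k ih =>
    have hx : 0 ≤ x := hy.trans hyx
    have h1 : y ^ (k + 1) ≤ x ^ (k + 1) := pow_le_pow_left₀ hy hyx _
    have h2 := mul_le_mul_of_nonneg_left ih hx
    have h3 := mul_le_mul_of_nonneg_left h1 (sub_nonneg.2 hyx)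
    push_cast
    calc x ^ (k + 1 + 1) - y ^ (k + 1 + 1)
        = x * (x ^ (k + 1) - y ^ (k + 1)) + (x - y) * y ^ (k + 1) := by ring
      _ ≤ x * ((k + 1) * (x - y) * x ^ k) + (x - y) * x ^ (k + 1) := add_le_add h2 h3
      _ = _ := by ring

theorem le_pow_succ_sub_pow_succ {x y : ℝ} (hy : 0 ≤ y) (hyx : y ≤ x) (k : ℕ) :
    (k + 1) * (x - y) * y ^ k ≤ x ^ (k + 1) - y ^ (k + 1) := by
  induction k with
  | zero => simp
  | succ k ih =>
    have h1 : y ^ (k + 1) ≤ x ^ (k + 1) := pow_le_pow_left₀ hy hyx _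
    have h2 := mul_le_mul_of_nonneg_left ih hy
    have h3 := mul_le_mul_of_nonneg_left h1 (sub_nonneg.2 hyx)
    push_cast
    calc (k + 1 + 1) * (x - y) * y ^ (k + 1)
        = y * ((k + 1) * (x - y) * y ^ k) + (x - y) * y ^ (k + 1) := by ring
      _ ≤ y * (x ^ (k + 1) - y ^ (k + 1)) + (x - y) * x ^ (k + 1) := add_le_add h2 h3
      _ = _ := by ring

theorem max_pow_succ_sub_le {a : ℝ} (ha : 0 ≤ a) (x : ℝ) (k : ℕ) :
    (max x 0) ^ (k + 1) - (max (x - a) 0) ^ (k + 1) ≤ (k + 1) * a * (max x 0) ^ k := by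
  have h0 : max (x - a) 0 ≤ max x 0 := max_le_max (by linarith) le_rfl
  refine (pow_succ_sub_pow_succ_le (le_max_right _ _) h0 k).trans ?_
  refine mul_le_mul_of_nonneg_right (mul_le_mul_of_nonneg_left ?_ (by positivity)) (by positivity)
  rcases le_total x 0 with hx | hx
  · rw [max_eq_right hx]
    have := le_max_right (x - a) 0
    linarith
  · rw [max_eq_left hx]
    have := le_max_left (x - a) 0
    linarith

/-- Up to lower order terms, there are `mᵏ / (k! ∏ aᵢ)` positive solutions; the bounds are proved by
summation over the first unknown. -/
theorem ncard_posSol_bounds {k : ℕ} (a : Fin k → ℕ) (ha : ∀ i, 0 < a i) (m : ℕ) :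
    ((max ((m : ℝ) - ∑ i, (a i : ℝ)) 0) ^ k ≤
      ((k.factorial : ℝ) * ∏ i, (a i : ℝ)) * (posSol a m).ncard) ∧
    ((k.factorial : ℝ) * ∏ i, (a i : ℝ)) * (posSol a m).ncard ≤ (m : ℝ) ^ k := by
  induction k generalizing m with
  | zero =>
    have : posSol a m = {default} := by
      ext c
      simp [posSol, Subsingleton.elim c default]
    simp [this]
  | succ k ih =>
    have ih' := ih (fun i => a i.succ) (fun i => ha i.succ)
    have ha0 : (0 : ℝ) < a 0 := by exact_mod_cast ha 0
    set S : ℝ := ∑ i : Fin k, (a i.succ : ℝ) with hS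
    set J := m / a 0 with hJ
    have hsplit : (((k + 1).factorial : ℝ) * ∏ i, (a i : ℝ)) * (posSol a m).ncard =
        ∑ j ∈ Finset.range J, (k + 1) * a 0 * (((k.factorial : ℝ) * ∏ i : Fin k, (a i.succ : ℝ)) *
          (posSol (fun i : Fin k => a i.succ) (m - (j + 1) * a 0)).ncard) := by
      rw [ncard_posSol_succ ha, Fin.prod_univ_succ, Nat.factorial_succ, Nat.cast_sum,
        ← Finset.mul_sum, ← Finset.mul_sum, Finset.range_eq_Ico,
        Finset.sum_Ico_add' (fun j => ((posSol (fun i : Fin k => a i.succ)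
          (m - j * a 0)).ncard : ℝ)) 0 J 1, zero_add]
      have : Finset.Ico 1 (J + 1) = Finset.Icc 1 (m / a 0) := by ext; simp [hJ]
      rw [this]
      push_cast
      ring
    have hcast : ∀ j ∈ Finset.range J,
        ((m - (j + 1) * a 0 : ℕ) : ℝ) = (m : ℝ) - (j + 1) * a 0 := by
      intro j hj
      have : (j + 1) * a 0 ≤ m := by
        rw [← Nat.le_div_iff_mul_le (ha 0)]
        exact Finset.mem_range.1 hj
      rw [Nat.cast_sub this]
      push_cast
      ring
    rw [hsplit]
    constructor
    · have htel := Finset.sum_range_sub' (fun j : ℕ =>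
        (max ((m : ℝ) - (j + 1) * a 0 - S) 0) ^ (k + 1)) J
      have hJ0 : max ((m : ℝ) - (J + 1) * a 0 - S) 0 = 0 := by
        have h1 : (m : ℝ) < (J + 1) * a 0 := by
          exact_mod_cast Nat.lt_mul_of_div_lt (Nat.lt_succ_self _) (ha 0)
        have h2 : 0 ≤ S := Finset.sum_nonneg fun i _ => Nat.cast_nonneg _
        exact max_eq_right (by linarith)
      rw [hJ0, zero_pow (by omega), sub_zero] at htel
      have h0 : (m : ℝ) - ∑ i, (a i : ℝ) = (m : ℝ) - ((0 : ℕ) + 1) * a 0 - S := by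
        rw [Fin.sum_univ_succ, hS]
        push_cast
        ring
      rw [h0, ← htel]
      refine Finset.sum_le_sum fun j hj => ?_
      have h1 := (ih' (m - (j + 1) * a 0)).1
      rw [hcast j hj] at h1
      have h2 := max_pow_succ_sub_le ha0.le ((m : ℝ) - (j + 1) * a 0 - S) k
      have h3 : (m : ℝ) - ((j + 1 : ℕ) + 1) * a 0 - S = (m : ℝ) - (j + 1) * a 0 - S - a 0 := by
        push_cast
        ring
      rw [h3]
      exact h2.trans (mul_le_mul_of_nonneg_left h1 (by positivity))
    · have htel := Finset.sum_range_sub' (fun j : ℕ => ((m : ℝ) - j * a 0) ^ (k + 1)) J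
      have hJ0 : 0 ≤ (m : ℝ) - J * a 0 := by
        have : J * a 0 ≤ m := Nat.div_mul_le_self m (a 0)
        rw [sub_nonneg]
        exact_mod_cast this
      calc _ ≤ ∑ j ∈ Finset.range J, (((m : ℝ) - j * a 0) ^ (k + 1) -
            ((m : ℝ) - (j + 1 : ℕ) * a 0) ^ (k + 1)) := by
            refine Finset.sum_le_sum fun j hj => ?_
            have h1 := (ih' (m - (j + 1) * a 0)).2
            have h4 := hcast j hj
            rw [h4] at h1
            have h5 : (0 : ℝ) ≤ (m : ℝ) - (j + 1) * a 0 := h4 ▸ Nat.cast_nonneg _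
            have h2 := le_pow_succ_sub_pow_succ h5
              (show (m : ℝ) - (j + 1) * a 0 ≤ (m : ℝ) - j * a 0 by linarith) k
            have h3 : (m : ℝ) - j * a 0 - ((m : ℝ) - (j + 1) * a 0) = a 0 := by ring
            rw [h3] at h2
            push_cast
            exact (mul_le_mul_of_nonneg_left h1 (by positivity)).trans h2
        _ = (m : ℝ) ^ (k + 1) - ((m : ℝ) - J * a 0) ^ (k + 1) := by
            rw [htel]
            simp
        _ ≤ (m : ℝ) ^ (k + 1) := by
            have := pow_nonneg hJ0 (k + 1)
            linarith

theorem ncard_posSol_comp_equiv {ι κ : Type*} [Fintype ι] [Fintype κ] (e : κ ≃ ι) (a : ι → ℕ)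
    (m : ℕ) : (posSol (a ∘ e) m).ncard = (posSol a m).ncard := by
  refine ncard_congr (fun c _ => c ∘ e.symm) ?_ ?_ ?_
  · rintro c ⟨h1, h2⟩
    refine ⟨fun i => h1 _, ?_⟩
    rw [← e.sum_comp]
    simpa using h2
  · intro c c' _ _ h
    ext i
    simpa using congrFun h (e i)
  · rintro c ⟨h1, h2⟩
    refine ⟨c ∘ e, ⟨fun i => h1 _, ?_⟩, by ext; simp⟩
    rw [← e.sum_comp] at h2
    exact h2

theorem tendsto_ncard_posSol {ι : Type*} [Fintype ι] {a : ι → ℕ} (ha : ∀ i, 0 < a i) :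
    Filter.Tendsto (fun m : ℕ => ((posSol a m).ncard : ℝ) / (m : ℝ) ^ Fintype.card ι) Filter.atTop
      (nhds (1 / (((Fintype.card ι).factorial : ℝ) * ∏ i, (a i : ℝ)))) := by
  set k := Fintype.card ι with hk
  set e := (Fintype.equivFin ι).symm
  set D : ℝ := (k.factorial : ℝ) * ∏ i, (a i : ℝ) with hD
  have hDe : D = (k.factorial : ℝ) * ∏ i : Fin k, ((a ∘ e) i : ℝ) := by
    rw [hD]
    congr 1
    exact (e.prod_comp fun i => (a i : ℝ)).symm
  have hDpos : 0 < D := by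
    have : 0 < ∏ i, (a i : ℝ) := Finset.prod_pos fun i _ => by exact_mod_cast ha i
    positivity
  set S : ℝ := ∑ i : Fin k, ((a ∘ e) i : ℝ) with hS
  have hb : ∀ m : ℕ, (max ((m : ℝ) - S) 0) ^ k ≤ D * (posSol a m).ncard ∧
      D * (posSol a m).ncard ≤ (m : ℝ) ^ k := by
    intro m
    rw [← ncard_posSol_comp_equiv e, hDe]
    exact ncard_posSol_bounds (a ∘ e) (fun i => ha _) m
  have hlow : Filter.Tendsto (fun m : ℕ => (max (1 - S / (m : ℝ)) 0) ^ k / D) Filter.atTop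
      (nhds (1 / D)) := by
    have h1 : Filter.Tendsto (fun m : ℕ => S / (m : ℝ)) Filter.atTop (nhds 0) :=
      tendsto_const_div_atTop_nhds_zero_nat S
    have h2 := (((h1.const_sub 1).max (tendsto_const_nhds (x := (0 : ℝ)))).pow k).div_const D
    simpa using h2
  refine tendsto_of_tendsto_of_tendsto_of_le_of_le' hlow tendsto_const_nhds ?_ ?_
  · filter_upwards [Filter.eventually_gt_atTop 0] with m hm
    have hm' : (0 : ℝ) < m := by exact_mod_cast hm
    rw [div_le_div_iff₀ hDpos (by positivity), ← mul_pow, max_mul_of_nonneg _ _ hm'.le, zero_mul,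
      sub_mul, one_mul, div_mul_cancel₀ _ hm'.ne', mul_comm _ D]
    exact (hb m).1
  · filter_upwards [Filter.eventually_gt_atTop 0] with m hm
    have hm' : (0 : ℝ) < m := by exact_mod_cast hm
    rw [div_le_div_iff₀ (by positivity) hDpos, one_mul, mul_comm _ D]
    exact (hb m).2

end Counting

/-! ### Counting rational points of bounded denominator -/

section LatticeCount

variable {n : ℕ}

/-- The integer vectors of height at most `m` in the cone over `P`: the pairs `(x, q)` of a point
`x ∈ P` and a number `1 ≤ q ≤ m` such that `q x` is integral, encoded as `(q x, q)`. -/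
def conePoints (m : ℕ) (P : Set (E n)) : Set (Fin (n + 1) → ℤ) :=
  {y | 0 < y (Fin.last n) ∧ y (Fin.last n) ≤ m ∧ pt y ∈ P}

theorem conePoints_finite (m : ℕ) {P : Set (E n)} (hP : Bornology.IsBounded P) :
    (conePoints m P).Finite := by
  obtain ⟨R, hR⟩ := hP.exists_norm_le
  obtain ⟨r, hr⟩ := exists_nat_ge R
  refine (Set.Finite.pi' fun _ : Fin (n + 1) =>
    Set.finite_Icc (-((m : ℤ) * (r + 1))) (m * (r + 1))).subset fun y hy i => ?_
  obtain ⟨h0, hm, hy⟩ := hy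
  rw [mem_Icc, ← abs_le]
  refine Fin.lastCases ?_ (fun i => ?_) i
  · rw [abs_of_pos h0]
    nlinarith
  · have h1 := congrFun (castVec_eq_smul_lift_pt h0.ne') i.castSucc
    simp only [castVec_apply, Pi.smul_apply, lift_castSucc, smul_eq_mul] at h1
    have h2 : |(pt y : E n) i| ≤ r :=
      (by simpa using PiLp.norm_apply_le (pt y : E n) i : |(pt y : E n) i| ≤ ‖(pt y : E n)‖).trans
        ((hR _ hy).trans hr)
    have h0' : (0 : ℝ) < y (Fin.last n) := by exact_mod_cast h0
    have hm' : (y (Fin.last n) : ℝ) ≤ m := by exact_mod_cast hm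
    have h3 : |(y i.castSucc : ℝ)| ≤ m * (r + 1) := by
      rw [h1, abs_mul, abs_of_pos h0']
      have : (0 : ℝ) ≤ r := Nat.cast_nonneg r
      exact mul_le_mul hm' (by linarith) (abs_nonneg _) (by linarith)
    exact_mod_cast h3

theorem ncard_conePoints_union_add_inter (m : ℕ) {P Q : Set (E n)} (hP : Bornology.IsBounded P)
    (hQ : Bornology.IsBounded Q) : (conePoints m (P ∪ Q)).ncard + (conePoints m (P ∩ Q)).ncard =
      (conePoints m P).ncard + (conePoints m Q).ncard := by
  have h1 : conePoints m (P ∪ Q) = conePoints m P ∪ conePoints m Q := by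
    ext y; simp only [conePoints, mem_union, mem_ofPred_eq]; tauto
  have h2 : conePoints m (P ∩ Q) = conePoints m P ∩ conePoints m Q := by
    ext y; simp only [conePoints, mem_inter_iff, mem_ofPred_eq]; tauto
  rw [h1, h2, ncard_union_add_ncard_inter _ _ (conePoints_finite m hP) (conePoints_finite m hQ)]

/-- The lattice points in the open cone over a regular simplex are the positive integer
combinations of the homogeneous correspondents of its vertices. -/
theorem ncard_conePoints_relInt {s : Finset (E n)} (hne : s.Nonempty)
    (hs : IsRegularSimplex (fun v : s => (v : E n))) (m : ℕ) :
    (conePoints m (relInt s)).ncard = (posSol (fun v : s => den (v : E n)) m).ncard := by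
  obtain ⟨⟨hind, hrat⟩, b, f, hb⟩ := hs
  have hden : ∀ v : s, 0 < den (v : E n) := fun v => den_pos (hrat v)
  have hcast : ∀ r : s → ℝ, ∑ v : s, r v • castVec (homog (v : E n)) =
      ∑ v : s, (r v * den (v : E n)) • lift (v : E n) := fun r =>
    Finset.sum_congr rfl fun v _ => by rw [castVec_homog (hrat v), smul_smul]
  have hlast : ∀ c : s → ℕ, (∑ v : s, (c v : ℤ) • homog (v : E n)) (Fin.last n) =
      ((∑ v : s, c v * den (v : E n) : ℕ) : ℤ) := fun c => by
    simp [Finset.sum_apply, homog_last]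
  symm
  refine ncard_congr (fun c _ => ∑ v : s, (c v : ℤ) • homog (v : E n)) ?_ ?_ ?_
  · rintro c ⟨h1, h2⟩
    have hpos : 0 < ∑ v : s, c v * den (v : E n) :=
      Finset.sum_pos (fun v _ => Nat.mul_pos (h1 v) (hden v)) (by
        obtain ⟨x, hx⟩ := hne
        exact ⟨⟨x, hx⟩, Finset.mem_univ _⟩)
    set q := ∑ v : s, c v * den (v : E n) with hq
    have hq0 : (0 : ℝ) < q := by exact_mod_cast hpos
    refine ⟨by rw [hlast]; exact_mod_cast hpos, by rw [hlast]; exact_mod_cast h2, ?_⟩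
    refine ⟨fun x => if hx : x ∈ s then c ⟨x, hx⟩ * den x / (q : ℝ) else 0, fun x hx => ?_, ?_, ?_⟩
    · simp only [dif_pos hx]
      have h3 : (0 : ℝ) < c ⟨x, hx⟩ := by exact_mod_cast h1 _
      have h4 : (0 : ℝ) < den x := by exact_mod_cast hden ⟨x, hx⟩
      positivity
    · rw [← Finset.sum_coe_sort s]
      simp only [Finset.coe_mem, dif_pos, Subtype.coe_eta]
      rw [← Finset.sum_div, div_eq_one_iff_eq hq0.ne', hq]
      push_cast
      rfl
    · rw [eq_pt_iff (by rw [hlast]; exact_mod_cast hpos.ne'), hlast, castVec_sum]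
      simp only [castVec_smul, Int.cast_natCast]
      rw [hcast, lift_affineCombination _ _ (fun x => x), Finset.smul_sum, ← Finset.sum_coe_sort s]
      · refine Finset.sum_congr rfl fun v _ => ?_
        simp only [Finset.coe_mem, dif_pos, Subtype.coe_eta, smul_smul]
        congr 1
        rw [mul_div_cancel₀ _ hq0.ne']
      · rw [← Finset.sum_coe_sort s]
        simp only [Finset.coe_mem, dif_pos, Subtype.coe_eta]
        rw [← Finset.sum_div, div_eq_one_iff_eq hq0.ne', hq]
        push_cast
        rfl
  · intro c c' _ _ h
    ext v
    have h1 := congrArg (fun y => functional (coordVec b (f v)) (castVec y)) h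
    simp only [castVec_sum, castVec_smul, Int.cast_natCast, hb] at h1
    rw [functional_coordVec_sum b f Finset.univ (fun v => (c v : ℝ)) v (Finset.mem_univ _),
      functional_coordVec_sum b f Finset.univ (fun v => (c' v : ℝ)) v (Finset.mem_univ _)] at h1
    exact_mod_cast h1
  · rintro y ⟨h0, hm, w, hw, h1, hwy⟩
    have h0' : (0 : ℝ) < y (Fin.last n) := by exact_mod_cast h0
    have hdR : ∀ v : s, (0 : ℝ) < den (v : E n) := fun v => by exact_mod_cast hden v
    -- the real coordinates of `y` are integers, as the generators are part of a basis of `ℤⁿ⁺¹`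
    have hy : castVec y = ∑ v : s, (y (Fin.last n) * w v / den (v : E n)) •
        castVec (homog (v : E n)) := by
      rw [hcast, castVec_eq_smul_lift_pt h0.ne', ← hwy,
        lift_affineCombination _ _ (fun x => x) h1, Finset.smul_sum, ← Finset.sum_coe_sort s]
      refine Finset.sum_congr rfl fun v _ => ?_
      rw [smul_smul, div_mul_cancel₀ _ (hdR v).ne']
    have hcoord : ∀ v : s, ((b.coord (f v) y : ℤ) : ℝ) = y (Fin.last n) * w v / den (v : E n) := by
      intro v
      rw [← functional_coordVec, hy]
      simp only [hb]
      exact functional_coordVec_sum b f Finset.univ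
        (fun v => (y (Fin.last n) * w v / den (v : E n) : ℝ)) v (Finset.mem_univ _)
    have hcpos : ∀ v : s, 0 < b.coord (f v) y := fun v => by
      have : (0 : ℝ) < (b.coord (f v) y : ℤ) := by
        rw [hcoord]
        exact div_pos (mul_pos h0' (hw v v.2)) (hdR v)
      exact_mod_cast this
    have hnat : ∀ v : s, (((b.coord (f v) y).toNat : ℕ) : ℤ) = b.coord (f v) y :=
      fun v => Int.toNat_of_nonneg (hcpos v).le
    have hsum : ∑ v : s, (((b.coord (f v) y).toNat : ℕ) : ℤ) • homog (v : E n) = y := by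
      apply castVec_injective
      rw [hy, castVec_sum]
      refine Finset.sum_congr rfl fun v _ => ?_
      rw [castVec_smul, hnat, hcoord]
    refine ⟨fun v => (b.coord (f v) y).toNat, ⟨fun v => ?_, ?_⟩, hsum⟩
    · exact Int.pos_iff_toNat_pos.1 (hcpos v)
    · have h3 := hlast (fun v => (b.coord (f v) y).toNat)
      rw [hsum] at h3
      rw [h3] at hm
      exact_mod_cast hm

theorem tendsto_ncard_conePoints_relInt {s : Finset (E n)} (hne : s.Nonempty)
    (hs : IsRegularSimplex (fun v : s => (v : E n))) :
    Filter.Tendsto (fun m : ℕ => ((conePoints m (relInt s)).ncard : ℝ) / (m : ℝ) ^ s.card)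
      Filter.atTop (nhds (1 / ((s.card.factorial : ℝ) * ((∏ v ∈ s, den v : ℕ) : ℝ)))) := by
  have h := tendsto_ncard_posSol (a := fun v : s => den (v : E n)) fun v => den_pos (hs.1.2 v)
  simp only [← ncard_conePoints_relInt hne hs, Fintype.card_coe] at h
  have h2 : ∏ v : s, (den (v : E n) : ℝ) = ((∏ v ∈ s, den v : ℕ) : ℝ) := by
    rw [Nat.cast_prod, ← Finset.prod_coe_sort s]
  rwa [h2] at h

theorem tendsto_ncard_conePoints_relInt_zero {s : Finset (E n)} (hne : s.Nonempty)
    (hs : IsRegularSimplex (fun v : s => (v : E n))) {k : ℕ} (hk : s.card < k) :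
    Filter.Tendsto (fun m : ℕ => ((conePoints m (relInt s)).ncard : ℝ) / (m : ℝ) ^ k)
      Filter.atTop (nhds 0) := by
  have h1 : Filter.Tendsto (fun m : ℕ => ((m : ℝ) ^ (k - s.card))⁻¹) Filter.atTop (nhds 0) :=
    ((Filter.tendsto_pow_atTop (by omega)).comp tendsto_natCast_atTop_atTop).inv_tendsto_atTop
  have h2 := (tendsto_ncard_conePoints_relInt hne hs).mul h1
  rw [mul_zero] at h2
  refine h2.congr fun m => ?_
  rw [← div_eq_mul_inv, div_div, ← pow_add, Nat.add_sub_cancel' hk.le]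

/-- A complex is the disjoint union of the relative interiors of its faces. -/
theorem ncard_conePoints_space {K : SimplicialComplex ℝ (E n)} (hK : K.faces.Finite) (m : ℕ) :
    (conePoints m K.space).ncard = ∑ s ∈ hK.toFinset, (conePoints m (relInt s)).ncard := by
  have hU : conePoints m K.space = ⋃ s ∈ K.faces, conePoints m (relInt s) := by
    ext y
    simp only [mem_iUnion, exists_prop]
    constructor
    · rintro ⟨h0, hm, hy⟩
      obtain ⟨s, hs, hy⟩ := SimplicialComplex.mem_space_iff.1 hy
      obtain ⟨t, ht, hyt⟩ := exists_mem_relInt hy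
      exact ⟨t, K.down_closed hs ht (nonempty_of_mem_relInt hyt), h0, hm, hyt⟩
    · rintro ⟨s, hs, h0, hm, hy⟩
      exact ⟨h0, hm, SimplicialComplex.mem_space_iff.2 ⟨s, hs, relInt_subset_convexHull s hy⟩⟩
  rw [hU, hK.ncard_biUnion, finsum_mem_eq_finite_toFinset_sum _ hK]
  · exact fun s _ => conePoints_finite m
      ((isBounded_convexHull_finset s).subset (relInt_subset_convexHull s))
  · intro s hs t ht hne
    rw [Function.onFun, Set.disjoint_left]
    rintro y ⟨-, -, hys⟩ ⟨-, -, hyt⟩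
    exact hne (subset_antisymm
      (subset_of_mem_relInt hs ht hys (relInt_subset_convexHull t hyt))
      (subset_of_mem_relInt ht hs hyt (relInt_subset_convexHull s hys)))

theorem mem_maxSimplexes_iff_of_card_le {K : SimplicialComplex ℝ (E n)} {d : ℕ}
    (hd : ∀ s ∈ K.faces, s.card ≤ d + 1) {s : Finset (E n)} :
    s ∈ maxSimplexes K d ↔ s ∈ K.faces ∧ s.card = d + 1 := by
  constructor
  · rintro ⟨h1, h2⟩
    exact ⟨h1.1, h2⟩
  · rintro ⟨h1, h2⟩
    exact ⟨⟨h1, fun t ht hst => Finset.eq_of_subset_of_card_le hst (h2 ▸ hd t ht)⟩, h2⟩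

theorem lambdaOf_eq_sum {K : SimplicialComplex ℝ (E n)} (hK : K.faces.Finite) {d : ℕ}
    (hd : ∀ s ∈ K.faces, s.card ≤ d + 1) : lambdaOf d K =
      ∑ s ∈ hK.toFinset with s.card = d + 1,
        1 / ((d.factorial : ℝ) * ((∏ v ∈ s, den v : ℕ) : ℝ)) := by
  have : maxSimplexes K d = ((hK.toFinset.filter fun s => s.card = d + 1 : Finset _) : Set _) := by
    ext s
    rw [mem_maxSimplexes_iff_of_card_le hd]
    simp
  rw [lambdaOf, this, finsum_mem_coe_finset]

/-- The number of lattice points in the cone over a `d`-dimensional complex determines its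
`d`-dimensional rational measure. -/
theorem tendsto_ncard_conePoints_space {K : SimplicialComplex ℝ (E n)} {P : Set (E n)}
    (hK : IsRegularTriangulation K P) {d : ℕ} (hd : ∀ s ∈ K.faces, s.card ≤ d + 1) :
    Filter.Tendsto (fun m : ℕ => ((conePoints m P).ncard : ℝ) / (m : ℝ) ^ (d + 1))
      Filter.atTop (nhds (lambdaOf d K / (d + 1))) := by
  have hfin := hK.1.1
  rw [← hK.1.2]
  simp only [ncard_conePoints_space hfin, Nat.cast_sum, Finset.sum_div]
  rw [lambdaOf_eq_sum hfin hd, Finset.sum_div, Finset.sum_filter]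
  refine tendsto_finsetSum _ fun s hs => ?_
  have hsf : s ∈ K.faces := hfin.mem_toFinset.1 hs
  have hne := K.nonempty_of_mem_faces hsf
  split_ifs with h
  · have h1 := tendsto_ncard_conePoints_relInt hne (hK.2 s hsf)
    rw [h] at h1
    convert h1 using 2
    rw [Nat.factorial_succ, div_div]
    push_cast
    ring
  · exact tendsto_ncard_conePoints_relInt_zero hne (hK.2 s hsf)
      (lt_of_le_of_ne (hd s hsf) h)

/-- The subcomplex of all faces of the maximal `d`-simplexes of `K`. -/
def maxSubcomplex (K : SimplicialComplex ℝ (E n)) (d : ℕ) : SimplicialComplex ℝ (E n) where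
  faces := {s | s.Nonempty ∧ ∃ t ∈ maxSimplexes K d, s ⊆ t}
  isRelLowerSet_faces := by
    rintro s ⟨hne, t, ht, hst⟩
    exact ⟨hne, fun u hu hune => ⟨hune, t, ht, (show u ⊆ s from hu).trans hst⟩⟩
  indep := by
    rintro s ⟨hne, t, ht, hst⟩
    exact K.indep (K.down_closed ht.1.1 hst hne)
  inter_subset_convexHull := by
    rintro s s' ⟨hne, t, ht, hst⟩ ⟨hne', t', ht', hst'⟩
    exact K.inter_subset_convexHull (K.down_closed ht.1.1 hst hne)
      (K.down_closed ht'.1.1 hst' hne')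

theorem maxSubcomplex_faces_subset (K : SimplicialComplex ℝ (E n)) (d : ℕ) :
    (maxSubcomplex K d).faces ⊆ K.faces := by
  rintro s ⟨hne, t, ht, hst⟩
  exact K.down_closed ht.1.1 hst hne

theorem card_le_of_mem_maxSubcomplex {K : SimplicialComplex ℝ (E n)} {d : ℕ} {s : Finset (E n)}
    (hs : s ∈ (maxSubcomplex K d).faces) : s.card ≤ d + 1 := by
  obtain ⟨-, t, ht, hst⟩ := hs
  exact ht.2 ▸ Finset.card_le_card hst

theorem maxSimplexes_maxSubcomplex (K : SimplicialComplex ℝ (E n)) (d : ℕ) :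
    maxSimplexes (maxSubcomplex K d) d = maxSimplexes K d := by
  ext s
  rw [mem_maxSimplexes_iff_of_card_le fun _ => card_le_of_mem_maxSubcomplex]
  constructor
  · rintro ⟨⟨-, t, ht, hst⟩, hcard⟩
    rwa [Finset.eq_of_subset_of_card_le hst (by rw [ht.2, hcard])]
  · exact fun hs => ⟨⟨K.nonempty_of_mem_faces hs.1.1, s, hs, subset_rfl⟩, hs.2⟩

theorem lambdaOf_maxSubcomplex (K : SimplicialComplex ℝ (E n)) (d : ℕ) :
    lambdaOf d (maxSubcomplex K d) = lambdaOf d K := by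
  rw [lambdaOf, lambdaOf, maxSimplexes_maxSubcomplex]

theorem space_maxSubcomplex (K : SimplicialComplex ℝ (E n)) (d : ℕ) :
    (maxSubcomplex K d).space = maxSimplexUnion K d := by
  refine subset_antisymm (iUnion₂_subset ?_) (iUnion₂_subset fun s hs => ?_)
  · rintro s ⟨-, t, ht, hst⟩
    exact (convexHull_mono (Finset.coe_subset.2 hst)).trans (subset_biUnion_of_mem (u := fun
      s : Finset (E n) => convexHull ℝ (s : Set (E n))) ht)
  · exact SimplicialComplex.convexHull_subset_space (K := maxSubcomplex K d)
      ⟨K.nonempty_of_mem_faces hs.1.1, s, hs, subset_rfl⟩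

theorem IsRegularTriangulation.maxSubcomplex {K : SimplicialComplex ℝ (E n)} {P : Set (E n)}
    (hK : IsRegularTriangulation K P) (d : ℕ) :
    IsRegularTriangulation (maxSubcomplex K d) (dimPart d P) :=
  ⟨⟨hK.1.1.subset (maxSubcomplex_faces_subset K d), by
    rw [space_maxSubcomplex, hK.1.dimPart_eq]⟩,
    fun s hs => hK.2 s (maxSubcomplex_faces_subset K d hs)⟩

theorem tendsto_ncard_conePoints_dimPart {K : SimplicialComplex ℝ (E n)} {P : Set (E n)}
    (hK : IsRegularTriangulation K P) (d : ℕ) :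
    Filter.Tendsto (fun m : ℕ => ((conePoints m (dimPart d P)).ncard : ℝ) / (m : ℝ) ^ (d + 1))
      Filter.atTop (nhds (lambdaOf d K / (d + 1))) := by
  have h := tendsto_ncard_conePoints_space (hK.maxSubcomplex d)
    fun _ => card_le_of_mem_maxSubcomplex
  rwa [lambdaOf_maxSubcomplex] at h

/-- The rational measure does not depend on the regular triangulation. -/
theorem IsRegularTriangulation.lam_eq {K : SimplicialComplex ℝ (E n)} {P : Set (E n)}
    (hK : IsRegularTriangulation K P) (d : ℕ) : lam d P = lambdaOf d K := by
  have h : ∃ K : SimplicialComplex ℝ (E n), IsRegularTriangulation K P := ⟨K, hK⟩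
  rw [lam, dif_pos h]
  have h1 := tendsto_nhds_unique (tendsto_ncard_conePoints_dimPart h.choose_spec d)
    (tendsto_ncard_conePoints_dimPart hK d)
  have h2 : (d + 1 : ℝ) ≠ 0 := by positivity
  field_simp at h1
  exact h1

theorem lambdaOf_nonneg (d : ℕ) (K : SimplicialComplex ℝ (E n)) : 0 ≤ lambdaOf d K :=
  finsum_nonneg fun s => finsum_nonneg fun _ => by positivity

theorem IsRationalPolyhedron.tendsto_dimPart {P : Set (E n)} (hP : IsRationalPolyhedron P)
    (d : ℕ) :
    Filter.Tendsto (fun m : ℕ => ((conePoints m (dimPart d P)).ncard : ℝ) / (m : ℝ) ^ (d + 1))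
      Filter.atTop (nhds (lam d P / (d + 1))) := by
  obtain ⟨K, hK⟩ := hP.exists_isRegularTriangulation
  rw [hK.lam_eq d]
  exact tendsto_ncard_conePoints_dimPart hK d

theorem IsRationalPolyhedron.tendsto_of_dimLE {P : Set (E n)} (hP : IsRationalPolyhedron P)
    {d : ℕ} (hd : DimLE P d) :
    Filter.Tendsto (fun m : ℕ => ((conePoints m P).ncard : ℝ) / (m : ℝ) ^ (d + 1))
      Filter.atTop (nhds (lam d P / (d + 1))) := by
  obtain ⟨K, hK⟩ := hP.exists_isRegularTriangulation
  rw [hK.lam_eq d]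
  exact tendsto_ncard_conePoints_space hK fun s hs =>
    hd s (K.indep hs) (hK.1.2 ▸ K.convexHull_subset_space hs)

end LatticeCount

/-! ### Invariance under `ℤ`-homeomorphisms -/

section Invariance

variable {n k : ℕ}

/-- The homogeneous version of the map `f`. (The floors are exact if `f` is piecewise linear with
integer coefficients.) -/
noncomputable def homogMap (f : E n → E k) (y : Fin (n + 1) → ℤ) : Fin (k + 1) → ℤ :=
  Fin.snoc (α := fun _ => ℤ) (fun i => ⌊(y (Fin.last n) : ℝ) * f (pt y) i⌋) (y (Fin.last n))

theorem homogMap_last (f : E n → E k) (y : Fin (n + 1) → ℤ) :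
    homogMap f y (Fin.last k) = y (Fin.last n) := by simp [homogMap]

theorem castVec_homogMap {P : Set (E n)} {f : E n → E k} (hf : IsIntegerPL P f) {m : ℕ}
    {y : Fin (n + 1) → ℤ} (hy : y ∈ conePoints m P) :
    castVec (homogMap f y) = (y (Fin.last n) : ℝ) • lift (f (pt y)) := by
  obtain ⟨h0, -, hyP⟩ := hy
  have h0' : (y (Fin.last n) : ℝ) ≠ 0 := by exact_mod_cast h0.ne'
  ext i
  refine Fin.lastCases ?_ (fun i => ?_) i
  · simp [homogMap_last]
  · obtain ⟨F, -, hF⟩ := hf.2 i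
    obtain ⟨l, -, hl⟩ := hF _ hyP
    have h1 : (y (Fin.last n) : ℝ) * f (pt y) i =
        ((∑ j, l.1 j * y j.castSucc + l.2 * y (Fin.last n) : ℤ) : ℝ) := by
      rw [hl, mul_add, Finset.mul_sum]
      push_cast
      congr 1
      · refine Finset.sum_congr rfl fun j _ => ?_
        simp only [pt]
        field_simp
      · ring
    simp only [castVec_apply, homogMap, Fin.snoc_castSucc, Pi.smul_apply, lift_castSucc,
      smul_eq_mul]
    rw [h1, Int.floor_intCast]

theorem pt_homogMap {P : Set (E n)} {f : E n → E k} (hf : IsIntegerPL P f) {m : ℕ}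
    {y : Fin (n + 1) → ℤ} (hy : y ∈ conePoints m P) : pt (homogMap f y) = f (pt y) := by
  symm
  rw [eq_pt_iff (by rw [homogMap_last]; exact hy.1.ne'), castVec_homogMap hf hy, homogMap_last]

theorem IsIntegerPL.mono {P Q : Set (E n)} {f : E n → E k} (hf : IsIntegerPL Q f) (h : P ⊆ Q) :
    IsIntegerPL P f :=
  ⟨hf.1.mono h, fun i => let ⟨F, hF, hl⟩ := hf.2 i; ⟨F, hF, fun x hx => hl x (h hx)⟩⟩

/-- An injective piecewise linear map with integer coefficients acts on homogeneous coordinates, and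
it does not change the height. -/
theorem ncard_conePoints_le {P : Set (E n)} {Q : Set (E k)} (hQ : Bornology.IsBounded Q)
    {f : E n → E k} (hf : IsIntegerPL P f) (hfPQ : MapsTo f P Q) (hinj : InjOn f P) (m : ℕ) :
    (conePoints m P).ncard ≤ (conePoints m Q).ncard := by
  refine ncard_le_ncard_of_injOn (homogMap f) (fun y hy => ?_) (fun y hy y' hy' h => ?_)
    (conePoints_finite m hQ)
  · exact ⟨by rw [homogMap_last]; exact hy.1, by rw [homogMap_last]; exact hy.2.1,
      by rw [pt_homogMap hf hy]; exact hfPQ hy.2.2⟩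
  · have h1 := congrArg pt h
    rw [pt_homogMap hf hy, pt_homogMap hf hy'] at h1
    have h2 := hinj hy.2.2 hy'.2.2 h1
    have h3 := congrFun h (Fin.last k)
    rw [homogMap_last, homogMap_last] at h3
    apply castVec_injective
    rw [castVec_eq_smul_lift_pt hy.1.ne', castVec_eq_smul_lift_pt hy'.1.ne', h2, h3]

theorem IsRationalPolyhedron.dimPart_eq_closure {P : Set (E n)} (hP : IsRationalPolyhedron P)
    (d : ℕ) : dimPart d P = closure (localDimSet d P) := by
  obtain ⟨K, hK⟩ := hP.exists_isRegularTriangulation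
  rw [hK.1.dimPart_eq, hK.1.maxSimplexUnion_eq]

theorem IsRationalPolyhedron.dimPart_subset {P : Set (E n)} (hP : IsRationalPolyhedron P)
    (d : ℕ) : dimPart d P ⊆ P := by
  rw [hP.dimPart_eq_closure]
  exact closure_minimal (localDimSet_subset hP.isCompact.isClosed) hP.isCompact.isClosed

/-- `ℤ`-homeomorphisms preserve the rational measures, as they preserve the dimensional parts and
the denominators of rational points. -/
theorem IsZHomeomorphic.lam_eq {P : Set (E n)} {Q : Set (E k)} (h : IsZHomeomorphic P Q)
    (hP : IsRationalPolyhedron P) (hQ : IsRationalPolyhedron Q) (d : ℕ) : lam d P = lam d Q := by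
  obtain ⟨f, g, hf, hg, hfg, hfi, hgi⟩ := h
  have h1 : MapsTo f (dimPart d P) (dimPart d Q) := by
    rw [hP.dimPart_eq_closure, hQ.dimPart_eq_closure]
    exact mapsTo_closure_localDimSet hP.isCompact.isClosed hf hg hfg hfi hgi
  have h2 : MapsTo g (dimPart d Q) (dimPart d P) := by
    rw [hP.dimPart_eq_closure, hQ.dimPart_eq_closure]
    exact mapsTo_closure_localDimSet hQ.isCompact.isClosed hg hf hfg.symm hgi hfi
  have hcard : ∀ m, (conePoints m (dimPart d P)).ncard = (conePoints m (dimPart d Q)).ncard :=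
    fun m => le_antisymm
      (ncard_conePoints_le (hQ.isCompact.isBounded.subset (hQ.dimPart_subset d))
        (hfi.mono (hP.dimPart_subset d)) h1 (hfg.1.injOn.mono (hP.dimPart_subset d)) m)
      (ncard_conePoints_le (hP.isCompact.isBounded.subset (hP.dimPart_subset d))
        (hgi.mono (hQ.dimPart_subset d)) h2 (hfg.2.injOn.mono (hQ.dimPart_subset d)) m)
  have h3 := hP.tendsto_dimPart d
  simp only [hcard] at h3
  have h4 := tendsto_nhds_unique h3 (hQ.tendsto_dimPart d)
  have h5 : (d + 1 : ℝ) ≠ 0 := by positivity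
  field_simp at h4
  exact h4

theorem isIntegerPL_of_forall {f : E n → E k} (l : Fin k → (Fin n → ℤ) × ℤ)
    (hf : ∀ x i, f x i = ∑ j, ((l i).1 j : ℝ) * x j + ((l i).2 : ℝ)) (P : Set (E n)) :
    IsIntegerPL P f := by
  have : f = integerAffineMap l := by
    ext x i
    rw [hf, integerAffineMap_apply]
  refine ⟨?_, fun i => ⟨{l i}, finite_singleton _, fun x _ => ⟨l i, rfl, hf x i⟩⟩⟩
  rw [this]
  exact (AffineMap.continuous_of_finiteDimensional _).continuousOn

theorem isZHomeomorphic_of_mem_affineGroup {γ : E n → E n} (hγ : γ ∈ affineGroup n)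
    (Q : Set (E n)) : IsZHomeomorphic (γ '' Q) Q := by
  obtain ⟨A, t, hA, hγ⟩ := hγ
  have hdet : IsUnit A.det := Int.isUnit_iff.2 hA
  set B := A⁻¹ with hB
  have hAB : A * B = 1 := Matrix.mul_nonsing_inv A hdet
  have hBA : B * A = 1 := Matrix.nonsing_inv_mul A hdet
  let l : Fin n → (Fin n → ℤ) × ℤ := fun i => (B i, -∑ j, B i j * t j)
  have key : ∀ (C D : Matrix (Fin n) (Fin n) ℤ), C * D = 1 → ∀ (x : E n) (i : Fin n),
      ∑ j, (C i j : ℝ) * ∑ m, (D j m : ℝ) * x m = x i := by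
    intro C D h x i
    simp only [Finset.mul_sum, ← mul_assoc]
    rw [Finset.sum_comm]
    simp only [← Finset.sum_mul]
    have h1 : ∀ m, ∑ j, (C i j : ℝ) * (D j m : ℝ) = if i = m then 1 else 0 := by
      intro m
      have := congrFun (congrFun h i) m
      rw [Matrix.mul_apply, Matrix.one_apply] at this
      have h2 := congrArg (Int.cast (R := ℝ)) this
      push_cast at h2
      exact h2
    simp [h1]
  have hg : ∀ x : E n, integerAffineMap l (γ x) = x := by
    intro x
    ext i
    rw [integerAffineMap_apply]
    simp only [l, hγ, mul_add, Finset.sum_add_distrib]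
    rw [key B A hBA]
    push_cast
    ring
  refine ⟨integerAffineMap l, γ, ?_, mapsTo_image γ Q, ⟨?_, fun x _ => hg x⟩,
    isIntegerPL_of_forall l (fun x i => integerAffineMap_apply l x i) _,
    isIntegerPL_of_forall (fun i => (A i, t i)) hγ _⟩
  · rintro _ ⟨x, hx, rfl⟩
    rwa [hg]
  · rintro _ ⟨x, hx, rfl⟩
    rw [hg]

theorem embed_apply (x : E n) (i : Fin (n + 1)) :
    embed x i = ∑ j : Fin n, ((if j.castSucc = i then 1 else 0 : ℤ) : ℝ) * x j + ((0 : ℤ) : ℝ) := by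
  refine Fin.lastCases ?_ (fun i => ?_) i
  · simp [embed, (Fin.castSucc_lt_last _).ne]
  · simp [embed]

theorem embed_eq_integerAffineMap : (embed : E n → E (n + 1)) =
    integerAffineMap (fun i => (fun j => if j.castSucc = i then 1 else 0, 0)) := by
  ext x i
  rw [embed_apply, integerAffineMap_apply]

theorem embed_castSucc (x : E n) (i : Fin n) : embed x i.castSucc = x i := by simp [embed]

theorem embed_injective : Function.Injective (embed (n := n)) := by
  intro x y h
  ext i
  rw [← embed_castSucc x, h, embed_castSucc]

theorem isZHomeomorphic_embed (P : Set (E n)) : IsZHomeomorphic P (embed '' P) := by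
  obtain ⟨l, hl⟩ : ∃ l : Fin n → (Fin (n + 1) → ℤ) × ℤ, l = fun i => (Pi.single i.castSucc 1, 0) :=
    ⟨_, rfl⟩
  have hg : ∀ x : E n, integerAffineMap l (embed x) = x := by
    intro x
    ext i
    rw [integerAffineMap_apply]
    simp [hl, Pi.single_apply, embed_castSucc]
  refine ⟨embed, integerAffineMap l, mapsTo_image _ _, ?_, ⟨fun x _ => hg x, ?_⟩,
    isIntegerPL_of_forall (fun i => (fun j => if j.castSucc = i then 1 else 0, 0)) ?_ _,
    isIntegerPL_of_forall l (fun x i => integerAffineMap_apply l x i) _⟩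
  · rintro _ ⟨x, hx, rfl⟩
    rwa [hg]
  · rintro _ ⟨x, hx, rfl⟩
    rw [hg]
  · exact embed_apply

theorem isRationalPoint_embed {x : E n} (hx : IsRationalPoint x) : IsRationalPoint (embed x) := by
  intro i
  refine Fin.lastCases ⟨0, by simp [embed]⟩ (fun i => ?_) i
  rw [embed_castSucc]
  exact hx i

theorem IsRationalPolyhedron.image_affineMap {m : ℕ} {P : Set (E n)} (hP : IsRationalPolyhedron P)
    (A : E n →ᵃ[ℝ] E m) (hA : Function.Injective A)
    (hr : ∀ x, IsRationalPoint x → IsRationalPoint (A x)) : IsRationalPolyhedron (A '' P) := by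
  classical
  obtain ⟨S, hS, hs, rfl⟩ := hP
  refine ⟨(fun s : Finset (E n) => Finset.univ.image fun x : s => A x) '' S, hS.image _, ?_, ?_⟩
  · rintro _ ⟨s, hsS, rfl⟩
    obtain ⟨hne, hind, hrat⟩ := hs s hsS
    have : Nonempty s := hne.to_subtype
    refine ⟨Finset.univ_nonempty.image _, affineIndependent_image (hind.map' A hA), ?_⟩
    rintro ⟨y, hy⟩
    obtain ⟨x, -, rfl⟩ := Finset.mem_image.1 hy
    exact hr x (hrat x)
  · rw [biUnion_image, image_iUnion₂]
    refine iUnion₂_congr fun s _ => ?_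
    have h : ((Finset.univ.image fun x : s => A x : Finset (E m)) : Set (E m)) = A '' s := by
      ext y
      simp
    rw [h, AffineMap.image_convexHull]

theorem isRationalPolyhedron_embed {P : Set (E n)} (hP : IsRationalPolyhedron P) :
    IsRationalPolyhedron (embed '' P) := by
  have hr := fun x (hx : IsRationalPoint x) => isRationalPoint_embed (n := n) hx
  have hi := embed_injective (n := n)
  rw [embed_eq_integerAffineMap] at hr hi ⊢
  exact hP.image_affineMap _ hi hr

end Invariance

/-! ### Valuation, and the measures of single simplexes -/

section Valuation

variable {n : ℕ}

theorem lam_empty (d : ℕ) : lam d (∅ : Set (E n)) = 0 := by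
  have hK : IsRegularTriangulation (⊥ : SimplicialComplex ℝ (E n)) ∅ :=
    ⟨⟨by rw [SimplicialComplex.faces_bot]; exact finite_empty, SimplicialComplex.space_bot⟩,
      fun s hs => by rw [SimplicialComplex.faces_bot] at hs; exact hs.elim⟩
  have h : maxSimplexes (⊥ : SimplicialComplex ℝ (E n)) d = ∅ := by
    ext s
    simp [maxSimplexes, SimplicialComplex.facets_bot]
  rw [hK.lam_eq d, lambdaOf, h, finsum_mem_empty]

theorem IsRationalPolyhedron.dimPart {P : Set (E n)} (hP : IsRationalPolyhedron P) (d : ℕ) :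
    IsRationalPolyhedron (dimPart d P) ∧ lam d P = lam d (dimPart d P) := by
  obtain ⟨K, hK⟩ := hP.exists_isRegularTriangulation
  have h := hK.maxSubcomplex d
  exact ⟨h.isRationalPolyhedron, by rw [hK.lam_eq, h.lam_eq, lambdaOf_maxSubcomplex]⟩

theorem DimLE.union {P Q : Set (E n)} (hP : IsClosed P) (hQ : IsClosed Q) {d : ℕ}
    (hPd : DimLE P d) (hQd : DimLE Q d) : DimLE (P ∪ Q) d := by
  rw [dimLE_iff] at *
  intro h
  obtain ⟨i, hi⟩ := h.exists_of_cover (C := fun b : Bool => cond b P Q)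
    (fun b => by cases b <;> assumption) (by rw [union_eq_iUnion])
  cases i
  · exact hQd (hi.mono inter_subset_left)
  · exact hPd (hi.mono inter_subset_left)

/-- In dimension at most `d`, the rational measure is read off from the number of lattice points in
the cone, and this number is additive. -/
theorem lam_union_add_inter {P Q : Set (E n)} (hP : IsRationalPolyhedron P)
    (hQ : IsRationalPolyhedron Q) {d : ℕ} (hPd : DimLE P d) (hQd : DimLE Q d) :
    lam d P + lam d Q = lam d (P ∪ Q) + lam d (P ∩ Q) := by
  have h1 := (hP.tendsto_of_dimLE hPd).add (hQ.tendsto_of_dimLE hQd)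
  have h2 := ((hP.union hQ).tendsto_of_dimLE
    (hPd.union hP.isCompact.isClosed hQ.isCompact.isClosed hQd)).add
    ((hP.inter hQ).tendsto_of_dimLE fun s hs h => hPd s hs (h.trans inter_subset_left))
  have h3 := tendsto_nhds_unique (h1.congr fun m => ?_) h2
  · have h4 : (d + 1 : ℝ) ≠ 0 := by positivity
    field_simp at h3
    exact h3
  · rw [← add_div, ← add_div]
    have := ncard_conePoints_union_add_inter m hP.isCompact.isBounded hQ.isCompact.isBounded
    congr 1
    exact_mod_cast this.symm

/-- The complex of all faces of one simplex. -/
def simplexComplex (s : Finset (E n)) (hs : AffineIndependent ℝ (fun v : s => (v : E n))) :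
    SimplicialComplex ℝ (E n) where
  faces := {t | t.Nonempty ∧ t ⊆ s}
  isRelLowerSet_faces := by
    rintro t ⟨hne, ht⟩
    exact ⟨hne, fun u hu hune => ⟨hune, (show u ⊆ t from hu).trans ht⟩⟩
  indep := by
    rintro t ⟨-, ht⟩
    exact AffineIndependent.mono (s := (t : Set (E n))) (t := (s : Set (E n))) hs ht
  inter_subset_convexHull := by
    classical
    rintro t t' ⟨-, ht⟩ ⟨-, ht'⟩
    rw [← hs.convexHull_inter ht ht']

theorem IsPartOfBasis.comp {ι κ : Type} {N : ℕ} {v : ι → Fin N → ℤ} (h : IsPartOfBasis v)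
    (e : κ ↪ ι) : IsPartOfBasis (v ∘ e) := by
  obtain ⟨b, f, hb⟩ := h
  exact ⟨b, e.trans f, fun i => hb (e i)⟩

theorem IsRegularSimplex.comp {ι κ : Type} {v : ι → E n} (h : IsRegularSimplex v) (e : κ ↪ ι) :
    IsRegularSimplex (v ∘ e) :=
  ⟨⟨h.1.1.comp_embedding e, fun i => h.1.2 (e i)⟩, h.2.comp e⟩

theorem IsRegularSimplex.of_comp_equiv {ι κ : Type} {v : ι → E n} (e : κ ≃ ι)
    (h : IsRegularSimplex (v ∘ e)) : IsRegularSimplex v := by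
  have := h.comp e.symm.toEmbedding
  have he : (v ∘ e) ∘ e.symm.toEmbedding = v := by ext; simp
  rwa [he] at this

theorem exists_equiv_image {ι : Type} [Fintype ι] {v : ι → E n} (hv : Function.Injective v) :
    ∃ e : ι ≃ (Finset.univ.image v : Finset (E n)), ∀ i, (e i : E n) = v i :=
  ⟨Equiv.ofBijective (fun i => ⟨v i, Finset.mem_image_of_mem v (Finset.mem_univ i)⟩)
    ⟨fun i j h => hv (congrArg Subtype.val h), fun x => by
      obtain ⟨i, -, hi⟩ := Finset.mem_image.1 x.2
      exact ⟨i, Subtype.ext hi⟩⟩, fun _ => rfl⟩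

theorem IsRegularSimplex.image {ι : Type} [Fintype ι] {v : ι → E n} (h : IsRegularSimplex v) :
    IsRegularSimplex (fun x : (Finset.univ.image v : Finset (E n)) => (x : E n)) := by
  obtain ⟨e, he⟩ := exists_equiv_image h.1.1.injective
  exact IsRegularSimplex.of_comp_equiv e (by rwa [show _ ∘ e = v from funext he])

theorem isRegularTriangulation_simplexComplex {s : Finset (E n)}
    (hne : s.Nonempty) (hs : IsRegularSimplex (fun v : s => (v : E n))) :
    IsRegularTriangulation (simplexComplex s hs.1.1) (convexHull ℝ (s : Set (E n))) := by
  refine ⟨⟨(Finset.finite_toSet s.powerset).subset fun t ht =>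
    Finset.mem_coe.2 (Finset.mem_powerset.2 ht.2), subset_antisymm
      (iUnion₂_subset fun t ht => convexHull_mono (Finset.coe_subset.2 ht.2)) ?_⟩, ?_⟩
  · exact SimplicialComplex.convexHull_subset_space (K := simplexComplex s hs.1.1) ⟨hne, subset_rfl⟩
  · rintro t ⟨-, ht⟩
    exact hs.comp ⟨fun v : t => (⟨v, ht v.2⟩ : s), fun v v' h => Subtype.ext
      (congrArg (fun x : s => (x : E n)) h)⟩

/-- The faces of a regular simplex triangulate it, and there is only one maximal face. -/
theorem lam_convexHull {d : ℕ} {v : Fin (d + 1) → E n} (hv : IsRegularSimplex v) :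
    lam d (convexHull ℝ (range v)) = 1 / ((d.factorial : ℝ) * ∏ i, (den (v i) : ℝ)) := by
  classical
  set s := Finset.univ.image v with hs
  have hcard : s.card = d + 1 := by
    rw [hs, Finset.card_image_of_injective _ hv.1.1.injective, Finset.card_fin]
  have hne : s.Nonempty := Finset.card_pos.1 (by omega)
  have hK := isRegularTriangulation_simplexComplex hne hv.image
  have hcoe : (s : Set (E n)) = range v := by simp [hs]
  rw [← hcoe, hK.lam_eq, lambdaOf]
  have hmax : maxSimplexes (simplexComplex s hv.image.1.1) d = {s} := by
    ext t
    rw [mem_maxSimplexes_iff_of_card_le (fun t ht => hcard ▸ Finset.card_le_card ht.2)]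
    constructor
    · rintro ⟨⟨-, ht⟩, htc⟩
      exact Finset.eq_of_subset_of_card_le ht (by omega)
    · rintro rfl
      exact ⟨⟨hne, subset_rfl⟩, hcard⟩
  rw [hmax, finsum_mem_singleton, hs, Finset.prod_image fun _ _ _ _ h => hv.1.1.injective h]
  push_cast
  rfl

theorem den_intPoint (z : Fin n → ℤ) : den (intPoint z) = 1 := by
  have h : IsRationalPoint (intPoint z) := fun i => ⟨z i, by simp [intPoint]⟩
  refine le_antisymm (Nat.sInf_le ⟨one_pos, fun i => ⟨z i, by simp [intPoint]⟩⟩) (den_pos h)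

theorem lam_pyramid {k : ℕ} (hk : 1 ≤ k) {v : Fin (k + 1) → E n} (hv : IsRegularSimplex v)
    (hz : ∃ z : Fin n → ℤ, v 0 = intPoint z) :
    lam k (convexHull ℝ (range v)) =
      lam (k - 1) (convexHull ℝ (range (fun i : Fin k => v i.succ))) / (k : ℝ) := by
  obtain ⟨k, rfl⟩ : ∃ l, k = l + 1 := ⟨k - 1, by omega⟩
  obtain ⟨z, hz⟩ := hz
  have h1 := lam_convexHull (hv.comp (Fin.succEmb (k + 1)))
  change lam (k + 1 - 1) (convexHull ℝ (range fun i : Fin (k + 1) => v i.succ)) = _ at h1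
  rw [lam_convexHull hv, h1, Fin.prod_univ_succ, hz, den_intPoint, Nat.factorial_succ, div_div]
  push_cast
  congr 1
  simp only [Function.comp_apply, Fin.coe_succEmb, one_mul]
  ring

end Valuation

/-! ### Normalization -/

section Normalization

variable {n : ℕ}

theorem sum_functional_coordVec {N : ℕ} {ι : Type*} [Fintype ι]
    (b : Module.Basis ι ℤ (Fin N → ℤ)) (x : Fin N → ℝ) :
    ∑ k, functional (coordVec b k) x • castVec (b k) = x := by
  have hx : x = ∑ j, x j • castVec (Pi.single j 1) := by
    ext k
    simp [Finset.sum_apply, Pi.single_apply]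
  conv_rhs => rw [hx]
  conv_lhs => rw [hx]
  simp only [map_sum, map_smul, functional_coordVec, smul_eq_mul, Finset.sum_smul, mul_smul]
  rw [Finset.sum_comm]
  refine Finset.sum_congr rfl fun j _ => ?_
  rw [← Finset.smul_sum]
  congr 1
  conv_rhs => rw [← b.sum_repr (Pi.single j 1)]
  rw [castVec_sum]
  exact Finset.sum_congr rfl fun k _ => by rw [castVec_smul]; rfl

theorem mem_parallelepipedOf_iff {j : ℕ} {w : Fin j → Fin n → ℤ}
    (b : Module.Basis (Fin n) ℤ (Fin n → ℤ)) (f : Fin j ↪ Fin n) (hb : ∀ i, w i = b (f i))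
    (x : E n) : x ∈ parallelepipedOf w ↔
      (∀ i, 0 ≤ functional (coordVec b (f i)) x ∧ functional (coordVec b (f i)) x ≤ 1) ∧
      ∀ k, k ∉ range f → functional (coordVec b k) x = 0 := by
  classical
  have hint : ∀ (γ : Fin j → ℝ), ((∑ i, γ i • intPoint (w i) : E n) : Fin n → ℝ) =
      ∑ i, γ i • castVec (b (f i)) := by
    intro γ
    ext k
    simp [Finset.sum_apply, intPoint, hb]
  constructor
  · rintro ⟨γ, hγ, rfl⟩
    rw [hint]
    refine ⟨fun i => ?_, fun k hk => ?_⟩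
    · rw [functional_coordVec_sum b f _ _ _ (Finset.mem_univ i)]
      exact hγ i
    · rw [map_sum]
      refine Finset.sum_eq_zero fun i _ => ?_
      have : f i ≠ k := fun h => hk ⟨i, h⟩
      simp [functional_coordVec, this]
  · rintro ⟨h1, h2⟩
    refine ⟨_, h1, ?_⟩
    have h3 : (x : Fin n → ℝ) = ∑ i, functional (coordVec b (f i)) x • castVec (b (f i)) := by
      conv_lhs => rw [← sum_functional_coordVec b x]
      rw [← Finset.sum_subset (Finset.subset_univ (Finset.univ.map f)), Finset.sum_map]
      intro k _ hk
      rw [h2 k (fun ⟨i, hi⟩ => hk (Finset.mem_map.2 ⟨i, Finset.mem_univ i, hi⟩)), zero_smul]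
    rw [← hint] at h3
    exact WithLp.ofLp_injective 2 h3

theorem isBounded_parallelepipedOf {j : ℕ} (w : Fin j → Fin n → ℤ) :
    Bornology.IsBounded (parallelepipedOf w) := by
  have : parallelepipedOf w =
      (fun γ : Fin j → ℝ => ∑ i, γ i • intPoint (w i)) '' Set.pi univ (fun _ => Icc (0 : ℝ) 1) := by
    ext x
    constructor
    · rintro ⟨γ, hγ, rfl⟩
      exact ⟨γ, fun i _ => hγ i, rfl⟩
    · rintro ⟨γ, hγ, rfl⟩
      exact ⟨γ, fun i => hγ i trivial, rfl⟩
  rw [this]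
  exact ((isCompact_univ_pi fun _ => isCompact_Icc).image (by fun_prop)).isBounded

/-- The parallelepiped is a bounded cell: the coordinates along the `wᵢ` lie between `0` and `1`, and
those along the rest of the basis vanish. -/
theorem isRationalPolyhedron_parallelepipedOf {j : ℕ} {w : Fin j → Fin n → ℤ}
    (hw : IsPartOfBasis w) : IsRationalPolyhedron (parallelepipedOf w) := by
  classical
  obtain ⟨b, f, hb⟩ := hw
  let low : Fin n → Fin (n + 1) → ℤ := fun k => Fin.snoc (α := fun _ => ℤ) (coordVec b k) 0
  let up : Fin n → Fin (n + 1) → ℤ := fun k =>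
    Fin.snoc (α := fun _ => ℤ) (-coordVec b k) (if k ∈ range f then 1 else 0)
  have hlow : ∀ k x, functional (low k) (lift x) = functional (coordVec b k) (x : E n) := by
    intro k x
    rw [functional_lift, functional_apply]
    simp [low]
  have hup : ∀ k x, functional (up k) (lift x) =
      (if k ∈ range f then 1 else 0) - functional (coordVec b k) (x : E n) := by
    intro k x
    rw [functional_lift, functional_apply]
    simp only [up, Fin.snoc_castSucc, Fin.snoc_last, Pi.neg_apply, Int.cast_neg, neg_mul,
      Finset.sum_neg_distrib]
    push_cast
    ring
  refine isRationalPolyhedron_of_cells (isBounded_parallelepipedOf w)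
    (finite_singleton (Finset.univ.image low ∪ Finset.univ.image up)) ?_
  ext x
  rw [biUnion_singleton, cell_union, mem_parallelepipedOf_iff b f hb]
  simp only [cell, mem_inter_iff, mem_ofPred_eq, Finset.forall_mem_image, Finset.mem_univ,
    forall_true_left, hlow, hup]
  constructor
  · rintro ⟨h1, h2⟩
    refine ⟨fun k => ?_, fun k => ?_⟩ <;> by_cases hk : k ∈ range f
    · obtain ⟨i, rfl⟩ := hk
      exact (h1 i).1
    · exact (h2 k hk).ge
    · rw [if_pos hk]
      obtain ⟨i, rfl⟩ := hk
      linarith [(h1 i).2]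
    · rw [if_neg hk, h2 k hk, sub_zero]
  · rintro ⟨h1, h2⟩
    refine ⟨fun i => ⟨@h1 (f i), ?_⟩, fun k hk => ?_⟩
    · have := @h2 (f i)
      rw [if_pos ⟨i, rfl⟩] at this
      linarith
    · have := @h2 k
      rw [if_neg hk] at this
      have := @h1 k
      linarith

theorem dimLE_parallelepipedOf {j : ℕ} (w : Fin j → Fin n → ℤ) :
    DimLE (parallelepipedOf w) j := by
  classical
  rw [dimLE_iff]
  intro h
  have h1 := h.lt_card_of_span (T := insert (lift 0) (Finset.univ.image fun i =>
    lift (intPoint (w i)))) ?_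
  · have h2 := Finset.card_insert_le (lift (0 : E n))
      (Finset.univ.image fun i => lift (intPoint (w i)))
    have h3 : (Finset.univ.image fun i => lift (intPoint (w i))).card ≤ j := by
      simpa using Finset.card_image_le (s := Finset.univ) (f := fun i => lift (intPoint (w i)))
    omega
  · rintro _ ⟨γ, -, rfl⟩
    have : lift (∑ i, γ i • intPoint (w i)) =
        ∑ i, γ i • lift (intPoint (w i)) + (1 - ∑ i, γ i) • lift (0 : E n) := by
      ext k
      refine Fin.lastCases ?_ (fun k => ?_) k
      · simp
      · simp [Finset.sum_apply]
    rw [this]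
    refine Submodule.add_mem _ (Submodule.sum_mem _ fun i _ => Submodule.smul_mem _ _
      (Submodule.subset_span ?_)) (Submodule.smul_mem _ _ (Submodule.subset_span ?_))
    · simp
    · simp

/-- The dilate of the parallelepiped by the factor `q + 1` contains `(q + 2) ^ j` lattice points. -/
theorem ncard_conePoints_parallelepipedOf {j : ℕ} {w : Fin j → Fin n → ℤ} (hw : IsPartOfBasis w)
    (m : ℕ) : (conePoints m (parallelepipedOf w)).ncard = ∑ q ∈ Finset.range m, (q + 2) ^ j := by
  classical
  obtain ⟨b, f, hb⟩ := hw
  -- `(q + 1) x` runs through the combinations of the `wᵢ` with coefficients in `{0, …, q + 1}`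
  let T : Finset (Σ _ : ℕ, Fin j → ℕ) := (Finset.range m).sigma fun q =>
    Fintype.piFinset fun _ : Fin j => Finset.range (q + 2)
  have hT : T.card = ∑ q ∈ Finset.range m, (q + 2) ^ j := by
    simp [T, Finset.card_sigma, Fintype.card_piFinset]
  rw [← hT, ← ncard_coe_finset]
  let F : (Σ _ : ℕ, Fin j → ℕ) → Fin (n + 1) → ℤ := fun p =>
    Fin.snoc (α := fun _ => ℤ) (∑ i, (p.2 i : ℤ) • w i) (p.1 + 1)
  have hFlast : ∀ p, F p (Fin.last n) = p.1 + 1 := fun p => by simp [F]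
  have hFcoord : ∀ p k, functional (coordVec b k) (pt (F p) : E n) =
      functional (coordVec b k) (∑ i, (p.2 i : ℝ) • castVec (b (f i))) / (p.1 + 1) := by
    intro p k
    have : ((pt (F p) : E n) : Fin n → ℝ) =
        ((p.1 : ℝ) + 1)⁻¹ • ∑ i, (p.2 i : ℝ) • castVec (b (f i)) := by
      ext l
      simp only [pt, hFlast, F, Fin.snoc_castSucc, Finset.sum_apply, Pi.smul_apply, smul_eq_mul,
        castVec_apply, ← hb]
      push_cast
      rw [div_eq_inv_mul]
    rw [this, map_smul, smul_eq_mul, div_eq_inv_mul]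
  symm
  refine ncard_congr (fun p _ => F p) ?_ ?_ ?_
  · intro p hp
    obtain ⟨hp1, hp2⟩ := Finset.mem_sigma.1 (Finset.mem_coe.1 hp)
    have hp1' := Finset.mem_range.1 hp1
    refine ⟨by rw [hFlast]; omega, by rw [hFlast]; omega, ?_⟩
    rw [mem_parallelepipedOf_iff b f hb]
    have h0 : (0 : ℝ) < p.1 + 1 := by positivity
    refine ⟨fun i => ?_, fun k hk => ?_⟩
    · rw [hFcoord, functional_coordVec_sum b f _ (fun i => (p.2 i : ℝ)) _ (Finset.mem_univ i),
        div_le_one h0]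
      refine ⟨by positivity, ?_⟩
      have := Finset.mem_range.1 (Fintype.mem_piFinset.1 hp2 i)
      have : p.2 i ≤ p.1 + 1 := by omega
      exact_mod_cast this
    · rw [hFcoord, map_sum, Finset.sum_eq_zero, zero_div]
      intro i _
      have : f i ≠ k := fun h => hk ⟨i, h⟩
      simp [functional_coordVec, this]
  · rintro ⟨q, c⟩ ⟨q', c'⟩ _ _ h
    have h1 := congrFun h (Fin.last n)
    simp only [hFlast] at h1
    obtain rfl : q = q' := by omega
    have h2 : ∀ i, c i = c' i := by
      intro i
      have h3 := congrArg (fun y => functional (coordVec b (f i)) (pt y : E n)) h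
      simp only [hFcoord] at h3
      rw [functional_coordVec_sum b f _ (fun i => (c i : ℝ)) _ (Finset.mem_univ i),
        functional_coordVec_sum b f _ (fun i => (c' i : ℝ)) _ (Finset.mem_univ i)] at h3
      have h0 : (q : ℝ) + 1 ≠ 0 := by positivity
      field_simp at h3
      exact_mod_cast h3
    rw [show c = c' from funext h2]
  · rintro y ⟨h0, hm, hy⟩
    rw [mem_parallelepipedOf_iff b f hb] at hy
    set z : Fin n → ℤ := fun i => y i.castSucc with hz
    have h0' : (0 : ℝ) < y (Fin.last n) := by exact_mod_cast h0
    have hpt : ((pt y : E n) : Fin n → ℝ) = (y (Fin.last n) : ℝ)⁻¹ • castVec z := by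
      ext l
      simp only [pt, Pi.smul_apply, castVec_apply, smul_eq_mul, hz]
      rw [div_eq_inv_mul]
    simp only [hpt, map_smul, functional_coordVec, smul_eq_mul, ← div_eq_inv_mul, div_le_one h0',
      le_div_iff₀ h0', zero_mul, div_eq_zero_iff, h0'.ne', or_false] at hy
    have hc0 : ∀ i, 0 ≤ b.coord (f i) z := fun i => by exact_mod_cast (hy.1 i).1
    have hc1 : ∀ i, b.coord (f i) z ≤ y (Fin.last n) := fun i => by exact_mod_cast (hy.1 i).2
    have hc2 : ∀ k, k ∉ range f → b.coord k z = 0 := fun k hk => by exact_mod_cast hy.2 k hk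
    refine ⟨⟨(y (Fin.last n) - 1).toNat, fun i => (b.coord (f i) z).toNat⟩, ?_, ?_⟩
    · refine Finset.mem_coe.2 (Finset.mem_sigma.2 ⟨Finset.mem_range.2 (by simp only; omega),
        Fintype.mem_piFinset.2 fun i => Finset.mem_range.2 ?_⟩)
      have h3 := hc0 i
      have h4 := hc1 i
      simp only
      generalize (b.coord (f i)) z = u at *
      omega
    · ext l
      refine Fin.lastCases ?_ (fun l => ?_) l
      · rw [hFlast]
        simp only
        omega
      · have hsum : ∑ i, (((b.coord (f i) z).toNat : ℕ) : ℤ) • w i = z := by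
          conv_rhs => rw [← b.sum_repr z]
          rw [← Finset.sum_subset (Finset.subset_univ (Finset.univ.map f)), Finset.sum_map]
          · refine Finset.sum_congr rfl fun i _ => ?_
            rw [hb, Int.toNat_of_nonneg (hc0 i)]
            rfl
          · intro k _ hk
            have h5 := hc2 k fun ⟨i, hi⟩ => hk (Finset.mem_map.2 ⟨i, Finset.mem_univ i, hi⟩)
            rw [Module.Basis.coord_apply] at h5
            rw [h5, zero_smul]
        simp only [F, Fin.snoc_castSucc]
        rw [hsum]

/-- The counting function `∑ (q + 2) ^ j` has the leading term `m ^ (j + 1) / (j + 1)`; no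
triangulation of the parallelepiped is needed. -/
theorem lam_parallelepipedOf {j : ℕ} {w : Fin j → Fin n → ℤ} (hw : IsPartOfBasis w) :
    lam j (parallelepipedOf w) = 1 := by
  have h1 := (isRationalPolyhedron_parallelepipedOf hw).tendsto_of_dimLE (dimLE_parallelepipedOf w)
  simp only [ncard_conePoints_parallelepipedOf hw] at h1
  have hj : (0 : ℝ) < j + 1 := by positivity
  have hlow : ∀ m : ℕ, (m : ℝ) ^ (j + 1) ≤
      (j + 1) * ((∑ q ∈ Finset.range m, (q + 2) ^ j : ℕ) : ℝ) := by
    intro m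
    induction m with
    | zero => simp
    | succ m ih =>
      have h := pow_succ_sub_pow_succ_le (x := m + 1) (y := m) (Nat.cast_nonneg m) (by simp) j
      have h' : ((m : ℝ) + 1) ^ j ≤ (m + 2) ^ j := pow_le_pow_left₀ (by positivity) (by linarith) j
      have h'' := mul_le_mul_of_nonneg_left h' hj.le
      rw [Finset.sum_range_succ]
      push_cast at ih ⊢
      have h3 : (j + 1 : ℝ) * (m + 1 - m) * (m + 1) ^ j = (j + 1) * (m + 1) ^ j := by ring
      rw [h3] at h
      rw [mul_add]
      linarith
  have hup : ∀ m : ℕ, (j + 1) * ((∑ q ∈ Finset.range m, (q + 2) ^ j : ℕ) : ℝ) ≤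
      ((m : ℝ) + 2) ^ (j + 1) := by
    intro m
    induction m with
    | zero => simp
    | succ m ih =>
      have h := le_pow_succ_sub_pow_succ (x := m + 3) (y := m + 2) (by positivity) (by linarith) j
      rw [Finset.sum_range_succ]
      push_cast at ih ⊢
      have h3 : (j + 1 : ℝ) * (m + 3 - (m + 2)) * (m + 2) ^ j = (j + 1) * (m + 2) ^ j := by ring
      rw [h3] at h
      rw [mul_add, show (m : ℝ) + 1 + 2 = m + 3 by ring]
      linarith
  have h2 : Filter.Tendsto (fun m : ℕ => ((∑ q ∈ Finset.range m, (q + 2) ^ j : ℕ) : ℝ) /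
      (m : ℝ) ^ (j + 1)) Filter.atTop (nhds (1 / (j + 1))) := by
    have h3 : Filter.Tendsto (fun m : ℕ => (1 + 2 / (m : ℝ)) ^ (j + 1) / (j + 1)) Filter.atTop
        (nhds (1 / (j + 1))) := by
      have := (((tendsto_const_div_atTop_nhds_zero_nat 2).const_add 1).pow (j + 1)).div_const
        (j + 1 : ℝ)
      simpa using this
    refine tendsto_of_tendsto_of_tendsto_of_le_of_le' tendsto_const_nhds h3 ?_ ?_
    · filter_upwards [Filter.eventually_gt_atTop 0] with m hm
      have hm' : (0 : ℝ) < m := by exact_mod_cast hm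
      rw [div_le_div_iff₀ hj (by positivity), one_mul, mul_comm _ (j + 1 : ℝ)]
      exact hlow m
    · filter_upwards [Filter.eventually_gt_atTop 0] with m hm
      have hm' : (0 : ℝ) < m := by exact_mod_cast hm
      rw [div_le_div_iff₀ (by positivity) hj, ← mul_pow, add_mul, one_mul,
        div_mul_cancel₀ _ hm'.ne', mul_comm _ (j + 1 : ℝ)]
      exact hup m
  have h3 := tendsto_nhds_unique h1 h2
  field_simp at h3
  exact h3

end Normalization

/-! ### Volumes of simplexes -/

section Volume

variable {m : ℕ}

/-- The determinant of the matrix whose rows are the vectors `(xᵢ, 1)`, for `m + 1` points of `ℝᵐ`: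
up to sign, `m!` times the volume of the simplex with these vertices. -/
noncomputable def liftDet (x : Fin (m + 1) → E m) : ℝ :=
  (Matrix.of fun i => lift (x i)).det

/-- The linear endomorphism of `ℝᵐ` taking the `i`-th unit vector to the `i`-th edge vector at the
vertex `x 0`. -/
noncomputable def edgeMap (x : Fin (m + 1) → E m) : E m →ₗ[ℝ] E m :=
  Matrix.toLin (EuclideanSpace.basisFun (Fin m) ℝ).toBasis (EuclideanSpace.basisFun (Fin m) ℝ).toBasis
    (Matrix.of fun j i : Fin m => (x i.succ - x 0) j)

theorem edgeMap_single (x : Fin (m + 1) → E m) (i : Fin m) :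
    edgeMap x (EuclideanSpace.single i 1) = x i.succ - x 0 := by
  have h := Matrix.toLin_self (EuclideanSpace.basisFun (Fin m) ℝ).toBasis
    (EuclideanSpace.basisFun (Fin m) ℝ).toBasis (Matrix.of fun j i : Fin m => (x i.succ - x 0) j) i
  simp only [OrthonormalBasis.coe_toBasis, EuclideanSpace.basisFun_apply] at h
  rw [edgeMap, h]
  ext j
  simp [Finset.sum_apply, Pi.single_apply]

theorem abs_det_edgeMap (x : Fin (m + 1) → E m) : |LinearMap.det (edgeMap x)| = |liftDet x| := by
  rw [edgeMap, LinearMap.det_toLin, liftDet]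
  -- Subtracting the first row from the others leaves only one nonzero entry in the last column.
  let B : Matrix (Fin (m + 1)) (Fin (m + 1)) ℝ :=
    Matrix.of (Fin.cons (lift (x 0)) fun i : Fin m => lift (x i.succ) - lift (x 0))
  have h1 : (Matrix.of fun i => lift (x i)).det = B.det := by
    refine Matrix.det_eq_of_forall_row_eq_smul_add_const (Fin.cons 0 fun _ => 1) 0 (by simp) ?_
    intro i j
    refine Fin.cases ?_ (fun i => ?_) i <;> simp [B]
  rw [h1, Matrix.det_succ_column B (Fin.last m), Fin.sum_univ_succ, Finset.sum_eq_zero, add_zero]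
  · rw [abs_mul, abs_mul, abs_pow, abs_neg, abs_one, one_pow, one_mul]
    have h2 : B 0 (Fin.last m) = 1 := by simp [B]
    rw [h2, abs_one, one_mul, ← Matrix.det_transpose]
    congr 2
    ext i j
    simp [B]
  · intro i _
    have h2 : B i.succ (Fin.last m) = 0 := by simp [B]
    rw [h2]
    simp

/-- The simplex is an affine image of the corner simplex spanned by `0` and the unit vectors, whose
volume need not be computed. -/
theorem volume_convexHull_range (x : Fin (m + 1) → E m) :
    volume (convexHull ℝ (range x)) = ENNReal.ofReal |liftDet x| *
      volume (convexHull ℝ (range (Fin.cons 0 fun i => EuclideanSpace.single i 1 :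
        Fin (m + 1) → E m))) := by
  have h1 : range x = (fun y => x 0 + y) '' (edgeMap x '' range (Fin.cons 0 fun i =>
      EuclideanSpace.single i 1 : Fin (m + 1) → E m)) := by
    rw [← range_comp, ← range_comp]
    congr 1
    ext i : 1
    refine Fin.cases ?_ (fun i => ?_) i
    · simp
    · simp [edgeMap_single]
  have h2 : (fun y => x 0 + y) = ⇑(AffineEquiv.constVAdd ℝ (E m) (x 0)).toAffineMap := by
    ext y
    simp
  rw [h1, h2, ← AffineMap.image_convexHull, ← h2, ← LinearMap.image_convexHull, image_add_left,
    measure_preimage_add, Measure.addHaar_image_linearMap, abs_det_edgeMap]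

theorem volume_convexHull_ne_top (s : Set (E m)) (hs : s.Finite) :
    volume (convexHull ℝ s) ≠ ⊤ :=
  (hs.isCompact_convexHull ℝ).measure_lt_top.ne

theorem volume_convexHull_pos {x : Fin (m + 1) → E m} (hx : AffineIndependent ℝ x) :
    0 < volume (convexHull ℝ (range x)) := by
  have h := interior_convexHull_nonempty_iff_affineSpan_eq_top.2
    ((hx.affineSpan_eq_top_iff_card_eq_finrank_add_one).2 (by simp))
  exact (isOpen_interior.measure_pos volume h).trans_le (measure_mono interior_subset)

theorem volume_convexHull_of_card_le {ι : Type*} [Fintype ι] {x : ι → E m}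
    (hx : AffineIndependent ℝ x) (hc : Fintype.card ι ≤ m) :
    volume (convexHull ℝ (range x)) = 0 := by
  refine measure_mono_null (convexHull_subset_affineSpan _) (Measure.addHaar_affineSubspace _ _ ?_)
  intro h
  have h1 := (hx.affineSpan_eq_top_iff_card_eq_finrank_add_one).1 h
  simp at h1
  omega

end Volume

/-! ### Unimodular change between regular simplexes -/

section Unimodular

variable {n : ℕ}

/-- The real coordinates of an integer vector with respect to a part of a basis of `ℤᴺ` are
integers. -/
theorem IsRegularSimplex.exists_homog_eq_sum {k : ℕ} {v v' : Fin k → E n}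
    (hv : IsRegularSimplex v) (hv' : ∀ i, IsRationalPoint (v' i))
    (h : ∀ i, v' i ∈ affineSpan ℝ (range v)) :
    ∃ U : Matrix (Fin k) (Fin k) ℤ, ∀ i, homog (v' i) = ∑ j, U i j • homog (v j) := by
  obtain ⟨b, f, hb⟩ := hv.2
  have h1 : ∀ i, ∃ r : Fin k → ℝ, castVec (homog (v' i)) = ∑ j, r j • castVec (homog (v j)) := by
    intro i
    obtain ⟨w, hw, hwi⟩ := eq_affineCombination_of_mem_affineSpan_of_fintype (h i)
    rw [Finset.affineCombination_eq_linear_combination _ _ _ hw] at hwi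
    refine ⟨fun j => den (v' i) * w j / den (v j), ?_⟩
    rw [castVec_homog (hv' i), hwi, lift_affineCombination _ _ _ hw, Finset.smul_sum]
    refine Finset.sum_congr rfl fun j _ => ?_
    have : (den (v j) : ℝ) ≠ 0 := by exact_mod_cast (den_pos (hv.1.2 j)).ne'
    rw [castVec_homog (hv.1.2 j), smul_smul, smul_smul, ← hwi]
    congr 1
    field_simp
  choose r hr using h1
  refine ⟨Matrix.of fun i j => b.coord (f j) (homog (v' i)), fun i => castVec_injective ?_⟩
  rw [castVec_sum, hr i]
  refine Finset.sum_congr rfl fun j _ => ?_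
  have h2 := functional_coordVec_sum b f Finset.univ (r i) j (Finset.mem_univ j)
  simp only [← hb] at h2
  rw [← hr i, functional_coordVec] at h2
  rw [castVec_smul, Matrix.of_apply, h2]

/-- Two regular simplexes of maximal dimension in the same affine subspace are related by an
integer matrix of determinant `±1`. -/
theorem IsRegularSimplex.exists_unimodular {k : ℕ} {v v' : Fin k → E n}
    (hv : IsRegularSimplex v) (hv' : IsRegularSimplex v')
    (h : affineSpan ℝ (range v) = affineSpan ℝ (range v')) :
    ∃ U : Matrix (Fin k) (Fin k) ℤ, |U.det| = 1 ∧
      ∀ i, homog (v' i) = ∑ j, U i j • homog (v j) := by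
  obtain ⟨U, hU⟩ := hv.exists_homog_eq_sum hv'.1.2
    fun i => h ▸ subset_affineSpan ℝ _ (mem_range_self i)
  obtain ⟨V, hV⟩ := hv'.exists_homog_eq_sum hv.1.2
    fun i => h ▸ subset_affineSpan ℝ _ (mem_range_self i)
  refine ⟨U, ?_, hU⟩
  obtain ⟨b, f, hb⟩ := hv'.2
  have hli : LinearIndependent ℤ (fun i => homog (v' i)) := by
    simp only [hb]
    exact b.linearIndependent.comp _ f.injective
  have hUV : U * V = 1 := by
    ext i l
    have h1 : ∑ l, (U * V) i l • homog (v' l) = ∑ l, (1 : Matrix (Fin k) (Fin k) ℤ) i l • homog (v' l) := by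
      simp only [Matrix.mul_apply, Matrix.one_apply, ite_smul, one_smul, zero_smul,
        Finset.sum_ite_eq, Finset.mem_univ, if_true, Finset.sum_smul]
      rw [Finset.sum_comm]
      conv_rhs => rw [hU i]
      refine Finset.sum_congr rfl fun j _ => ?_
      simp only [mul_smul]
      rw [← Finset.smul_sum, ← hV j]
    have h2 := Fintype.linearIndependent_iff.1 hli (fun l => (U * V) i l - (1 : Matrix _ _ ℤ) i l)
      (by simp only [sub_smul, Finset.sum_sub_distrib, h1, sub_self]) l
    exact sub_eq_zero.1 h2
  exact Int.isUnit_iff_abs_eq.1 (IsUnit.of_mul_eq_one _ (by rw [← Matrix.det_mul, hUV, Matrix.det_one]))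

/-- For points of `ℝᵐ` placed in `ℝⁿ` by an affine map, the determinants of two regular simplexes
are inversely proportional to the products of the denominators. -/
theorem IsRegularSimplex.prod_den_mul_abs_liftDet {m : ℕ} (φ : E m →ᵃ[ℝ] E n)
    (hφ : Function.Injective φ) {x x' : Fin (m + 1) → E m}
    (hx : IsRegularSimplex (φ ∘ x)) (hx' : IsRegularSimplex (φ ∘ x'))
    (h : affineSpan ℝ (range (φ ∘ x)) = affineSpan ℝ (range (φ ∘ x'))) :
    (∏ i, (den (φ (x' i)) : ℝ)) * |liftDet x'| = (∏ i, (den (φ (x i)) : ℝ)) * |liftDet x| := by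
  obtain ⟨U, hdet, hU⟩ := hx.exists_unimodular hx' h
  have key : ∀ i, (den (φ (x' i)) : ℝ) • lift (x' i) =
      ∑ j, ((U i j : ℝ) * den (φ (x j))) • lift (x j) := by
    intro i
    have h1 := congrArg castVec (hU i)
    rw [castVec_sum, castVec_homog (hx'.1.2 i)] at h1
    have h1' : (den (φ (x' i)) : ℝ) • lift (φ (x' i)) =
        ∑ j, ((U i j : ℝ) * den (φ (x j))) • lift (φ (x j)) := by
      rw [show φ (x' i) = (φ ∘ x') i from rfl, h1]
      refine Finset.sum_congr rfl fun j _ => ?_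
      rw [castVec_smul, castVec_homog (hx.1.2 j), smul_smul]
      rfl
    have hd : (den (φ (x' i)) : ℝ) ≠ 0 := by exact_mod_cast (den_pos (hx'.1.2 i)).ne'
    have h2 : lift (φ (x' i)) =
        ∑ j, ((U i j : ℝ) * den (φ (x j)) / den (φ (x' i))) • lift (φ (x j)) := by
      rw [← inv_smul_smul₀ hd (lift (φ (x' i))), h1', Finset.smul_sum]
      refine Finset.sum_congr rfl fun j _ => ?_
      rw [smul_smul]
      congr 1
      field_simp
    have hw : ∑ j, ((U i j : ℝ) * den (φ (x j)) / den (φ (x' i))) = 1 := by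
      have := congrFun h2 (Fin.last n)
      simpa using this.symm
    rw [← lift_affineCombination _ _ _ hw] at h2
    have h3 : x' i = ∑ j, ((U i j : ℝ) * den (φ (x j)) / den (φ (x' i))) • x j := by
      apply hφ
      rw [← Finset.affineCombination_eq_linear_combination _ _ _ hw, Finset.map_affineCombination _ _ _ hw,
        Finset.affineCombination_eq_linear_combination _ _ _ hw]
      exact lift_injective h2
    have h4 := congrArg lift h3
    rw [lift_affineCombination _ _ _ hw] at h4
    rw [h4, Finset.smul_sum]
    refine Finset.sum_congr rfl fun j _ => ?_
    rw [smul_smul]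
    congr 1
    field_simp
  have hmat : Matrix.diagonal (fun i => (den (φ (x' i)) : ℝ)) * Matrix.of (fun i => lift (x' i)) =
      U.map (Int.cast : ℤ → ℝ) * (Matrix.diagonal (fun i => (den (φ (x i)) : ℝ)) *
        Matrix.of (fun i => lift (x i))) := by
    ext i l
    have := congrFun (key i) l
    rw [Matrix.diagonal_mul, Matrix.mul_apply]
    simp only [Matrix.diagonal_mul]
    simpa [Finset.sum_apply, mul_assoc] using this
  have h5 := congrArg (fun M => |Matrix.det M|) hmat
  simp only [Matrix.det_mul, Matrix.det_diagonal, abs_mul] at h5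
  have h6 : |(U.map (Int.cast : ℤ → ℝ)).det| = 1 := by
    have : (U.map (Int.cast : ℤ → ℝ)).det = (U.det : ℝ) := (Int.castRingHom ℝ).map_det U |>.symm
    rw [this, ← Int.cast_abs, hdet, Int.cast_one]
  rw [h6, one_mul] at h5
  simpa [Finset.abs_prod, liftDet] using h5

end Unimodular

/-! ### Proportionality to Hausdorff measure -/

section Hausdorff

variable {n m : ℕ}

theorem exists_affineIsometry_range_eq {A : AffineSubspace ℝ (E n)} (hne : (A : Set (E n)).Nonempty)
    (hm : Module.finrank ℝ A.direction = m) :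
    ∃ φ : E m →ᵃ[ℝ] E n, Isometry φ ∧ range φ = A := by
  obtain ⟨p, hp⟩ := hne
  let e : E m ≃ₗᵢ[ℝ] A.direction :=
    ((stdOrthonormalBasis ℝ A.direction).reindex (finCongr hm)).repr.symm
  let φ : E m →ᵃ[ℝ] E n :=
    (A.direction.subtype ∘ₗ e.toLinearEquiv.toLinearMap).toAffineMap + AffineMap.const ℝ (E m) p
  have hφ : ∀ y, φ y = (e y : E n) + p := fun y => rfl
  refine ⟨φ, ?_, ?_⟩
  · refine Isometry.of_dist_eq fun y z => ?_
    rw [hφ, hφ, dist_add_right, ← Subtype.dist_eq, e.dist_map]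
  · ext z
    constructor
    · rintro ⟨y, rfl⟩
      rw [hφ]
      exact AffineSubspace.vadd_mem_of_mem_direction (e y).2 hp
    · intro hz
      refine ⟨e.symm ⟨z - p, AffineSubspace.vsub_mem_direction hz hp⟩, ?_⟩
      rw [hφ]
      simp

variable {A : AffineSubspace ℝ (E n)}

/-- An isometric chart of `A` turns the Hausdorff measure of simplexes into volume. -/
theorem exists_chart (hne : (A : Set (E n)).Nonempty) (hm : Module.finrank ℝ A.direction = m) :
    ∃ φ : E m →ᵃ[ℝ] E n, Function.Injective φ ∧
      ∀ {ι : Type} (v : ι → E n), (∀ i, v i ∈ A) → ∃ x : ι → E m, v = φ ∘ x ∧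
        μHE[m] (convexHull ℝ (range v)) = volume (convexHull ℝ (range x)) := by
  obtain ⟨φ, hφ, hA⟩ := exists_affineIsometry_range_eq hne hm
  refine ⟨φ, hφ.injective, fun {ι} v hv => ?_⟩
  have h1 : ∀ i, ∃ y, φ y = v i := fun i => by
    have : v i ∈ range φ := hA ▸ hv i
    exact this
  choose x hx using h1
  have h2 : v = φ ∘ x := funext fun i => (hx i).symm
  refine ⟨x, h2, ?_⟩
  rw [h2, range_comp, ← AffineMap.image_convexHull, hφ.euclideanHausdorffMeasure_image,
    EuclideanSpace.euclideanHausdorffMeasure_eq_volume]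

/-- The product of Hausdorff measure and denominators is the same for all regular `m`-simplexes
in `A`. -/
theorem hausdorff_convexHull_mul_prod_den (hm : Module.finrank ℝ A.direction = m)
    {v v' : Fin (m + 1) → E n} (hv : IsRegularSimplex v) (hv' : IsRegularSimplex v')
    (hvA : ∀ i, v i ∈ A) (hvA' : ∀ i, v' i ∈ A) :
    μHE[m] (convexHull ℝ (range v')) * ENNReal.ofReal (∏ i, (den (v' i) : ℝ)) =
      μHE[m] (convexHull ℝ (range v)) * ENNReal.ofReal (∏ i, (den (v i) : ℝ)) := by
  have hspan : ∀ u : Fin (m + 1) → E n, AffineIndependent ℝ u → (∀ i, u i ∈ A) →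
      affineSpan ℝ (range u) = A := fun u hu huA =>
    hu.affineSpan_eq_of_le_of_card_eq_finrank_add_one
      (affineSpan_le.2 (range_subset_iff.2 huA)) (by simp [hm])
  have h := (hspan v hv.1.1 hvA).trans (hspan v' hv'.1.1 hvA').symm
  obtain ⟨φ, hφ, hchart⟩ := exists_chart ⟨v 0, hvA 0⟩ hm
  obtain ⟨x, rfl, hx⟩ := hchart v hvA
  obtain ⟨x', rfl, hx'⟩ := hchart v' hvA'
  have key := IsRegularSimplex.prod_den_mul_abs_liftDet φ hφ hv hv' h
  have h0 : ∀ y : Fin (m + 1) → E m, 0 ≤ ∏ i, (den (φ (y i)) : ℝ) := fun y =>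
    Finset.prod_nonneg fun _ _ => Nat.cast_nonneg _
  rw [hx, hx', volume_convexHull_range x, volume_convexHull_range x', mul_right_comm,
    mul_right_comm (ENNReal.ofReal |liftDet x|), mul_comm (ENNReal.ofReal |liftDet x'|),
    mul_comm (ENNReal.ofReal |liftDet x|)]
  simp only [Function.comp_apply]
  rw [← ENNReal.ofReal_mul (h0 _), ← ENNReal.ofReal_mul (h0 _), key]

theorem hausdorff_convexHull_pos_and_ne_top (hm : Module.finrank ℝ A.direction = m)
    {v : Fin (m + 1) → E n} (hv : AffineIndependent ℝ v) (hvA : ∀ i, v i ∈ A) :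
    0 < μHE[m] (convexHull ℝ (range v)) ∧ μHE[m] (convexHull ℝ (range v)) ≠ ⊤ := by
  obtain ⟨φ, hφ, hchart⟩ := exists_chart ⟨v 0, hvA 0⟩ hm
  obtain ⟨x, rfl, hx⟩ := hchart v hvA
  rw [hx]
  exact ⟨volume_convexHull_pos (hv.of_comp φ), volume_convexHull_ne_top _ (finite_range _)⟩

theorem hausdorff_convexHull_of_card_le (hne : (A : Set (E n)).Nonempty)
    (hm : Module.finrank ℝ A.direction = m) {s : Finset (E n)}
    (hs : AffineIndependent ℝ (fun v : s => (v : E n))) (hsA : (s : Set (E n)) ⊆ A)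
    (hc : s.card ≤ m) : μHE[m] (convexHull ℝ (s : Set (E n))) = 0 := by
  obtain ⟨φ, hφ, hchart⟩ := exists_chart hne hm
  obtain ⟨x, hxs, hx⟩ := hchart (fun v : s => (v : E n)) fun v => hsA v.2
  rw [hxs] at hs
  rw [volume_convexHull_of_card_le (hs.of_comp φ) (by simpa using hc)] at hx
  simpa using hx

/-- Hausdorff measure is additive over the maximal simplexes of a complex. -/
theorem hausdorff_space (hm : Module.finrank ℝ A.direction = m)
    {K : SimplicialComplex ℝ (E n)} (hK : K.faces.Finite) (hKA : K.space ⊆ A) :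
    μHE[m] K.space = ∑ s ∈ hK.toFinset with s.card = m + 1,
      μHE[m] (convexHull ℝ (s : Set (E n))) := by
  classical
  rcases (A : Set (E n)).eq_empty_or_nonempty with hA | hne
  · have h1 : K.space = ∅ := subset_empty_iff.1 (hA ▸ hKA)
    rw [h1, measure_empty, Finset.sum_eq_zero]
    intro s hs
    have hsf := hK.mem_toFinset.1 (Finset.mem_filter.1 hs).1
    have h2 := SimplicialComplex.convexHull_subset_space hsf
    rw [h1] at h2
    rw [subset_empty_iff.1 h2, measure_empty]
  have hsub : ∀ s ∈ K.faces, (s : Set (E n)) ⊆ A := fun s hs =>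
    (subset_convexHull ℝ _).trans ((SimplicialComplex.convexHull_subset_space hs).trans hKA)
  have hnull : ∀ s ∈ K.faces, s.card ≤ m → μHE[m] (convexHull ℝ (s : Set (E n))) = 0 :=
    fun s hs hc => hausdorff_convexHull_of_card_le hne hm (K.indep hs) (hsub s hs) hc
  have hcard : ∀ s ∈ K.faces, s.card ≤ m + 1 := by
    intro s hs
    have h1 := AffineIndependent.card_le_finrank_succ (p := fun v : s => (v : E n)) (K.indep hs)
    have h2 : Module.finrank ℝ (vectorSpan ℝ (range fun v : s => (v : E n))) ≤ m := by
      rw [← hm, ← direction_affineSpan]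
      refine Submodule.finrank_mono (AffineSubspace.direction_le (affineSpan_le.2 ?_))
      simpa using hsub s hs
    rw [Fintype.card_coe] at h1
    omega
  rw [← measure_biUnion_finset₀]
  · refine le_antisymm ?_ (measure_mono (iUnion₂_subset fun s hs =>
      SimplicialComplex.convexHull_subset_space (hK.mem_toFinset.1 (Finset.mem_filter.1 hs).1)))
    have hN : μHE[m] (⋃ s ∈ hK.toFinset.filter (fun s => ¬ s.card = m + 1),
        convexHull ℝ (s : Set (E n))) = 0 := by
      refine (measure_biUnion_null_iff (Finset.countable_toSet _)).2 fun s hs => ?_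
      obtain ⟨h1, h2⟩ := Finset.mem_filter.1 (Finset.mem_coe.1 hs)
      have h3 := hK.mem_toFinset.1 h1
      exact hnull s h3 (by have := hcard s h3; omega)
    have hcover : K.space ⊆ (⋃ s ∈ hK.toFinset.filter (fun s => s.card = m + 1),
        convexHull ℝ (s : Set (E n))) ∪ ⋃ s ∈ hK.toFinset.filter (fun s => ¬ s.card = m + 1),
        convexHull ℝ (s : Set (E n)) := by
      intro y hy
      obtain ⟨s, hs, hys⟩ := SimplicialComplex.mem_space_iff.1 hy
      by_cases h : s.card = m + 1
      · exact Or.inl (mem_iUnion₂.2 ⟨s, by simp [hs, h], hys⟩)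
      · exact Or.inr (mem_iUnion₂.2 ⟨s, by simp [hs, h], hys⟩)
    exact (measure_mono hcover).trans ((measure_union_le _ _).trans_eq (by rw [hN, add_zero]))
  · intro s hs t ht hst
    simp only [Finset.coe_filter, Finite.mem_toFinset, mem_ofPred_eq] at hs ht
    change μHE[m] (convexHull ℝ (s : Set (E n)) ∩ convexHull ℝ (t : Set (E n))) = 0
    have h1 := K.convexHull_inter_convexHull hs.1 ht.1
    rw [h1, ← Finset.coe_inter]
    rcases (s ∩ t).eq_empty_or_nonempty with h | h
    · simp [h]
    · refine hnull _ (K.down_closed hs.1 Finset.inter_subset_left h) ?_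
      have : (s ∩ t).card < s.card := Finset.card_lt_card
        (Finset.ssubset_iff_subset_ne.2 ⟨Finset.inter_subset_left, fun he => hst
          (Finset.eq_of_subset_of_card_le (Finset.inter_eq_left.1 he) (by omega))⟩)
      omega
  · intro s _
    exact (isCompact_convexHull_finset s).isClosed.measurableSet.nullMeasurableSet

/-- On an `m`-dimensional affine subspace, the contribution of a regular `m`-simplex to the rational
measure is a constant multiple of its Hausdorff measure. -/
theorem exists_hausdorff_constant (hm : Module.finrank ℝ A.direction = m) :
    ∃ κ : ℝ, 0 < κ ∧ ∀ v : Fin (m + 1) → E n, IsRegularSimplex v → (∀ i, v i ∈ A) →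
      ENNReal.ofReal (1 / ((m.factorial : ℝ) * ∏ i, (den (v i) : ℝ))) =
        ENNReal.ofReal κ * μHE[m] (convexHull ℝ (range v)) := by
  by_cases h : ∃ v : Fin (m + 1) → E n, IsRegularSimplex v ∧ ∀ i, v i ∈ A
  swap
  -- without a regular `m`-simplex in `A`, any constant will do
  · push Not at h
    refine ⟨1, one_pos, fun v hv hvA => ?_⟩
    obtain ⟨i, hi⟩ := h v hv
    exact (hi (hvA i)).elim
  obtain ⟨v, hv, hvA⟩ := h
  have hden : ∀ u : Fin (m + 1) → E n, IsRegularSimplex u → 0 < ∏ i, (den (u i) : ℝ) :=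
    fun u hu => Finset.prod_pos fun i _ => Nat.cast_pos.2 (den_pos (hu.1.2 i))
  obtain ⟨hpos, htop⟩ := hausdorff_convexHull_pos_and_ne_top hm hv.1.1 hvA
  obtain ⟨h0, hh0, hv0⟩ : ∃ r : ℝ, 0 < r ∧ μHE[m] (convexHull ℝ (range v)) = ENNReal.ofReal r :=
    ⟨_, ENNReal.toReal_pos hpos.ne' htop, (ENNReal.ofReal_toReal htop).symm⟩
  have hf : (0 : ℝ) < m.factorial := Nat.cast_pos.2 m.factorial_pos
  have hd := hden v hv
  refine ⟨1 / (m.factorial * (h0 * ∏ i, (den (v i) : ℝ))), by positivity, fun u hu huA => ?_⟩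
  have key := hausdorff_convexHull_mul_prod_den hm hv hu hvA huA
  obtain ⟨-, htop'⟩ := hausdorff_convexHull_pos_and_ne_top hm hu.1.1 huA
  have hd' := hden u hu
  rw [← ENNReal.ofReal_toReal htop', hv0, ← ENNReal.ofReal_mul ENNReal.toReal_nonneg,
    ← ENNReal.ofReal_mul hh0.le, ENNReal.ofReal_eq_ofReal_iff (by positivity) (by positivity)] at key
  rw [← ENNReal.ofReal_toReal htop', ← ENNReal.ofReal_mul (by positivity), ← key]
  congr 1
  have h1 : (μHE[m] (convexHull ℝ (range u))).toReal ≠ 0 := by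
    intro h1
    rw [h1, zero_mul] at key
    have : 0 < h0 * ∏ i, (den (v i) : ℝ) := by positivity
    exact this.ne key
  field_simp

theorem exists_lam_eq_hausdorff (hm : Module.finrank ℝ A.direction = m) :
    ∃ κ : ℝ, 0 < κ ∧ ∀ v : Fin (m + 1) → E n, IsRationalSimplex v →
      convexHull ℝ (range v) ⊆ (A : Set (E n)) →
        ENNReal.ofReal (lam m (convexHull ℝ (range v))) =
          ENNReal.ofReal κ * μHE[m] (convexHull ℝ (range v)) := by
  classical
  obtain ⟨κ, hκ, h⟩ := exists_hausdorff_constant (A := A) hm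
  refine ⟨κ, hκ, fun v hv hvA => ?_⟩
  have hP : IsRationalPolyhedron (convexHull ℝ (range v)) := by
    have := isRationalPolyhedron_convexHull (s := Finset.univ.image v)
      (Finset.univ_nonempty.image v) ⟨affineIndependent_image hv.1, ?_⟩
    · simpa using this
    · rintro ⟨y, hy⟩
      obtain ⟨i, -, rfl⟩ := Finset.mem_image.1 hy
      exact hv.2 i
  obtain ⟨K, hK⟩ := hP.exists_isRegularTriangulation
  have hsub : ∀ s ∈ K.faces, (s : Set (E n)) ⊆ convexHull ℝ (range v) := fun s hs =>
    (subset_convexHull ℝ _).trans (hK.1.2 ▸ SimplicialComplex.convexHull_subset_space hs)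
  have hcard : ∀ s ∈ K.faces, s.card ≤ m + 1 := by
    intro s hs
    have h1 := (HasSimplex.of_finset (K.indep hs) (d := s.card - 1)
      (by have := Finset.card_pos.2 (K.nonempty_of_mem_faces hs); omega) subset_rfl).mono
      (convexHull_min (hsub s hs) (convex_convexHull ℝ _))
    have h2 : HasSimplex (s.card - 1)
      (convexHull ℝ ((Finset.univ.image v : Finset (E n)) : Set (E n))) := by simpa using h1
    have h3 := h2.lt_card
    have h4 := Finset.card_image_le (s := Finset.univ) (f := v)
    rw [Finset.card_fin] at h4
    omega
  rw [hK.lam_eq, lambdaOf_eq_sum hK.1.1 hcard, ENNReal.ofReal_sum_of_nonneg fun s _ => by positivity]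
  conv_rhs => rw [← hK.1.2, hausdorff_space hm hK.1.1 (hK.1.2 ▸ hvA), Finset.mul_sum]
  refine Finset.sum_congr rfl fun s hs => ?_
  obtain ⟨hsK, hsc⟩ := Finset.mem_filter.1 hs
  have hsf := hK.1.1.mem_toFinset.1 hsK
  let e := (s.equivFinOfCardEq hsc).symm
  have h1 := h (fun i => (e i : E n)) ((hK.2 s hsf).comp e.toEmbedding)
    fun i => hvA (hsub s hsf (e i).2)
  have h2 : range (fun i => (e i : E n)) = s := by
    rw [show (fun i => (e i : E n)) = Subtype.val ∘ e from rfl, e.surjective.range_comp]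
    simp
  have h3 : ∏ i, (den (e i : E n) : ℝ) = ((∏ v ∈ s, den v : ℕ) : ℝ) := by
    rw [e.prod_comp (fun x : s => (den (x : E n) : ℝ)), Finset.prod_coe_sort s (fun x => (den x : ℝ))]
    push_cast
    rfl
  rwa [h2, h3] at h1

end Hausdorff

end RationalMeasure

theorem theorem4p2 (n : ℕ) (hn : 1 ≤ n) :
    -- the rational measures and the dimensional parts are well defined
    (∀ P : Set (E n), IsRationalPolyhedron P →
      (∃ K : SimplicialComplex ℝ (E n), IsRegularTriangulation K P) ∧
      (∀ (d : ℕ) (K : SimplicialComplex ℝ (E n)), IsRegularTriangulation K P →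
        lam d P = lambdaOf d K) ∧
      (∀ d : ℕ, 0 ≤ lam d P) ∧
      (∀ (i : ℕ) (K : SimplicialComplex ℝ (E n)), IsTriangulation K P →
        dimPart i P = maxSimplexUnion K i)) ∧
    -- (i) invariance under the affine group, and under all `ℤ`-homeomorphisms
    (∀ (d : ℕ) (P Q : Set (E n)), IsRationalPolyhedron P → IsRationalPolyhedron Q →
      ∀ γ ∈ affineGroup n, P = γ '' Q → lam d P = lam d Q) ∧
    (∀ (d m : ℕ), 1 ≤ m → ∀ (P : Set (E n)) (Q : Set (E m)),
      IsRationalPolyhedron P → IsRationalPolyhedron Q → IsZHomeomorphic P Q →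
      lam d P = lam d Q) ∧
    -- (ii) valuation
    (∀ d : ℕ, lam d (∅ : Set (E n)) = 0) ∧
    (∀ (d : ℕ) (P : Set (E n)), IsRationalPolyhedron P →
      IsRationalPolyhedron (dimPart d P) ∧ lam d P = lam d (dimPart d P)) ∧
    (∀ (d : ℕ) (P Q : Set (E n)), IsRationalPolyhedron P → IsRationalPolyhedron Q →
      DimLE P d → DimLE Q d →
      IsRationalPolyhedron (P ∪ Q) ∧ IsRationalPolyhedron (P ∩ Q) ∧
      lam d P + lam d Q = lam d (P ∪ Q) + lam d (P ∩ Q)) ∧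
    -- (iii) conservativity
    (∀ (d : ℕ) (P : Set (E n)), IsRationalPolyhedron P →
      IsRationalPolyhedron (embed '' P) ∧ lam d P = lam d (embed '' P)) ∧
    -- (iv) pyramid
    (∀ k : ℕ, 1 ≤ k → k ≤ n → ∀ v : Fin (k + 1) → E n, IsRegularSimplex v →
      (∃ z : Fin n → ℤ, v 0 = intPoint z) →
      lam k (convexHull ℝ (range v)) =
        lam (k - 1) (convexHull ℝ (range (fun i : Fin k => v i.succ))) / (k : ℝ)) ∧
    -- (v) normalization
    (∀ j : ℕ, 1 ≤ j → j ≤ n → ∀ w : Fin j → (Fin n → ℤ), IsPartOfBasis w →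
      IsRationalPolyhedron (parallelepipedOf w) ∧ lam j (parallelepipedOf w) = 1) ∧
    -- (vi) proportionality to the (Euclidean normalized) Hausdorff measure
    (∀ m : ℕ, m ≤ n → ∀ A : AffineSubspace ℝ (E n), IsRationalAffineSubspace A →
      (A : Set (E n)).Nonempty → Module.finrank ℝ A.direction = m →
      ∃ κ : ℝ, 0 < κ ∧ ∀ v : Fin (m + 1) → E n, IsRationalSimplex v →
        convexHull ℝ (range v) ⊆ (A : Set (E n)) →
        ENNReal.ofReal (lam m (convexHull ℝ (range v))) =
          ENNReal.ofReal κ * μHE[m] (convexHull ℝ (range v))) := by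
  refine ⟨fun P hP => ⟨hP.exists_isRegularTriangulation, fun d K hK => hK.lam_eq d, fun d => ?_,
      fun i K hK => hK.dimPart_eq i⟩, fun d P Q hP hQ γ hγ h => ?_,
    fun d m _ P Q hP hQ h => h.lam_eq hP hQ d, lam_empty, fun d P hP => hP.dimPart d,
    fun d P Q hP hQ hPd hQd => ⟨hP.union hQ, hP.inter hQ, lam_union_add_inter hP hQ hPd hQd⟩,
    fun d P hP => ⟨isRationalPolyhedron_embed hP,
      (isZHomeomorphic_embed P).lam_eq hP (isRationalPolyhedron_embed hP) d⟩,
    fun k hk _ v hv hz => lam_pyramid hk hv hz,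
    fun j _ _ w hw => ⟨isRationalPolyhedron_parallelepipedOf hw, lam_parallelepipedOf hw⟩,
    fun m _ A _ _ hm => exists_lam_eq_hausdorff hm⟩
  · obtain ⟨K, hK⟩ := hP.exists_isRegularTriangulation
    rw [hK.lam_eq d]
    exact lambdaOf_nonneg d K
  · subst h
    exact (isZHomeomorphic_of_mem_affineGroup hγ Q).lam_eq hP hQ d
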